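/- Let $G$ be a finite group and $C$ a finite cyclic group. For a ring $S$ let $K_0(S)$ be the Grothendieck group of finitely generated projective left $S$-modules and $HH_0(S)=S/[S,S]$, the quotient of $S$ by the additive subgroup generated by all $ab-ba$; the trace map $K_0(S)\to HH_0(S)$ sends $[P]$ to the Hattori–Stallings trace of $\mathrm{id}_P$. Let $A(C)$ be the Burnside ring of $C$ and let $\theta_C\in A(C)\otimes_{\mathbb Z}\mathbb Q$ be the element with $\chi_C(\theta_C)=(\delta_{CD})_{D\le C}$, where $\chi_C\colon A(C)\otimes_{\mathbb Z}\mathbb Q\to\prod_{D\le C}\mathbb Q$ is the isomorphism that sends a finite $C$-set $S$ to $(|S^D|)_D$. The group $A(C)\otimes_{\mathbb Z}\mathbb Q$ acts on $K_0(RC)\otimes_{\mathbb Z}\mathbb Q$ and on $HH_0(RC)\otimes_{\mathbb Z}\mathbb Q$; the action of a finite $C$-set $S$ is induced by the tensor product over $\mathbb Z$ with the permutation module $\mathbb ZS$ (with diagonal $C$-action). Write $\theta_C(M)$ for the image of $\theta_C$ acting on $M$. Consider the following cases for a ring $R$ and a finite group $H$: (i) $R$ is a finite dimensional semisimple algebra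 over a field of characteristic zero; (ii) $R$ is a commutative complete local domain of characteristic zero; (iii) $R$ is a commutative Dedekind domain whose quotient field is an algebraic number field, and $|H|$ is invertible in $R$. If $(R,G)$ is as in (i) or (ii), then the trace map $K_0(RG)\to HH_0(RG)$ is injective. If $(R,G)$ is as in (iii), then it is rationally injective, that is, $K_0(RG)\otimes_{\mathbb Z}\mathbb Q\to HH_0(RG)\otimes_{\mathbb Z}\mathbb Q$ is injective. If $(R,C)$ is as in (i), (ii) or (iii), then the trace map induces an injective map $$\theta_C\big(K_0(RC)\otimes_{\mathbb Z}\mathbb Q\big)\to\theta_C\big(HH_0(RC)\otimes_{\mathbb Z}\mathbb Q\big).$$ If moreover $R\neq 0$ and $(R,C)$ is as in (i) or (iii), then $\theta_C(K_0(RC)\otimes_{\mathbb Z}\mathbb Q)\neq 0$. -/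

import Mathlib

open scoped TensorProduct

noncomputable section

namespace BurnsideTrace

universe u v w

/-! Part 1. The group `HH₀(A) = A / [A, A]` and the Hattori-Stallings trace. -/

section Trace

/-- The additive subgroup `[A, A]` generated by all additive commutators `ab - ba`. -/
def commutatorSubgroup (A : Type u) [Ring A] : AddSubgroup A :=
  AddSubgroup.closure {x | ∃ a b : A, x = a * b - b * a}

/-- Zeroth Hochschild homology over the integers: `HH₀(A) = A / [A, A]`. -/
abbrev HH0 (A : Type u) [Ring A] : Type u := A ⧸ commutatorSubgroup A

/-- The quotient map `A → A / [A, A]`. -/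
def HH0.mk (A : Type u) [Ring A] : A →+ HH0 A := QuotientAddGroup.mk' (commutatorSubgroup A)

variable {A : Type u} [Ring A]

lemma HH0.mk_mul_comm (a b : A) : HH0.mk A (a * b) = HH0.mk A (b * a) := by
  rw [← sub_eq_zero, ← map_sub]
  exact (QuotientAddGroup.eq_zero_iff _).2 (AddSubgroup.subset_closure ⟨a, b, rfl⟩)

lemma HH0.mk_surjective : Function.Surjective (HH0.mk A) :=
  QuotientAddGroup.mk'_surjective _

lemma exists_dualBasis (A : Type u) [Ring A] (P : Type v) [AddCommGroup P] [Module A P]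
    [Module.Finite A P] [Module.Projective A P] :
    ∃ (n : ℕ) (e : Fin n → P) (f : Fin n → P →ₗ[A] A), ∀ x, ∑ i, f i x • e i = x := by
  obtain ⟨n, f, g, -, -, h⟩ := Module.Finite.exists_comp_eq_id_of_projective A P
  refine ⟨n, fun i => f (Pi.single i 1), fun i => (LinearMap.proj i).comp g, fun x => ?_⟩
  conv_rhs => rw [← LinearMap.id_apply (R := A) x, ← h, LinearMap.comp_apply,
    ← Finset.univ_sum_single (g x), map_sum]
  refine Finset.sum_congr rfl fun i _ => ?_
  rw [← map_smul]
  congr 1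
  ext j
  by_cases hj : j = i
  · subst hj; simp
  · simp [hj]

/-- The Hattori-Stallings trace of an endomorphism `φ` of a finitely generated projective left
`A`-module `P`: the class of `∑ᵢ fᵢ (φ eᵢ)` in `A / [A, A]`, for a dual basis `(eᵢ, fᵢ)` of `P`.
By `hsTrace_eq` below it does not depend on the dual basis. -/
def hsTrace (P : Type v) [AddCommGroup P] [Module A P] [Module.Finite A P]
    [Module.Projective A P] : Module.End A P →+ HH0 A where
  toFun φ := ∑ i, HH0.mk A ((exists_dualBasis A P).choose_spec.choose_spec.choose i
    (φ ((exists_dualBasis A P).choose_spec.choose i)))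
  map_zero' := by simp
  map_add' φ ψ := by simp [Finset.sum_add_distrib]

section

variable {P : Type v} [AddCommGroup P] [Module A P]
variable {Q : Type w} [AddCommGroup Q] [Module A Q]

lemma dualBasis_trace_comm {n m : ℕ} {e : Fin n → P} {f : Fin n → P →ₗ[A] A}
    (h : ∀ x, ∑ i, f i x • e i = x) {e' : Fin m → Q} {f' : Fin m → Q →ₗ[A] A}
    (h' : ∀ x, ∑ i, f' i x • e' i = x) (α : P →ₗ[A] Q) (β : Q →ₗ[A] P) :
    ∑ i, HH0.mk A (f i (β (α (e i)))) = ∑ j, HH0.mk A (f' j (α (β (e' j)))) := by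
  have h1 : ∀ i, HH0.mk A (f i (β (α (e i)))) =
      ∑ j, HH0.mk A (f' j (α (e i)) * f i (β (e' j))) := by
    intro i
    conv_lhs => rw [← h' (α (e i))]
    simp
  have h2 : ∀ j, HH0.mk A (f' j (α (β (e' j)))) =
      ∑ i, HH0.mk A (f i (β (e' j)) * f' j (α (e i))) := by
    intro j
    conv_lhs => rw [← h (β (e' j))]
    simp
  simp_rw [h1, h2]
  rw [Finset.sum_comm]
  exact Finset.sum_congr rfl fun j _ => Finset.sum_congr rfl fun i _ => HH0.mk_mul_comm _ _

variable [Module.Finite A P] [Module.Projective A P]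

lemma hsTrace_eq {n : ℕ} {e : Fin n → P} {f : Fin n → P →ₗ[A] A}
    (h : ∀ x, ∑ i, f i x • e i = x) (φ : Module.End A P) :
    hsTrace P φ = ∑ i, HH0.mk A (f i (φ (e i))) :=
  dualBasis_trace_comm (exists_dualBasis A P).choose_spec.choose_spec.choose_spec h φ
    LinearMap.id

variable [Module.Finite A Q] [Module.Projective A Q]

lemma hsTrace_comm (α : P →ₗ[A] Q) (β : Q →ₗ[A] P) :
    hsTrace P (β ∘ₗ α) = hsTrace Q (α ∘ₗ β) :=
  dualBasis_trace_comm (exists_dualBasis A P).choose_spec.choose_spec.choose_spec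
    (exists_dualBasis A Q).choose_spec.choose_spec.choose_spec α β

lemma hsTrace_conj (e : P ≃ₗ[A] Q) (φ : Module.End A P) (ψ : Module.End A Q)
    (h : ∀ x, e (φ x) = ψ (e x)) : hsTrace P φ = hsTrace Q ψ := by
  have h1 : φ = e.symm.toLinearMap ∘ₗ (e.toLinearMap ∘ₗ φ) := by ext x; simp
  have h2 : ψ = (e.toLinearMap ∘ₗ φ) ∘ₗ e.symm.toLinearMap := by ext x; simp [h]
  rw [h1, hsTrace_comm, ← h2]

lemma hsTrace_prodMap (φ : Module.End A P) (ψ : Module.End A Q) :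
    hsTrace (P × Q) (φ.prodMap ψ) = hsTrace P φ + hsTrace Q ψ := by
  have h : φ.prodMap ψ = (LinearMap.inl A P Q ∘ₗ φ) ∘ₗ LinearMap.fst A P Q +
      (LinearMap.inr A P Q ∘ₗ ψ) ∘ₗ LinearMap.snd A P Q := by
    ext x <;> simp
  rw [h, map_add, hsTrace_comm (LinearMap.fst A P Q), hsTrace_comm (LinearMap.snd A P Q)]
  rfl

end

end Trace

/-! Part 2. The group `K₀(A)` and the trace map `K₀(A) → HH₀(A)`. -/

section K0

/-- Finitely generated projective left modules over `A`. -/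
structure FGProj (A : Type u) [Ring A] where
  carrier : Type u
  [grp : AddCommGroup carrier]
  [mod : Module A carrier]
  [fin : Module.Finite A carrier]
  [proj : Module.Projective A carrier]

attribute [instance] FGProj.grp FGProj.mod FGProj.fin FGProj.proj

/-- Isomorphism of finitely generated projective modules. -/
instance FGProj.setoid (A : Type u) [Ring A] : Setoid (FGProj A) where
  r P Q := Nonempty (P.carrier ≃ₗ[A] Q.carrier)
  iseqv := ⟨fun _ => ⟨LinearEquiv.refl _ _⟩, fun ⟨e⟩ => ⟨e.symm⟩,
    fun ⟨e⟩ ⟨f⟩ => ⟨e.trans f⟩⟩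

/-- Isomorphism classes of finitely generated projective left `A`-modules. -/
def ProjClass (A : Type u) [Ring A] : Type (u + 1) := Quotient (FGProj.setoid A)

variable {A : Type u} [Ring A]

/-- The isomorphism class of a finitely generated projective module. -/
def ProjClass.mk (P : Type u) [AddCommGroup P] [Module A P] [Module.Finite A P]
    [Module.Projective A P] : ProjClass A :=
  Quotient.mk (FGProj.setoid A) ⟨P⟩

lemma ProjClass.ind {p : ProjClass A → Prop}
    (h : ∀ (P : Type u) [AddCommGroup P] [Module A P] [Module.Finite A P]
      [Module.Projective A P], p (ProjClass.mk P)) (x : ProjClass A) : p x :=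
  Quotient.inductionOn x fun P => h P.carrier

lemma ProjClass.mk_eq {P Q : Type u} [AddCommGroup P] [Module A P] [Module.Finite A P]
    [Module.Projective A P] [AddCommGroup Q] [Module A Q] [Module.Finite A Q]
    [Module.Projective A Q] (e : P ≃ₗ[A] Q) :
    (ProjClass.mk P : ProjClass A) = ProjClass.mk Q :=
  Quotient.sound ⟨e⟩

/-- Addition of isomorphism classes is induced by the direct sum. -/
instance ProjClass.add : Add (ProjClass A) where
  add := Quotient.map₂ (fun P Q => ⟨P.carrier × Q.carrier⟩)
    fun _ _ ⟨e⟩ _ _ ⟨f⟩ => ⟨e.prodCongr f⟩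

/-- The class of the zero module. -/
instance ProjClass.zero : Zero (ProjClass A) where
  zero := ProjClass.mk PUnit

instance ProjClass.addCommMonoid : AddCommMonoid (ProjClass A) where
  add_assoc := by
    rintro ⟨P⟩ ⟨Q⟩ ⟨S⟩
    exact Quotient.sound ⟨LinearEquiv.prodAssoc A P.carrier Q.carrier S.carrier⟩
  zero_add := by
    rintro ⟨P⟩
    exact Quotient.sound ⟨LinearEquiv.uniqueProd⟩
  add_zero := by
    rintro ⟨P⟩
    exact Quotient.sound ⟨LinearEquiv.prodUnique⟩
  add_comm := by
    rintro ⟨P⟩ ⟨Q⟩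
    exact Quotient.sound ⟨LinearEquiv.prodComm A P.carrier Q.carrier⟩
  nsmul := nsmulRec

lemma ProjClass.mk_add (P Q : Type u) [AddCommGroup P] [Module A P] [Module.Finite A P]
    [Module.Projective A P] [AddCommGroup Q] [Module A Q] [Module.Finite A Q]
    [Module.Projective A Q] :
    (ProjClass.mk P + ProjClass.mk Q : ProjClass A) = ProjClass.mk (P × Q) := rfl

lemma ProjClass.mk_zero (P : Type u) [AddCommGroup P] [Module A P] [Module.Finite A P]
    [Module.Projective A P] [Subsingleton P] : (ProjClass.mk P : ProjClass A) = 0 :=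
  ProjClass.mk_eq (Q := PUnit) ⟨0, 0, fun _ => Subsingleton.elim _ _, fun _ => rfl⟩

/-- `K₀(A)`: the Grothendieck group of the monoid of isomorphism classes of finitely generated
projective left `A`-modules. -/
abbrev K0 (A : Type u) [Ring A] : Type (u + 1) := Algebra.GrothendieckAddGroup (ProjClass A)

/-- The trace on isomorphism classes, `[P] ↦ tr(id_P)`. -/
def ProjClass.trace (A : Type u) [Ring A] : ProjClass A →+ HH0 A where
  toFun := Quotient.lift (fun P => hsTrace P.carrier LinearMap.id)
    fun _ _ ⟨e⟩ => hsTrace_conj e _ _ fun _ => rfl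
  map_zero' := by
    change hsTrace PUnit.{u + 1} (LinearMap.id : PUnit.{u + 1} →ₗ[A] PUnit.{u + 1}) = 0
    rw [show (LinearMap.id : PUnit.{u + 1} →ₗ[A] PUnit.{u + 1}) = 0 from LinearMap.ext fun _ => rfl, map_zero]
  map_add' := by
    rintro ⟨P⟩ ⟨Q⟩
    exact hsTrace_prodMap (LinearMap.id : P.carrier →ₗ[A] P.carrier)
      (LinearMap.id : Q.carrier →ₗ[A] Q.carrier)

/-- The trace map `K₀(A) → HH₀(A)`, that is, the Dennis trace in degree zero: it sends the class
of `P` to the Hattori-Stallings trace of the identity of `P`. -/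
def trace (A : Type u) [Ring A] : K0 A →+ HH0 A :=
  Algebra.GrothendieckAddGroup.lift (ProjClass.trace A)

lemma K0.hom_ext {B : Type*} [AddCommGroup B] {f g : K0 A →+ B}
    (h : ∀ (P : Type u) [AddCommGroup P] [Module A P] [Module.Finite A P]
      [Module.Projective A P], f (Algebra.GrothendieckAddGroup.of (ProjClass.mk P)) =
        g (Algebra.GrothendieckAddGroup.of (ProjClass.mk P))) : f = g := by
  apply Algebra.GrothendieckAddGroup.lift.symm.injective
  ext x
  induction x using ProjClass.ind with
  | h P => exact h P

lemma lift_of {M B : Type*} [AddCommMonoid M] [AddCommGroup B] (f : M →+ B) (x : M) :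
    Algebra.GrothendieckAddGroup.lift f (Algebra.GrothendieckAddGroup.of x) = f x :=
  DFunLike.congr_fun (Algebra.GrothendieckAddGroup.lift.symm_apply_apply f) x

end K0


/-! Part 3. The Burnside group of a finite group and the element `θ_C`. -/

section Burnside

/-- Finite `G`-sets. -/
structure FinGSet (G : Type v) [Group G] where
  carrier : Type v
  [act : MulAction G carrier]
  [fin : Finite carrier]

attribute [instance] FinGSet.act FinGSet.fin

/-- Isomorphism of finite `G`-sets: an equivariant bijection. -/
instance FinGSet.setoid (G : Type v) [Group G] : Setoid (FinGSet G) where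
  r S T := ∃ e : S.carrier ≃ T.carrier, ∀ (g : G) (x : S.carrier), e (g • x) = g • e x
  iseqv := ⟨fun _ => ⟨Equiv.refl _, fun _ _ => rfl⟩,
    fun ⟨e, h⟩ => ⟨e.symm, fun g x => by rw [Equiv.symm_apply_eq, h, e.apply_symm_apply]⟩,
    fun ⟨e, h⟩ ⟨f, k⟩ => ⟨e.trans f, fun g x => by simp [h, k]⟩⟩

/-- Isomorphism classes of finite `G`-sets. -/
def GSetClass (G : Type v) [Group G] : Type (v + 1) := Quotient (FinGSet.setoid G)

variable {G : Type v} [Group G]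

/-- The isomorphism class of a finite `G`-set. -/
def GSetClass.mk (G : Type v) [Group G] (S : Type v) [MulAction G S] [Finite S] : GSetClass G :=
  Quotient.mk (FinGSet.setoid G) ⟨S⟩

lemma GSetClass.mk_eq {S T : Type v} [MulAction G S] [Finite S] [MulAction G T] [Finite T]
    (e : S ≃ T) (h : ∀ (g : G) (x : S), e (g • x) = g • e x) :
    GSetClass.mk G S = GSetClass.mk G T :=
  Quotient.sound ⟨e, h⟩

/-- Addition of isomorphism classes is induced by the disjoint union. -/
instance GSetClass.add : Add (GSetClass G) where
  add := Quotient.map₂ (fun S T => ⟨S.carrier ⊕ T.carrier⟩)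
    fun _ _ ⟨e, h⟩ _ _ ⟨f, k⟩ => ⟨Equiv.sumCongr e f, by
      rintro g (x | x)
      · exact congrArg Sum.inl (h g x)
      · exact congrArg Sum.inr (k g x)⟩

/-- The trivial action on the empty type. -/
instance GSetClass.actionPEmpty : MulAction G PEmpty.{v + 1} where
  smul _ x := x
  one_smul _ := rfl
  mul_smul _ _ _ := rfl

/-- The class of the empty `G`-set. -/
instance GSetClass.zero : Zero (GSetClass G) where
  zero := GSetClass.mk G PEmpty

instance GSetClass.addCommMonoid : AddCommMonoid (GSetClass G) where
  add_assoc := by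
    rintro ⟨S⟩ ⟨T⟩ ⟨U⟩
    exact Quotient.sound ⟨Equiv.sumAssoc S.carrier T.carrier U.carrier, by
      rintro g ((x | x) | x) <;> rfl⟩
  zero_add := by
    rintro ⟨S⟩
    exact Quotient.sound ⟨Equiv.emptySum PEmpty S.carrier, by
      rintro g (x | x)
      · exact x.elim
      · rfl⟩
  add_zero := by
    rintro ⟨S⟩
    exact Quotient.sound ⟨Equiv.sumEmpty S.carrier PEmpty, by
      rintro g (x | x)
      · rfl
      · exact x.elim⟩
  add_comm := by
    rintro ⟨S⟩ ⟨T⟩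
    exact Quotient.sound ⟨Equiv.sumComm S.carrier T.carrier, by
      rintro g (x | x) <;> rfl⟩
  nsmul := nsmulRec

lemma GSetClass.mk_add (S T : Type v) [MulAction G S] [Finite S] [MulAction G T] [Finite T] :
    GSetClass.mk G S + GSetClass.mk G T = GSetClass.mk G (S ⊕ T) := rfl

lemma GSetClass.mk_zero (S : Type v) [MulAction G S] [Finite S] [IsEmpty S] :
    GSetClass.mk G S = 0 :=
  GSetClass.mk_eq (T := PEmpty) (Equiv.equivOfIsEmpty _ _) fun _ x => (IsEmpty.false x).elim

/-- The (additive group of the) Burnside ring `A(G)`: the Grothendieck group of finite `G`-sets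
under disjoint union. Only its additive structure and its action on `K₀` and `HH₀` are needed. -/
abbrev Burnside (G : Type v) [Group G] : Type (v + 1) := Algebra.GrothendieckAddGroup (GSetClass G)

/-- The class `[S]` of a finite `G`-set in the Burnside group. -/
def Burnside.mk (G : Type v) [Group G] (S : Type v) [MulAction G S] [Finite S] : Burnside G :=
  Algebra.GrothendieckAddGroup.of (GSetClass.mk G S)

lemma Burnside.hom_ext {B : Type*} [AddCommGroup B] {f g : Burnside G →+ B}
    (h : ∀ (S : Type v) [MulAction G S] [Finite S],
      f (Burnside.mk G S) = g (Burnside.mk G S)) : f = g := by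
  apply Algebra.GrothendieckAddGroup.lift.symm.injective
  ext x
  obtain ⟨S⟩ := x
  exact h S.carrier

/-- Counting fixed points on isomorphism classes: `[S] ↦ (|S^D|)_D`. -/
def GSetClass.chi (G : Type v) [Group G] : GSetClass G →+ (Subgroup G → ℤ) where
  toFun := Quotient.lift (fun S D => (Nat.card (MulAction.fixedPoints D S.carrier) : ℤ)) <| by
    rintro S T ⟨e, h⟩
    funext D
    refine congrArg Nat.cast (Nat.card_congr (e.subtypeEquiv fun x => ?_))
    simp only [MulAction.mem_fixedPoints]
    refine forall_congr' fun d => ?_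
    rw [Subgroup.smul_def, Subgroup.smul_def, ← h, e.apply_eq_iff_eq]
  map_zero' := by
    funext D
    change ((Nat.card (MulAction.fixedPoints D PEmpty.{v + 1}) : ℕ) : ℤ) = 0
    simp
  map_add' := by
    rintro ⟨S⟩ ⟨T⟩
    funext D
    change ((Nat.card (MulAction.fixedPoints D (S.carrier ⊕ T.carrier)) : ℕ) : ℤ) =
      (Nat.card (MulAction.fixedPoints D S.carrier) : ℤ) +
        (Nat.card (MulAction.fixedPoints D T.carrier) : ℤ)
    rw [← Nat.cast_add, ← Nat.card_sum]
    refine congrArg Nat.cast (Nat.card_congr (Equiv.subtypeSum.trans (Equiv.sumCongr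
      (Equiv.subtypeEquivRight fun x => ?_) (Equiv.subtypeEquivRight fun x => ?_))))
    · exact forall_congr' fun d => Sum.inl_injective.eq_iff
    · exact forall_congr' fun d => Sum.inr_injective.eq_iff

/-- The map `χ_G` counting fixed points, `[S] ↦ (|S^D|)_D`, on the Burnside group. (For abelian
`G` conjugacy classes of subgroups are subgroups.) -/
def chi (G : Type v) [Group G] : Burnside G →+ (Subgroup G → ℤ) :=
  Algebra.GrothendieckAddGroup.lift (GSetClass.chi G)

lemma chi_mk (S : Type v) [MulAction G S] [Finite S] (D : Subgroup G) :
    chi G (Burnside.mk G S) D = Nat.card (MulAction.fixedPoints D S) :=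
  congrFun (lift_of (GSetClass.chi G) (GSetClass.mk G S)) D

/-- The rationalization `χ_G ⊗ ℚ : A(G) ⊗ ℚ → ∏_D ℚ`. -/
def chiQ (G : Type v) [Group G] : ℚ ⊗[ℤ] Burnside G →ₗ[ℚ] (Subgroup G → ℚ) :=
  LinearMap.liftBaseChange ℚ
    (((Int.castAddHom ℚ).compLeft (Subgroup G)).comp (chi G)).toIntLinearMap

lemma chiQ_tmul (q : ℚ) (S : Type v) [MulAction G S] [Finite S] (D : Subgroup G) :
    chiQ G (q ⊗ₜ Burnside.mk G S) D = q * Nat.card (MulAction.fixedPoints D S) := by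
  change q * ((chi G (Burnside.mk G S) D : ℤ) : ℚ) = _
  rw [chi_mk]
  simp

lemma mk_mem_closure [Finite G] (S : Type v) [MulAction G S] [Finite S] :
    Burnside.mk G S ∈
      AddSubgroup.closure (Set.range fun D : Subgroup G => Burnside.mk G (G ⧸ D)) := by
  induction hn : Nat.card S using Nat.strong_induction_on generalizing S with
  | _ n ih =>
    rcases isEmpty_or_nonempty S with hS | ⟨⟨x⟩⟩
    · rw [Burnside.mk, GSetClass.mk_zero, map_zero]
      exact zero_mem _
    · let T : SubMulAction G S :=
        { carrier := {y | y ∉ MulAction.orbit G x}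
          smul_mem' := fun g y hy h => hy (by
            have := MulAction.mem_orbit_of_mem_orbit g⁻¹ h
            rwa [inv_smul_smul] at this) }
      classical
      let e : S ≃ (G ⧸ MulAction.stabilizer G x) ⊕ T :=
        (Equiv.Set.sumCompl (MulAction.orbit G x)).symm.trans
          (Equiv.sumCongr (MulAction.orbitEquivQuotientStabilizer G x) (Equiv.refl _))
      have he : ∀ (g : G) (y : (G ⧸ MulAction.stabilizer G x) ⊕ T),
          e.symm (g • y) = g • e.symm y := by
        rintro g (y | y)
        · induction y using QuotientGroup.induction_on with
          | H h =>
            change ((MulAction.orbitEquivQuotientStabilizer G x).symm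
              (((g * h : G) : G ⧸ MulAction.stabilizer G x)) : S) = g •
                ((MulAction.orbitEquivQuotientStabilizer G x).symm
                  (h : G ⧸ MulAction.stabilizer G x) : S)
            rw [MulAction.orbitEquivQuotientStabilizer_symm_apply,
              MulAction.orbitEquivQuotientStabilizer_symm_apply, mul_smul]
        · rfl
      have h1 : Burnside.mk G S = Burnside.mk G (G ⧸ MulAction.stabilizer G x) +
          Burnside.mk G T := by
        rw [Burnside.mk, Burnside.mk, Burnside.mk, ← map_add, GSetClass.mk_add]
        exact congrArg _ (GSetClass.mk_eq e.symm he).symm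
      rw [h1]
      refine add_mem (AddSubgroup.subset_closure ⟨_, rfl⟩) (ih _ ?_ _ rfl)
      rw [← hn, Nat.card_congr e, Nat.card_sum]
      have : 0 < Nat.card (G ⧸ MulAction.stabilizer G x) := Nat.card_pos
      omega

lemma burnside_closure [Finite G] (x : Burnside G) :
    x ∈ AddSubgroup.closure (Set.range fun D : Subgroup G => Burnside.mk G (G ⧸ D)) := by
  have h : QuotientAddGroup.mk' (AddSubgroup.closure
      (Set.range fun D : Subgroup G => Burnside.mk G (G ⧸ D))) = 0 :=
    Burnside.hom_ext fun S _ _ => (QuotientAddGroup.eq_zero_iff _).2 (mk_mem_closure S)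
  exact (QuotientAddGroup.eq_zero_iff _).1 (DFunLike.congr_fun h x)

/-- The linear map sending the basis vector at `D` to `[G / D]`. -/
def orbitMap (G : Type v) [Group G] [Finite G] : (Subgroup G →₀ ℚ) →ₗ[ℚ] ℚ ⊗[ℤ] Burnside G :=
  Finsupp.linearCombination ℚ fun D => 1 ⊗ₜ Burnside.mk G (G ⧸ D)

lemma orbitMap_surjective [Finite G] : Function.Surjective (orbitMap G) := by
  rw [← LinearMap.range_eq_top, eq_top_iff]
  rintro y -
  induction y using TensorProduct.induction_on with
  | zero => exact zero_mem _
  | add a b ha hb => exact add_mem ha hb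
  | tmul q x =>
    have hx := burnside_closure x
    have : q ⊗ₜ[ℤ] x = q • (1 : ℚ) ⊗ₜ[ℤ] x := by simp [TensorProduct.smul_tmul']
    rw [this]
    refine Submodule.smul_mem _ _ ?_
    clear this
    induction hx using AddSubgroup.closure_induction with
    | mem z hz =>
      obtain ⟨D, rfl⟩ := hz
      exact ⟨Finsupp.single D 1, by simp [orbitMap]⟩
    | zero => rw [TensorProduct.tmul_zero]; exact zero_mem _
    | add a b _ _ ha hb => rw [TensorProduct.tmul_add]; exact add_mem ha hb
    | neg a _ ha => rw [TensorProduct.tmul_neg]; exact neg_mem ha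

lemma card_fixedPoints_quotient (hG : ∀ a b : G, a * b = b * a) (D E : Subgroup G)
    [Decidable (E ≤ D)] :
    Nat.card (MulAction.fixedPoints E (G ⧸ D)) = if E ≤ D then D.index else 0 := by
  have key : ∀ (a : G), (a : G ⧸ D) ∈ MulAction.fixedPoints E (G ⧸ D) ↔ E ≤ D := by
    intro a
    rw [MulAction.mem_fixedPoints]
    constructor
    · intro h g hg
      have h1 : ((g * a : G) : G ⧸ D) = (a : G ⧸ D) := h ⟨g, hg⟩
      rw [eq_comm, QuotientGroup.eq, hG g a, inv_mul_cancel_left] at h1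
      exact h1
    · rintro h ⟨g, hg⟩
      change ((g * a : G) : G ⧸ D) = (a : G ⧸ D)
      rw [eq_comm, QuotientGroup.eq, hG g a, inv_mul_cancel_left]
      exact h hg
  split_ifs with h
  · have : MulAction.fixedPoints E (G ⧸ D) = Set.univ := by
      ext x
      induction x using QuotientGroup.induction_on with
      | H a => simp [key, h]
    rw [this, Nat.card_congr (Equiv.Set.univ _)]
    rfl
  · have : MulAction.fixedPoints E (G ⧸ D) = ∅ := by
      ext x
      induction x using QuotientGroup.induction_on with
      | H a => simp [key, h]
    rw [this]
    simp

lemma chiQ_surjective [Finite G] (hG : ∀ a b : G, a * b = b * a) :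
    Function.Surjective (chiQ G) := by
  classical
  have : Fintype (Subgroup G) := Fintype.ofFinite _
  have key : ∀ D : Subgroup G, Pi.single D (1 : ℚ) ∈ LinearMap.range (chiQ G) := by
    intro D
    induction D using WellFoundedLT.induction with
    | ind D ih =>
      have hi : (D.index : ℚ) ≠ 0 := by exact_mod_cast D.index_ne_zero_of_finite
      have h : Pi.single D (1 : ℚ) = chiQ G ((D.index : ℚ)⁻¹ ⊗ₜ Burnside.mk G (G ⧸ D)) -
          ∑ E ∈ Finset.univ.filter (· < D), Pi.single E (1 : ℚ) := by
        funext E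
        rw [Pi.sub_apply, chiQ_tmul]
        erw [card_fixedPoints_quotient hG]
        rw [Finset.sum_apply]
        simp only [Pi.single_apply, Finset.sum_ite_eq, Finset.mem_filter, Finset.mem_univ,
          true_and]
        rcases eq_or_ne E D with rfl | hE
        · simp [hi]
        · by_cases hle : E ≤ D
          · simp [hE, hle, lt_of_le_of_ne hle hE, hi]
          · simp [hE, hle, show ¬ E < D from fun h => hle h.le]
      rw [h]
      refine sub_mem ⟨_, rfl⟩ (sum_mem fun E hE => ih E ?_)
      simpa using hE
  rw [← LinearMap.range_eq_top, eq_top_iff]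
  rintro y -
  have hy : y = ∑ D, y D • Pi.single D (1 : ℚ) := by
    funext E
    simp [Finset.sum_apply, Pi.single_apply]
  rw [hy]
  exact sum_mem fun D _ => Submodule.smul_mem _ _ (key D)

/-- For a finite abelian group, counting fixed points is an isomorphism after rationalization. -/
lemma chiQ_bijective [Finite G] (hG : ∀ a b : G, a * b = b * a) :
    Function.Bijective (chiQ G) := by
  refine ⟨?_, chiQ_surjective hG⟩
  have hs : Function.Surjective (chiQ G ∘ₗ orbitMap G) :=
    (chiQ_surjective hG).comp orbitMap_surjective
  have hi : Function.Injective (chiQ G ∘ₗ orbitMap G) := by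
    refine (LinearMap.injective_iff_surjective_of_finrank_eq_finrank ?_).2 hs
    have : Fintype (Subgroup G) := Fintype.ofFinite _
    simp
  intro a b hab
  obtain ⟨x, rfl⟩ := orbitMap_surjective a
  obtain ⟨y, rfl⟩ := orbitMap_surjective b
  exact congrArg _ (hi hab)

lemma mul_comm_of_cyclic (C : Type v) [Group C] [IsCyclic C] (a b : C) : a * b = b * a :=
  (IsCyclic.isMulCommutative (α := C)).is_comm.comm a b

/-- `θ_C = (χ_C ⊗ ℚ)⁻¹ ((δ_{CD})_D)` in the rationalized Burnside group of a finite cyclic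
group `C`. -/
def theta (C : Type v) [Group C] [Finite C] [IsCyclic C] : ℚ ⊗[ℤ] Burnside C :=
  open Classical in
  (LinearEquiv.ofBijective (chiQ C) (chiQ_bijective (mul_comm_of_cyclic C))).symm
    (fun D => if D = ⊤ then 1 else 0)

end Burnside

/-! Part 4. The operation `P ↦ ℤS ⊗ P` and the action of the Burnside group. -/

section Action

/-- The abelian group `ℤS ⊗_ℤ P`. -/
def PermTensor (S : Type v) (P : Type w) [AddCommGroup P] : Type (max v w) := (S →₀ ℤ) ⊗[ℤ] P

instance PermTensor.addCommGroup (S : Type v) (P : Type w) [AddCommGroup P] :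
    AddCommGroup (PermTensor S P) :=
  inferInstanceAs (AddCommGroup ((S →₀ ℤ) ⊗[ℤ] P))

/-- The element `s ⊗ x` of `ℤS ⊗ P`. -/
def PermTensor.of {S : Type v} {P : Type w} [AddCommGroup P] (s : S) : P →+ PermTensor S P :=
  (TensorProduct.mk ℤ (S →₀ ℤ) P (Finsupp.single s 1)).toAddMonoidHom

/-- Additive maps out of `ℤS ⊗ P`, given by a family indexed by `S` of additive maps out of `P`. -/
def PermTensor.lift {S : Type v} {P : Type w} [AddCommGroup P] {B : Type*} [AddCommGroup B]
    (f : S → P →+ B) : PermTensor S P →+ B :=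
  (TensorProduct.lift (Finsupp.linearCombination ℤ
    fun s => (f s).toIntLinearMap : (S →₀ ℤ) →ₗ[ℤ] P →ₗ[ℤ] B)).toAddMonoidHom

lemma PermTensor.lift_of {S : Type v} {P : Type w} [AddCommGroup P] {B : Type*} [AddCommGroup B]
    (f : S → P →+ B) (s : S) (x : P) : PermTensor.lift f (PermTensor.of s x) = f s x := by
  change TensorProduct.lift _ (Finsupp.single s 1 ⊗ₜ x) = _
  simp

lemma PermTensor.ind {S : Type v} {P : Type w} [AddCommGroup P] {p : PermTensor S P → Prop}
    (h0 : p 0) (ha : ∀ a b, p a → p b → p (a + b))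
    (h : ∀ s x, p (PermTensor.of s x)) (y : PermTensor S P) : p y := by
  refine TensorProduct.induction_on (motive := p) y h0 (fun a x => ?_) ha
  induction a using Finsupp.induction_linear with
  | zero => rw [TensorProduct.zero_tmul]; exact h0
  | add a b h1 h2 => rw [TensorProduct.add_tmul]; exact ha _ _ h1 h2
  | single s n =>
    have : (Finsupp.single s n) ⊗ₜ[ℤ] x = PermTensor.of s (n • x) := by
      change _ = (Finsupp.single s 1) ⊗ₜ[ℤ] (n • x)
      rw [← TensorProduct.smul_tmul]
      simp
    rw [this]
    exact h _ _

variable {R : Type u} [Ring R] {G : Type v} [Group G]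

/-- The action of the group ring `RG` on `ℤS ⊗ P`, where `R` acts on `P` and `G` acts
diagonally. -/
def PermTensor.actionHom (R : Type u) [Ring R] (G : Type v) [Group G] (S : Type v)
    [MulAction G S] (P : Type w) [AddCommGroup P] [Module (MonoidAlgebra R G) P] :
    MonoidAlgebra R G →+* Module.End ℤ ((S →₀ ℤ) ⊗[ℤ] P) :=
  MonoidAlgebra.liftNCRingHom
    { toFun := fun r => TensorProduct.map LinearMap.id
        (Module.toModuleEnd ℤ P (MonoidAlgebra.single (1 : G) r))
      map_one' := TensorProduct.ext' fun z x => by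
        rw [← MonoidAlgebra.one_def, map_one]
        rfl
      map_mul' := fun a b => TensorProduct.ext' fun z x => by
        rw [← one_mul (1 : G), ← MonoidAlgebra.single_mul_single, map_mul, one_mul]
        rfl
      map_zero' := TensorProduct.ext' fun z x => by
        rw [MonoidAlgebra.single_zero, map_zero, TensorProduct.map_zero_right]
        rfl
      map_add' := fun a b => TensorProduct.ext' fun z x => by
        rw [MonoidAlgebra.single_add, map_add, TensorProduct.map_add_right]
        rfl }
    { toFun := fun g => TensorProduct.map (Finsupp.lmapDomain ℤ ℤ fun s : S => g • s)
        (Module.toModuleEnd ℤ P (MonoidAlgebra.single g (1 : R)))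
      map_one' := TensorProduct.ext' fun z x => by
        change Finsupp.mapDomain (fun s : S => (1 : G) • s) z ⊗ₜ[ℤ]
          (MonoidAlgebra.single (1 : G) (1 : R) • x) = z ⊗ₜ[ℤ] x
        rw [← MonoidAlgebra.one_def, one_smul]
        simp only [one_smul]
        exact congrArg (· ⊗ₜ[ℤ] x) Finsupp.mapDomain_id
      map_mul' := fun a b => TensorProduct.ext' fun z x => by
        change Finsupp.mapDomain (fun s : S => (a * b) • s) z ⊗ₜ[ℤ]
          (MonoidAlgebra.single (a * b) (1 : R) • x) =
          Finsupp.mapDomain (fun s : S => a • s) (Finsupp.mapDomain (fun s : S => b • s) z) ⊗ₜ[ℤ]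
          (MonoidAlgebra.single a (1 : R) • MonoidAlgebra.single b (1 : R) • x)
        rw [← mul_smul (MonoidAlgebra.single a (1 : R)), MonoidAlgebra.single_mul_single, one_mul,
          ← Finsupp.mapDomain_comp]
        simp only [mul_smul, Function.comp_def] }
    (fun r g => TensorProduct.ext' fun z x => by
      change _ ⊗ₜ[ℤ] (MonoidAlgebra.single (1 : G) r • MonoidAlgebra.single g (1 : R) • x) =
        _ ⊗ₜ[ℤ] (MonoidAlgebra.single g (1 : R) • MonoidAlgebra.single (1 : G) r • x)
      rw [← mul_smul, ← mul_smul, MonoidAlgebra.single_mul_single,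
        MonoidAlgebra.single_mul_single, one_mul, one_mul, mul_one, mul_one]
      rfl)

instance PermTensor.module (S : Type v) [MulAction G S] (P : Type w) [AddCommGroup P]
    [Module (MonoidAlgebra R G) P] : Module (MonoidAlgebra R G) (PermTensor S P) :=
  Module.compHom ((S →₀ ℤ) ⊗[ℤ] P) (PermTensor.actionHom R G S P)

variable {S : Type v} [MulAction G S]
variable {P : Type w} [AddCommGroup P] [Module (MonoidAlgebra R G) P]
variable {Q : Type*} [AddCommGroup Q] [Module (MonoidAlgebra R G) Q]

/-- The defining formula `rg (s ⊗ x) = gs ⊗ rgx` of the action. -/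
lemma PermTensor.single_smul_of (g : G) (r : R) (s : S) (x : P) :
    MonoidAlgebra.single g r • PermTensor.of s x =
      PermTensor.of (g • s) (MonoidAlgebra.single g r • x) := by
  change PermTensor.actionHom R G S P (MonoidAlgebra.single g r) (Finsupp.single s 1 ⊗ₜ x) =
    Finsupp.single (g • s) 1 ⊗ₜ[ℤ] (MonoidAlgebra.single g r • x)
  refine (LinearMap.congr_fun (MonoidAlgebra.liftNCRingHom_single _ _ _ g r) _).trans ?_
  change Finsupp.mapDomain (fun s : S => g • s) (Finsupp.single s 1) ⊗ₜ[ℤ]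
    (MonoidAlgebra.single (1 : G) r • MonoidAlgebra.single g (1 : R) • x) = _
  rw [← mul_smul, MonoidAlgebra.single_mul_single, one_mul, mul_one, Finsupp.mapDomain_single]

/-- An additive map is `RG`-linear if it commutes with the elements `rg`. -/
def linearOfSingle (f : P →+ Q)
    (h : ∀ (g : G) (r : R) (x : P), f (MonoidAlgebra.single g r • x) =
      MonoidAlgebra.single g r • f x) : P →ₗ[MonoidAlgebra R G] Q where
  toFun := f
  map_add' := f.map_add
  map_smul' a x := by
    rw [RingHom.id_apply]
    induction a using MonoidAlgebra.induction_linear with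
    | zero => simp
    | add a b ha hb => rw [add_smul, add_smul, map_add, ha, hb]
    | single g r => exact h g r x

/-- The functor `ℤS ⊗ -` on `RG`-linear maps, `φ ↦ id ⊗ φ`. -/
def PermTensor.map (S : Type v) [MulAction G S] (φ : P →ₗ[MonoidAlgebra R G] Q) :
    PermTensor S P →ₗ[MonoidAlgebra R G] PermTensor S Q :=
  linearOfSingle (PermTensor.lift fun s => (PermTensor.of s).comp φ.toAddMonoidHom)
    fun g r y => by
      induction y using PermTensor.ind with
      | h0 => simp
      | ha a b h1 h2 => simp only [smul_add, map_add, h1, h2]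
      | h s x =>
        rw [PermTensor.single_smul_of, PermTensor.lift_of, PermTensor.lift_of]
        simp [PermTensor.single_smul_of]

lemma PermTensor.map_of (φ : P →ₗ[MonoidAlgebra R G] Q) (s : S) (x : P) :
    PermTensor.map S φ (PermTensor.of s x) = PermTensor.of s (φ x) :=
  PermTensor.lift_of _ s x

lemma PermTensor.hom_ext {φ ψ : PermTensor S P →ₗ[MonoidAlgebra R G] Q}
    (h : ∀ s x, φ (PermTensor.of s x) = ψ (PermTensor.of s x)) : φ = ψ := by
  ext y
  induction y using PermTensor.ind with
  | h0 => simp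
  | ha a b h1 h2 => rw [map_add, map_add, h1, h2]
  | h s x => exact h s x

lemma PermTensor.map_id : PermTensor.map S (LinearMap.id : P →ₗ[MonoidAlgebra R G] P) =
    LinearMap.id :=
  PermTensor.hom_ext fun s x => PermTensor.map_of _ s x

lemma PermTensor.map_comp {U : Type*} [AddCommGroup U] [Module (MonoidAlgebra R G) U]
    (ψ : Q →ₗ[MonoidAlgebra R G] U) (φ : P →ₗ[MonoidAlgebra R G] Q) :
    PermTensor.map S (ψ ∘ₗ φ) = PermTensor.map S ψ ∘ₗ PermTensor.map S φ :=
  PermTensor.hom_ext fun s x => by simp [PermTensor.map_of]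

lemma PermTensor.map_add (φ ψ : P →ₗ[MonoidAlgebra R G] Q) :
    PermTensor.map S (φ + ψ) = PermTensor.map S φ + PermTensor.map S ψ :=
  PermTensor.hom_ext fun s x => by simp [PermTensor.map_of]

lemma PermTensor.map_zero :
    PermTensor.map S (0 : P →ₗ[MonoidAlgebra R G] Q) = 0 :=
  PermTensor.hom_ext fun s x => by simp [PermTensor.map_of]

lemma PermTensor.map_sum {ι : Type*} (t : Finset ι) (φ : ι → P →ₗ[MonoidAlgebra R G] Q) :
    PermTensor.map S (∑ i ∈ t, φ i) = ∑ i ∈ t, PermTensor.map S (φ i) :=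
  PermTensor.hom_ext fun s x => by simp [PermTensor.map_of]

lemma fgProj_of_sum {A : Type u} [Ring A] {P : Type v} [AddCommGroup P] [Module A P]
    {Q : Type w} [AddCommGroup Q] [Module A Q] [Module.Finite A Q] [Module.Projective A Q]
    {ι : Type*} [Fintype ι] (α : ι → P →ₗ[A] Q) (β : ι → Q →ₗ[A] P)
    (h : ∑ i, β i ∘ₗ α i = LinearMap.id) : Module.Finite A P ∧ Module.Projective A P := by
  classical
  let b : (ι → Q) →ₗ[A] P := ∑ i, β i ∘ₗ LinearMap.proj i
  have hb : b ∘ₗ LinearMap.pi α = LinearMap.id := by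
    rw [← h]
    ext x
    simp [b]
  have : Module.Projective A (ι → Q) :=
    Module.Projective.of_equiv (DFinsupp.linearEquivFunOnFintype (R := A) (M := fun _ : ι => Q))
  exact ⟨Module.Finite.of_surjective b fun x => ⟨LinearMap.pi α x, LinearMap.congr_fun hb x⟩,
    Module.Projective.of_split (LinearMap.pi α) b hb⟩

/-- The part of an element of `RG` supported on the set of all `g` with `g s = t`. -/
def supportPart (R : Type u) [Ring R] {G : Type v} [Group G] {S : Type v} [MulAction G S]
    (s t : S) : MonoidAlgebra R G →+ MonoidAlgebra R G :=
  open Classical in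
  MonoidAlgebra.liftNC (MonoidAlgebra.singleOneRingHom (R := R) (M := G)).toAddMonoidHom
    fun g => if g • s = t then MonoidAlgebra.single g (1 : R) else 0

open Classical in
lemma supportPart_single (s t : S) (g : G) (r : R) :
    supportPart R s t (MonoidAlgebra.single g r) =
      if g • s = t then MonoidAlgebra.single g r else 0 := by
  rw [supportPart, MonoidAlgebra.liftNC_single]
  change MonoidAlgebra.single (1 : G) r * _ = _
  split_ifs <;> simp [MonoidAlgebra.single_mul_single]

/-- The coordinate functions of `ℤS ⊗ RG` with respect to the basis of all `s ⊗ 1`. -/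
def PermTensor.coord (R : Type u) [Ring R] {G : Type v} [Group G] {S : Type v} [MulAction G S]
    (s : S) : PermTensor S (MonoidAlgebra R G) →ₗ[MonoidAlgebra R G] MonoidAlgebra R G :=
  linearOfSingle (PermTensor.lift fun t => supportPart R s t) fun g r y => by
    classical
    induction y using PermTensor.ind with
    | h0 => simp
    | ha a b h1 h2 => simp only [smul_add, _root_.map_add, h1, h2]
    | h t x =>
      rw [PermTensor.single_smul_of, PermTensor.lift_of, PermTensor.lift_of]
      induction x using MonoidAlgebra.induction_linear with
      | zero => simp
      | add a b ha hb => simp only [smul_add, _root_.map_add, ha, hb]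
      | single h r' =>
        rw [smul_eq_mul, smul_eq_mul, MonoidAlgebra.single_mul_single, supportPart_single,
          supportPart_single, mul_smul, smul_left_cancel_iff]
        split_ifs <;> simp [MonoidAlgebra.single_mul_single]

lemma PermTensor.sum_coord [Fintype S] :
    ∑ s : S, LinearMap.toSpanSingleton (MonoidAlgebra R G) _
      (PermTensor.of s (1 : MonoidAlgebra R G)) ∘ₗ PermTensor.coord R s = LinearMap.id := by
  classical
  refine PermTensor.hom_ext fun t x => ?_
  rw [LinearMap.sum_apply]
  change ∑ s : S, PermTensor.lift (fun t => supportPart R s t) (PermTensor.of t x) •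
    PermTensor.of s (1 : MonoidAlgebra R G) = PermTensor.of t x
  simp only [PermTensor.lift_of]
  induction x using MonoidAlgebra.induction_linear with
  | zero => simp
  | add a b ha hb => simp only [_root_.map_add, add_smul, Finset.sum_add_distrib, ha, hb]
  | single g r =>
    rw [Finset.sum_eq_single (g⁻¹ • t)]
    · rw [supportPart_single, if_pos (smul_inv_smul g t), PermTensor.single_smul_of,
        smul_inv_smul, smul_eq_mul, mul_one]
    · intro s _ hs
      rw [supportPart_single, if_neg fun h => hs (by rw [← h, inv_smul_smul]), zero_smul]
    · simp

lemma PermTensor.fgProj_free (R : Type u) [Ring R] (G : Type v) [Group G] (S : Type v)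
    [MulAction G S] [Finite S] :
    Module.Finite (MonoidAlgebra R G) (PermTensor S (MonoidAlgebra R G)) ∧
      Module.Projective (MonoidAlgebra R G) (PermTensor S (MonoidAlgebra R G)) := by
  have := Fintype.ofFinite S
  exact fgProj_of_sum _ _ (PermTensor.sum_coord (R := R) (G := G) (S := S))

lemma sum_dualBasis {A : Type u} [Ring A] {P : Type v} [AddCommGroup P] [Module A P] {n : ℕ}
    {e : Fin n → P} {f : Fin n → P →ₗ[A] A} (h : ∀ x, ∑ i, f i x • e i = x) :
    ∑ i, LinearMap.toSpanSingleton A P (e i) ∘ₗ f i = LinearMap.id := by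
  ext x
  simp [h]

lemma PermTensor.fgProj (R : Type u) [Ring R] (G : Type v) [Group G] (S : Type v)
    [MulAction G S] [Finite S] (P : Type w) [AddCommGroup P] [Module (MonoidAlgebra R G) P]
    [Module.Finite (MonoidAlgebra R G) P] [Module.Projective (MonoidAlgebra R G) P] :
    Module.Finite (MonoidAlgebra R G) (PermTensor S P) ∧
      Module.Projective (MonoidAlgebra R G) (PermTensor S P) := by
  obtain ⟨n, e, f, h⟩ := exists_dualBasis (MonoidAlgebra R G) P
  obtain ⟨h1, h2⟩ := PermTensor.fgProj_free R G S
  refine fgProj_of_sum (fun i => PermTensor.map S (f i))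
    (fun i => PermTensor.map S (LinearMap.toSpanSingleton _ _ (e i))) ?_
  simp_rw [← PermTensor.map_comp]
  rw [← PermTensor.map_sum, sum_dualBasis h, PermTensor.map_id]

instance PermTensor.finite [Finite S] [Module.Finite (MonoidAlgebra R G) P]
    [Module.Projective (MonoidAlgebra R G) P] :
    Module.Finite (MonoidAlgebra R G) (PermTensor S P) :=
  (PermTensor.fgProj R G S P).1

instance PermTensor.projective [Finite S] [Module.Finite (MonoidAlgebra R G) P]
    [Module.Projective (MonoidAlgebra R G) P] :
    Module.Projective (MonoidAlgebra R G) (PermTensor S P) :=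
  (PermTensor.fgProj R G S P).2

/-- `ℤS ⊗ -` preserves isomorphisms. -/
def PermTensor.congr (S : Type v) [MulAction G S] (e : P ≃ₗ[MonoidAlgebra R G] Q) :
    PermTensor S P ≃ₗ[MonoidAlgebra R G] PermTensor S Q :=
  LinearEquiv.ofLinearMap (PermTensor.map S e.toLinearMap) (PermTensor.map S e.symm.toLinearMap)
    (by rw [← PermTensor.map_comp, LinearEquiv.comp_symm, PermTensor.map_id])
    (by rw [← PermTensor.map_comp, LinearEquiv.symm_comp, PermTensor.map_id])

/-- `ℤS ⊗ -` preserves direct sums. -/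
def PermTensor.prodEquiv (S : Type v) [MulAction G S] (P : Type w) [AddCommGroup P]
    [Module (MonoidAlgebra R G) P] (Q : Type w) [AddCommGroup Q] [Module (MonoidAlgebra R G) Q] :
    PermTensor S (P × Q) ≃ₗ[MonoidAlgebra R G] PermTensor S P × PermTensor S Q :=
  LinearEquiv.ofLinearMap
    ((PermTensor.map S (LinearMap.fst _ P Q)).prod (PermTensor.map S (LinearMap.snd _ P Q)))
    ((PermTensor.map S (LinearMap.inl _ P Q)).coprod (PermTensor.map S (LinearMap.inr _ P Q)))
    (LinearMap.prod_ext
      (PermTensor.hom_ext fun s x => by simp [PermTensor.map_of])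
      (PermTensor.hom_ext fun s x => by simp [PermTensor.map_of]))
    (PermTensor.hom_ext fun s x => by
      obtain ⟨x, y⟩ := x
      simp [PermTensor.map_of, ← _root_.map_add])

/-- The map induced by an equivariant map `S → T`. -/
def PermTensor.mapLeft {S T : Type v} [MulAction G S] [MulAction G T] (e : S → T)
    (he : ∀ (g : G) (s : S), e (g • s) = g • e s) (P : Type w) [AddCommGroup P]
    [Module (MonoidAlgebra R G) P] : PermTensor S P →ₗ[MonoidAlgebra R G] PermTensor T P :=
  linearOfSingle (PermTensor.lift fun s => PermTensor.of (e s)) fun g r y => by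
    induction y using PermTensor.ind with
    | h0 => simp
    | ha a b h1 h2 => simp only [smul_add, _root_.map_add, h1, h2]
    | h s x =>
      rw [PermTensor.single_smul_of, PermTensor.lift_of, PermTensor.lift_of, he,
        PermTensor.single_smul_of]

lemma PermTensor.mapLeft_of {S T : Type v} [MulAction G S] [MulAction G T] (e : S → T)
    (he : ∀ (g : G) (s : S), e (g • s) = g • e s) (s : S) (x : P) :
    PermTensor.mapLeft (R := R) e he P (PermTensor.of s x) = PermTensor.of (e s) x :=
  PermTensor.lift_of _ s x

/-- `ℤS ⊗ P` depends only on the isomorphism class of `S`. -/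
def PermTensor.congrLeft {S T : Type v} [MulAction G S] [MulAction G T] (e : S ≃ T)
    (he : ∀ (g : G) (s : S), e (g • s) = g • e s) (P : Type w) [AddCommGroup P]
    [Module (MonoidAlgebra R G) P] : PermTensor S P ≃ₗ[MonoidAlgebra R G] PermTensor T P :=
  LinearEquiv.ofLinearMap (PermTensor.mapLeft e he P)
    (PermTensor.mapLeft e.symm (fun g s => by rw [Equiv.symm_apply_eq, he, e.apply_symm_apply]) P)
    (PermTensor.hom_ext fun s x => by simp [PermTensor.mapLeft_of])
    (PermTensor.hom_ext fun s x => by simp [PermTensor.mapLeft_of])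

/-- The map `ℤ(S ⊔ T) ⊗ P → ℤS ⊗ P × ℤT ⊗ P`. -/
def PermTensor.sumTo (S T : Type v) [MulAction G S] [MulAction G T] (P : Type w) [AddCommGroup P]
    [Module (MonoidAlgebra R G) P] :
    PermTensor (S ⊕ T) P →ₗ[MonoidAlgebra R G] PermTensor S P × PermTensor T P :=
  linearOfSingle (PermTensor.lift (Sum.elim
    (fun s => (AddMonoidHom.inl (PermTensor S P) (PermTensor T P)).comp (PermTensor.of s))
    (fun t => (AddMonoidHom.inr (PermTensor S P) (PermTensor T P)).comp (PermTensor.of t))))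
    fun g r y => by
    induction y using PermTensor.ind with
    | h0 => simp
    | ha a b h1 h2 => simp only [smul_add, _root_.map_add, h1, h2]
    | h s x =>
      rw [PermTensor.single_smul_of, PermTensor.lift_of, PermTensor.lift_of]
      rcases s with s | s
      · simp [PermTensor.single_smul_of]
      · simp [PermTensor.single_smul_of]

/-- The inclusion of `ℤS ⊗ P` into `ℤ(S ⊔ T) ⊗ P`. -/
def PermTensor.inl (S T : Type v) [MulAction G S] [MulAction G T] (P : Type w) [AddCommGroup P]
    [Module (MonoidAlgebra R G) P] :
    PermTensor S P →ₗ[MonoidAlgebra R G] PermTensor (S ⊕ T) P :=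
  PermTensor.mapLeft Sum.inl (fun _ _ => rfl) P

/-- The inclusion of `ℤT ⊗ P` into `ℤ(S ⊔ T) ⊗ P`. -/
def PermTensor.inr (S T : Type v) [MulAction G S] [MulAction G T] (P : Type w) [AddCommGroup P]
    [Module (MonoidAlgebra R G) P] :
    PermTensor T P →ₗ[MonoidAlgebra R G] PermTensor (S ⊕ T) P :=
  PermTensor.mapLeft Sum.inr (fun _ _ => rfl) P

lemma PermTensor.inl_of {S T : Type v} [MulAction G S] [MulAction G T] (s : S) (x : P) :
    PermTensor.inl (R := R) (G := G) S T P (PermTensor.of s x) = PermTensor.of (Sum.inl s) x :=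
  PermTensor.lift_of _ _ _

lemma PermTensor.inr_of {S T : Type v} [MulAction G S] [MulAction G T] (t : T) (x : P) :
    PermTensor.inr (R := R) (G := G) S T P (PermTensor.of t x) = PermTensor.of (Sum.inr t) x :=
  PermTensor.lift_of _ _ _

lemma PermTensor.sumTo_inl {S T : Type v} [MulAction G S] [MulAction G T] (s : S) (x : P) :
    PermTensor.sumTo (R := R) (G := G) S T P (PermTensor.of (Sum.inl s) x) = (PermTensor.of s x, 0) :=
  PermTensor.lift_of _ _ _

lemma PermTensor.sumTo_inr {S T : Type v} [MulAction G S] [MulAction G T] (t : T) (x : P) :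
    PermTensor.sumTo (R := R) (G := G) S T P (PermTensor.of (Sum.inr t) x) = (0, PermTensor.of t x) :=
  PermTensor.lift_of _ _ _

/-- `ℤ(S ⊔ T) ⊗ P` is the direct sum of `ℤS ⊗ P` and `ℤT ⊗ P`. -/
def PermTensor.sumEquiv (S T : Type v) [MulAction G S] [MulAction G T] (P : Type w)
    [AddCommGroup P] [Module (MonoidAlgebra R G) P] :
    PermTensor (S ⊕ T) P ≃ₗ[MonoidAlgebra R G] PermTensor S P × PermTensor T P :=
  LinearEquiv.ofLinearMap (PermTensor.sumTo S T P)
    ((PermTensor.inl S T P).coprod (PermTensor.inr S T P))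
    (LinearMap.prod_ext
      (PermTensor.hom_ext fun s x => by
        simp [PermTensor.inl_of, PermTensor.sumTo_inl])
      (PermTensor.hom_ext fun s x => by
        simp [PermTensor.inr_of, PermTensor.sumTo_inr]))
    (PermTensor.hom_ext fun s x => by
      rcases s with s | s
      · simp [PermTensor.inl_of, PermTensor.sumTo_inl]
      · simp [PermTensor.inr_of, PermTensor.sumTo_inr])

/-- The action of a finite `G`-set `S` on isomorphism classes, `[P] ↦ [ℤS ⊗ P]`. -/
def ProjClass.act (R : Type u) [Ring R] (G : Type v) [Group G] (S : Type v) [MulAction G S] [Finite S] :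
    ProjClass (MonoidAlgebra R G) →+ ProjClass (MonoidAlgebra R G) where
  toFun := Quotient.lift (fun P => ProjClass.mk (PermTensor S P.carrier))
    fun _ _ ⟨e⟩ => ProjClass.mk_eq (PermTensor.congr S e)
  map_zero' := by
    change ProjClass.mk (PermTensor S PUnit) = 0
    have : Subsingleton (PermTensor S PUnit.{max u v + 1}) := ⟨fun a b => by
      have h : ∀ c : PermTensor S PUnit.{max u v + 1}, c = 0 := fun c => by
        induction c using PermTensor.ind with
        | h0 => rfl
        | ha a b h1 h2 => rw [h1, h2, add_zero]
        | h s x => rw [Subsingleton.elim x 0, map_zero]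
      rw [h a, h b]⟩
    exact ProjClass.mk_zero _
  map_add' := by
    rintro ⟨P⟩ ⟨Q⟩
    exact ProjClass.mk_eq (PermTensor.prodEquiv S P.carrier Q.carrier)

/-- The action of a finite `G`-set `S` on `K₀(RG)`, `[P] ↦ [ℤS ⊗ P]`. -/
def K0.act (R : Type u) [Ring R] (G : Type v) [Group G] (S : Type v) [MulAction G S] [Finite S] :
    K0 (MonoidAlgebra R G) →+ K0 (MonoidAlgebra R G) :=
  Algebra.GrothendieckAddGroup.lift
    (Algebra.GrothendieckAddGroup.of.comp (ProjClass.act R G S))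

lemma K0.act_of (S : Type v) [MulAction G S] [Finite S] (P : Type max u v) [AddCommGroup P]
    [Module (MonoidAlgebra R G) P] [Module.Finite (MonoidAlgebra R G) P]
    [Module.Projective (MonoidAlgebra R G) P] :
    K0.act R G S (Algebra.GrothendieckAddGroup.of (ProjClass.mk P)) =
      Algebra.GrothendieckAddGroup.of (ProjClass.mk (PermTensor S P)) :=
  lift_of _ _

/-- The action of the Burnside group on `K₀(RG)`, which extends `[S] ↦ ([P] ↦ [ℤS ⊗ P])`. -/
def K0.burnsideAct (R : Type u) [Ring R] (G : Type v) [Group G] :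
    Burnside G →+ AddMonoid.End (K0 (MonoidAlgebra R G)) :=
  Algebra.GrothendieckAddGroup.lift (M := GSetClass G)
    { toFun := Quotient.lift (fun S => (K0.act R G S.carrier : AddMonoid.End _))
        fun _ _ ⟨e, he⟩ => K0.hom_ext fun P _ _ _ _ => by
          rw [K0.act_of, K0.act_of, ProjClass.mk_eq (PermTensor.congrLeft e he P)]
      map_zero' := K0.hom_ext fun P _ _ _ _ => by
        change K0.act R G PEmpty _ = 0
        have : Subsingleton (PermTensor PEmpty.{v + 1} P) := ⟨fun a b => by
          have h : ∀ c : PermTensor PEmpty.{v + 1} P, c = 0 := fun c => by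
            induction c using PermTensor.ind with
            | h0 => rfl
            | ha a b h1 h2 => rw [h1, h2, add_zero]
            | h s x => exact s.elim
          rw [h a, h b]⟩
        rw [K0.act_of, ProjClass.mk_zero, map_zero]
      map_add' := by
        rintro ⟨S⟩ ⟨T⟩
        refine K0.hom_ext fun P _ _ _ _ => ?_
        change K0.act R G (S.carrier ⊕ T.carrier) _ =
          K0.act R G S.carrier _ + K0.act R G T.carrier _
        rw [K0.act_of, K0.act_of, K0.act_of, ← map_add, ProjClass.mk_add,
          ProjClass.mk_eq (PermTensor.sumEquiv S.carrier T.carrier P)] }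

/-- Right multiplication by `a`, as an endomorphism of the free left module `A`. -/
def rightMul {A : Type u} [Ring A] (a : A) : Module.End A A := LinearMap.toSpanSingleton A A a

/-- The action of a finite `G`-set `S` on `HH₀(RG)`. A class `[a]` is the trace of right
multiplication by `a` on the free module `RG`, and `S` sends it to the Hattori-Stallings trace of
the induced endomorphism of `ℤS ⊗ RG`. -/
def HH0.act (R : Type u) [Ring R] (G : Type v) [Group G] (S : Type v) [MulAction G S] [Finite S] :
    HH0 (MonoidAlgebra R G) →+ HH0 (MonoidAlgebra R G) :=
  QuotientAddGroup.lift (commutatorSubgroup (MonoidAlgebra R G))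
    { toFun := fun a => hsTrace (PermTensor S (MonoidAlgebra R G))
        (PermTensor.map S (rightMul a))
      map_zero' := by
        rw [rightMul, LinearMap.toSpanSingleton_zero, PermTensor.map_zero, map_zero]
      map_add' := fun a b => by
        rw [rightMul, LinearMap.toSpanSingleton_add, PermTensor.map_add, map_add]
        rfl } <| by
    refine (AddSubgroup.closure_le _).2 ?_
    rintro _ ⟨a, b, rfl⟩
    rw [SetLike.mem_coe, AddMonoidHom.mem_ker, map_sub, sub_eq_zero]
    change hsTrace _ (PermTensor.map S (rightMul (a * b))) =
      hsTrace _ (PermTensor.map S (rightMul (b * a)))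
    have h : ∀ a b : MonoidAlgebra R G, rightMul (a * b) = rightMul b ∘ₗ rightMul a :=
      fun a b => LinearMap.ext fun x => (mul_assoc x a b).symm
    rw [h, h, PermTensor.map_comp, PermTensor.map_comp, hsTrace_comm]

lemma HH0.act_mk (S : Type v) [MulAction G S] [Finite S] (a : MonoidAlgebra R G) :
    HH0.act R G S (HH0.mk _ a) = hsTrace (PermTensor S (MonoidAlgebra R G))
      (PermTensor.map S (rightMul a)) := rfl

lemma HH0.hom_ext {A : Type u} [Ring A] {B : Type*} [AddCommGroup B] {f g : HH0 A →+ B}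
    (h : ∀ a, f (HH0.mk A a) = g (HH0.mk A a)) : f = g := by
  ext x
  exact h x

lemma PermTensor.congrLeft_map {S T : Type v} [MulAction G S] [MulAction G T] (e : S ≃ T)
    (he : ∀ (g : G) (s : S), e (g • s) = g • e s) (φ : P →ₗ[MonoidAlgebra R G] P)
    (y : PermTensor S P) :
    PermTensor.congrLeft (R := R) e he P (PermTensor.map S φ y) =
      PermTensor.map T φ (PermTensor.congrLeft (R := R) e he P y) := by
  change PermTensor.mapLeft (R := R) e he P (PermTensor.map S φ y) =
      PermTensor.map T φ (PermTensor.mapLeft (R := R) e he P y)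
  induction y using PermTensor.ind with
  | h0 => simp only [_root_.map_zero]
  | ha a b h1 h2 => simp only [_root_.map_add, h1, h2]
  | h s x => rw [PermTensor.map_of, PermTensor.mapLeft_of, PermTensor.mapLeft_of,
      PermTensor.map_of]

lemma PermTensor.sumEquiv_map (S T : Type v) [MulAction G S] [MulAction G T]
    (φ : P →ₗ[MonoidAlgebra R G] P) (y : PermTensor (S ⊕ T) P) :
    PermTensor.sumEquiv (R := R) (G := G) S T P (PermTensor.map (S ⊕ T) φ y) =
      (PermTensor.map S φ).prodMap (PermTensor.map T φ)
        (PermTensor.sumEquiv (R := R) (G := G) S T P y) := by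
  change PermTensor.sumTo (R := R) (G := G) S T P (PermTensor.map (S ⊕ T) φ y) =
      (PermTensor.map S φ).prodMap (PermTensor.map T φ)
        (PermTensor.sumTo (R := R) (G := G) S T P y)
  induction y using PermTensor.ind with
  | h0 => simp only [_root_.map_zero]
  | ha a b h1 h2 => simp only [_root_.map_add, h1, h2]
  | h s x =>
    rcases s with s | s
    · rw [PermTensor.map_of, PermTensor.sumTo_inl, PermTensor.sumTo_inl,
        LinearMap.prodMap_apply, PermTensor.map_of, _root_.map_zero]
    · rw [PermTensor.map_of, PermTensor.sumTo_inr, PermTensor.sumTo_inr,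
        LinearMap.prodMap_apply, PermTensor.map_of, _root_.map_zero]

/-- The action of the Burnside group on `HH₀(RG)`. -/
def HH0.burnsideAct (R : Type u) [Ring R] (G : Type v) [Group G] :
    Burnside G →+ AddMonoid.End (HH0 (MonoidAlgebra R G)) :=
  Algebra.GrothendieckAddGroup.lift (M := GSetClass G)
    { toFun := Quotient.lift (fun S => (HH0.act R G S.carrier : AddMonoid.End (HH0 (MonoidAlgebra R G))))
        fun S T h => by
          obtain ⟨e, he⟩ := h
          refine HH0.hom_ext fun a => ?_
          rw [HH0.act_mk, HH0.act_mk]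
          refine hsTrace_conj (PermTensor.congrLeft e he _) _ _ fun y => ?_
          exact PermTensor.congrLeft_map e he (rightMul a) y
      map_zero' := HH0.hom_ext fun a => by
        change HH0.act R G PEmpty _ = 0
        rw [HH0.act_mk, show PermTensor.map PEmpty.{v + 1} (rightMul a) = 0 from
          PermTensor.hom_ext fun s => s.elim, map_zero]
      map_add' := by
        rintro ⟨S⟩ ⟨T⟩
        refine HH0.hom_ext fun a => ?_
        change HH0.act R G (S.carrier ⊕ T.carrier) _ =
          HH0.act R G S.carrier _ + HH0.act R G T.carrier _
        rw [HH0.act_mk, HH0.act_mk, HH0.act_mk, ← hsTrace_prodMap]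
        refine hsTrace_conj (PermTensor.sumEquiv S.carrier T.carrier _) _ _ fun y => ?_
        exact PermTensor.sumEquiv_map S.carrier T.carrier (rightMul a) y }

/-- The trace map commutes with the actions of a finite `G`-set. -/
lemma trace_act (S : Type v) [MulAction G S] [Finite S] (x : K0 (MonoidAlgebra R G)) :
    trace _ (K0.act R G S x) = HH0.act R G S (trace _ x) := by
  refine DFunLike.congr_fun (F := K0 (MonoidAlgebra R G) →+ HH0 (MonoidAlgebra R G))
    (f := (trace _).comp (K0.act R G S)) (g := (HH0.act R G S).comp (trace _))
    (K0.hom_ext fun P _ _ _ _ => ?_) x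
  rw [AddMonoidHom.comp_apply, AddMonoidHom.comp_apply, K0.act_of, trace, lift_of, lift_of]
  change hsTrace (PermTensor S P) LinearMap.id = HH0.act R G S (hsTrace P LinearMap.id)
  obtain ⟨n, e, f, h⟩ := exists_dualBasis (MonoidAlgebra R G) P
  have key : (LinearMap.id : PermTensor S P →ₗ[MonoidAlgebra R G] PermTensor S P) =
      ∑ i, PermTensor.map S (LinearMap.toSpanSingleton (MonoidAlgebra R G) P (e i) ∘ₗ f i) := by
    rw [← PermTensor.map_sum, sum_dualBasis h, PermTensor.map_id]
  rw [hsTrace_eq h, map_sum, key, map_sum]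
  refine Finset.sum_congr rfl fun i _ => ?_
  rw [PermTensor.map_comp, hsTrace_comm, ← PermTensor.map_comp, HH0.act_mk]
  congr 2
  ext
  simp [rightMul]

lemma trace_burnsideAct (b : Burnside G) (x : K0 (MonoidAlgebra R G)) :
    trace _ (K0.burnsideAct R G b x) = HH0.burnsideAct R G b (trace _ x) := by
  refine DFunLike.congr_fun (F := Burnside G →+ HH0 (MonoidAlgebra R G))
    (f := (trace _).comp ((AddMonoidHom.eval x).comp (K0.burnsideAct R G)))
    (g := (AddMonoidHom.eval (trace _ x)).comp (HH0.burnsideAct R G))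
    (Burnside.hom_ext fun S _ _ => ?_) b
  change trace _ (K0.burnsideAct R G (Burnside.mk G S) x) =
    HH0.burnsideAct R G (Burnside.mk G S) (trace _ x)
  have h1 : K0.burnsideAct R G (Burnside.mk G S) = K0.act R G S := lift_of _ _
  have h2 : HH0.burnsideAct R G (Burnside.mk G S) = HH0.act R G S := lift_of _ _
  rw [h1, h2]
  exact trace_act S x

end Action

/-! Part 5. Rationalization, and the images of `θ_C`. -/

section Rational

/-- The rationalization `f ⊗ ℚ` of a homomorphism of abelian groups. -/
def rat {M N : Type*} [AddCommGroup M] [AddCommGroup N] (f : M →+ N) :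
    ℚ ⊗[ℤ] M →ₗ[ℚ] ℚ ⊗[ℤ] N :=
  LinearMap.baseChange ℚ f.toIntLinearMap

/-- The rationalization of an action of an abelian group `B` by endomorphisms of `M`. -/
def ratAct {B M : Type*} [AddCommGroup B] [AddCommGroup M] (f : B →+ AddMonoid.End M) :
    ℚ ⊗[ℤ] B →ₗ[ℚ] Module.End ℚ (ℚ ⊗[ℤ] M) :=
  LinearMap.liftBaseChange ℚ
    (AddMonoidHom.toIntLinearMap
      { toFun := fun b => rat (f b)
        map_zero' := by
          rw [_root_.map_zero]
          exact TensorProduct.AlgebraTensorModule.ext fun q x =>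
          TensorProduct.tmul_zero M q
        map_add' := fun a b => by
          rw [_root_.map_add]
          exact TensorProduct.AlgebraTensorModule.ext fun q x =>
          TensorProduct.tmul_add q (f a x) (f b x) })

lemma ratAct_tmul {B M : Type*} [AddCommGroup B] [AddCommGroup M] (f : B →+ AddMonoid.End M)
    (q q' : ℚ) (b : B) (x : M) :
    ratAct f (q ⊗ₜ b) (q' ⊗ₜ x) = (q * q') ⊗ₜ (f b x) := by
  change q • (q' ⊗ₜ[ℤ] f b x) = _
  rw [TensorProduct.smul_tmul', smul_eq_mul]

variable (R : Type u) [Ring R] (C : Type v) [Group C] [Finite C] [IsCyclic C]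

/-- The endomorphism of `K₀(RC) ⊗ ℚ` given by the action of `θ_C`. -/
def thetaK0 : Module.End ℚ (ℚ ⊗[ℤ] K0 (MonoidAlgebra R C)) :=
  ratAct (K0.burnsideAct R C) (theta C)

/-- The endomorphism of `HH₀(RC) ⊗ ℚ` given by the action of `θ_C`. -/
def thetaHH0 : Module.End ℚ (ℚ ⊗[ℤ] HH0 (MonoidAlgebra R C)) :=
  ratAct (HH0.burnsideAct R C) (theta C)

lemma rat_trace_ratAct {R : Type u} [Ring R] {C : Type v} [Group C] (t : ℚ ⊗[ℤ] Burnside C)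
    (x : ℚ ⊗[ℤ] K0 (MonoidAlgebra R C)) :
    rat (trace _) (ratAct (K0.burnsideAct R C) t x) =
      ratAct (HH0.burnsideAct R C) t (rat (trace _) x) := by
  induction t using TensorProduct.induction_on with
  | zero => simp
  | add a b ha hb => simp only [map_add, LinearMap.add_apply, ha, hb]
  | tmul q b =>
    induction x using TensorProduct.induction_on with
    | zero => simp
    | add a b ha hb => simp only [map_add, ha, hb]
    | tmul q' x =>
      rw [ratAct_tmul]
      change (q * q') ⊗ₜ[ℤ] trace _ (K0.burnsideAct R C b x) =
        ratAct (HH0.burnsideAct R C) (q ⊗ₜ b) (q' ⊗ₜ[ℤ] trace _ x)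
      rw [ratAct_tmul, trace_burnsideAct]

lemma rat_trace_mem (y : ℚ ⊗[ℤ] K0 (MonoidAlgebra R C)) (hy : y ∈ LinearMap.range (thetaK0 R C)) :
    rat (trace (MonoidAlgebra R C)) y ∈ LinearMap.range (thetaHH0 R C) := by
  obtain ⟨x, rfl⟩ := hy
  rw [thetaK0, rat_trace_ratAct, ← thetaHH0]
  exact LinearMap.mem_range_self _ _

/-- The map `θ_C (K₀(RC) ⊗ ℚ) → θ_C (HH₀(RC) ⊗ ℚ)` induced by the trace map. -/
def thetaTrace :
    LinearMap.range (thetaK0 R C) →ₗ[ℚ] LinearMap.range (thetaHH0 R C) :=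
  (rat (trace (MonoidAlgebra R C))).restrict (rat_trace_mem R C)

end Rational

end BurnsideTrace

end

open scoped TensorProduct

noncomputable section

namespace BurnsideTrace

universe u v w

/-! ### Hom-ranks and trace functionals -/

section HomRank

variable {A : Type u} [Ring A] (L : Type*) (V : Type*) [AddCommGroup V] [Module A V]

section Eval

variable {P : Type*} [AddCommGroup P] [Module A P] [DivisionRing L] [Module L V]
  [SMulCommClass A L V]

/-! Everything is detected by ranks of Hom groups. Let `V` be an `A`-module, finite dimensional over
a field `L` that acts by `A`-endomorphisms. Then `a ↦ tr_L(a | V)` kills commutators, so it is a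
functional on `HH₀(A)`, and its composite with the trace map is `[P] ↦ dim_L Hom_A(P, V)`, read in
`L` (`traceFunctional_trace`). Injectivity thus becomes the question whether enough modules `V`
separate `K₀(A)`.

In (i) and (ii), with `A = RG`, every simple module `S` is covered by a finitely generated
projective `P_S` whose proper submodules all lie in the kernel of `P_S → S`. In (i) Maschke's
argument allows `P_S = S`; in (ii) `P_S = Ae`, where the idempotent `e` is lifted from `A` modulo
its radical by Newton iteration. The classes `[P_S]` generate `K₀(A)`, and `Hom_A(P_S, S') = 0`
unless `S ≅ S'`, so the ranks at the simple modules are diagonal. Over scalars of characteristic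
zero this already kills all coefficients.

If the residue characteristic in (ii) is a prime `p`, ranks are visible only modulo `p`. With `L =
End_A(S)` the space `Hom_A(P_S, S)` is a line, so the coefficients of an element of the kernel are
divisible by `p`. As `HH₀(RG)` is torsion free, the quotient by `p` is again in the kernel; hence
the coefficients are divisible by all powers of `p` and vanish. This needs `End_A(S)` to be a field
(`end_comm_of_isSimpleModule`): `S` is the sum of the `R`-translates of a finite simple
`ℤG`-submodule, whose endomorphism ring is commutative by Wedderburn.

In (iii) `RG` is a hereditary order. `K₀(RG)` is generated by irreducible lattices, and two of these
that are linked by a nonzero homomorphism differ by the class of a torsion module. Extension to the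
fraction field and the rank argument then show that the trace kernel is torsion, provided that
torsion modules have torsion classes (`mem_torsion_of_trace_eq_zero`). For a simple torsion module
`T` (`chi0_mem_torsion_of_isSimpleModule`), the centre `W` maps to a number field `L` with kernel
inside the annihilator `m` of `T` in `W`. A prime `p` of the integers of `L` lying under a prime
over `m` gives lattices in `A ⊗_W L` generated by the powers of `p`. Their successive quotients are
killed by `m`, hence have class a multiple of `[T]`, since `T` is determined by `m`. Some power of
`p` is principal and gives back the first lattice up to isomorphism, so a positive multiple of `[T]`
is zero.

The trace map commutes with the Burnside action, so its injectivity passes to the images of `θ_C`.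
For the nonvanishing, let `g` generate `C`: a `C`-set acts on the coefficient at `g` through the
number of its fixed points, so `θ_C` acts there as `1`, and the idempotent `|C|⁻¹ ∑ k` has nonzero
coefficient at `g`. -/

/-- Evaluation of homomorphisms at a finite family of points. -/
def homEval {n : ℕ} (e : Fin n → P) : (P →ₗ[A] V) →ₗ[L] (Fin n → V) where
  toFun h i := h (e i)
  map_add' _ _ := rfl
  map_smul' _ _ := rfl

/-- The homomorphism determined by a family of functionals and a family of vectors. -/
def homOfDual {n : ℕ} (f : Fin n → P →ₗ[A] A) : (Fin n → V) →ₗ[L] (P →ₗ[A] V) where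
  toFun v := ∑ i, LinearMap.toSpanSingleton A V (v i) ∘ₗ f i
  map_add' v w := by
    ext x
    simp [Finset.sum_add_distrib]
  map_smul' c v := by
    ext x
    simp [Finset.smul_sum, smul_comm]

variable {L V} in
lemma homOfDual_apply {n : ℕ} (f : Fin n → P →ₗ[A] A) (v : Fin n → V) (x : P) :
    homOfDual L V f v x = ∑ i, f i x • v i := by
  simp [homOfDual]

lemma homOfDual_homEval {n : ℕ} {e : Fin n → P} {f : Fin n → P →ₗ[A] A}
    (h : ∀ x, ∑ i, f i x • e i = x) :
    homOfDual L V f ∘ₗ homEval L V e = LinearMap.id := by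
  ext g x
  simp only [LinearMap.comp_apply, homOfDual_apply, LinearMap.id_apply]
  conv_rhs => rw [← h x]
  simp [homEval]

instance hom_finite [Module.Finite A P] [Module.Projective A P] [Module.Finite L V] :
    Module.Finite L (P →ₗ[A] V) := by
  obtain ⟨n, e, f, h⟩ := exists_dualBasis A P
  exact Module.Finite.of_surjective (homOfDual L V f) fun g =>
    ⟨homEval L V e g, LinearMap.congr_fun (homOfDual_homEval L V h) g⟩

end Eval

/-- The additive invariant `[P] ↦ dim_L Hom_A(P, V)` on isomorphism classes. -/
def ProjClass.homRank [DivisionRing L] [Module L V] [SMulCommClass A L V] [Module.Finite L V] :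
    ProjClass A →+ ℤ where
  toFun := Quotient.lift (fun P => (Module.finrank L (P.carrier →ₗ[A] V) : ℤ))
    fun P Q ⟨e⟩ => congrArg Nat.cast (LinearEquiv.finrank_eq
      { toFun := fun f => f ∘ₗ e.symm.toLinearMap
        invFun := fun f => f ∘ₗ e.toLinearMap
        map_add' := fun _ _ => rfl
        map_smul' := fun _ _ => rfl
        left_inv := fun f => by ext; simp
        right_inv := fun f => by ext; simp })
  map_zero' := by
    change (Module.finrank L (PUnit.{u + 1} →ₗ[A] V) : ℤ) = 0
    rw [Module.finrank_zero_of_subsingleton]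
    rfl
  map_add' := by
    rintro ⟨P⟩ ⟨Q⟩
    change (Module.finrank L (P.carrier × Q.carrier →ₗ[A] V) : ℤ) =
      Module.finrank L (P.carrier →ₗ[A] V) + Module.finrank L (Q.carrier →ₗ[A] V)
    rw [← (LinearMap.coprodEquiv L).finrank_eq, Module.finrank_prod, Nat.cast_add]

/-- The additive invariant `[P] ↦ dim_L Hom_A(P, V)` on `K₀(A)`. -/
def homRank [DivisionRing L] [Module L V] [SMulCommClass A L V] [Module.Finite L V] :
    K0 A →+ ℤ :=
  Algebra.GrothendieckAddGroup.lift (ProjClass.homRank L V)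

lemma homRank_of [DivisionRing L] [Module L V] [SMulCommClass A L V] [Module.Finite L V]
    (P : Type u) [AddCommGroup P] [Module A P] [Module.Finite A P] [Module.Projective A P] :
    homRank L V (Algebra.GrothendieckAddGroup.of (ProjClass.mk P : ProjClass A)) =
      Module.finrank L (P →ₗ[A] V) :=
  lift_of _ _

variable [Field L] [Module L V] [SMulCommClass A L V]

/-- The functional `[a] ↦ tr_L (a | V)` on `HH₀(A)`. -/
def traceFunctional : HH0 A →+ L :=
  QuotientAddGroup.lift (commutatorSubgroup A)
    ((LinearMap.trace L V).toAddMonoidHom.comp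
      (Module.toModuleEnd L (S := A) V).toAddMonoidHom) <| by
    refine (AddSubgroup.closure_le _).2 ?_
    rintro _ ⟨a, b, rfl⟩
    rw [SetLike.mem_coe, AddMonoidHom.mem_ker, map_sub, sub_eq_zero]
    change LinearMap.trace L V (Module.toModuleEnd L V (a * b)) =
      LinearMap.trace L V (Module.toModuleEnd L V (b * a))
    rw [(Module.toModuleEnd L V).map_mul, (Module.toModuleEnd L V).map_mul,
      LinearMap.trace_mul_comm]

lemma traceFunctional_mk (a : A) :
    traceFunctional L V (HH0.mk A a) = LinearMap.trace L V (Module.toModuleEnd L V a) := rfl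

/-- A dual basis makes `Hom_A(P, V)` a retract of `Vⁿ`, so its dimension is the trace of the
projector `homEval ∘ homOfDual`. That projector is the block matrix of the actions of `fᵢ(eₖ)`; its
diagonal blocks are the actions of the `fᵢ(eᵢ)`, which make up the Hattori-Stallings trace. -/
lemma traceFunctional_hsTrace [Module.Finite L V] (P : Type*) [AddCommGroup P] [Module A P]
    [Module.Finite A P] [Module.Projective A P] :
    traceFunctional L V (hsTrace P (LinearMap.id : P →ₗ[A] P)) =
      (Module.finrank L (P →ₗ[A] V) : L) := by
  obtain ⟨n, e, f, h⟩ := exists_dualBasis A P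
  rw [hsTrace_eq h, map_sum, ← LinearMap.trace_id, ← homOfDual_homEval L V h,
    LinearMap.trace_comp_comm']
  have key : homEval L V e ∘ₗ homOfDual L V f = ∑ i, ∑ j,
      (LinearMap.single L (fun _ : Fin n => V) j ∘ₗ Module.toModuleEnd L V (f i (e j))) ∘ₗ
        LinearMap.proj i := by
    refine LinearMap.ext fun v => funext fun k => ?_
    simp only [LinearMap.comp_apply, LinearMap.sum_apply, Finset.sum_apply]
    change homOfDual L V f v (e k) = _
    rw [homOfDual_apply]
    refine Finset.sum_congr rfl fun i _ => ?_
    rw [Finset.sum_eq_single k]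
    · simp
    · intro j _ hj
      simp [hj.symm]
    · simp
  rw [key, map_sum]
  refine Finset.sum_congr rfl fun i _ => ?_
  -- Cyclicity of the trace puts `proj i` next to `single j`, so only the diagonal blocks survive.
  rw [map_sum, Finset.sum_eq_single i]
  · rw [LinearMap.trace_comp_comm', traceFunctional_mk]
    congr 1
    ext v
    simp
  · intro j _ hj
    rw [LinearMap.trace_comp_comm']
    convert map_zero (LinearMap.trace L V)
    ext v
    simp [hj.symm]
  · simp

lemma traceFunctional_trace [Module.Finite L V] (x : K0 A) :
    traceFunctional L V (trace A x) = (homRank L V x : L) := by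
  refine DFunLike.congr_fun (f := (traceFunctional L V).comp (trace A))
    (g := (Int.castAddHom L).comp (homRank L V)) (K0.hom_ext fun P _ _ _ _ => ?_) x
  rw [AddMonoidHom.comp_apply, AddMonoidHom.comp_apply, homRank_of, trace, lift_of]
  change traceFunctional L V (hsTrace P LinearMap.id) = _
  rw [traceFunctional_hsTrace]
  simp

end HomRank

/-! ### Rationalization -/

lemma rat_injective {M N : Type*} [AddCommGroup M] [AddCommGroup N] {f : M →+ N}
    (hf : Function.Injective f) : Function.Injective (rat f) := by
  have := Module.Flat.lTensor_preserves_injective_linearMap (M := ℚ) f.toIntLinearMap hf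
  exact this

/-- The induced map is a restriction of the rationalized trace map; equivariance has already been
spent on its being well defined. -/
lemma thetaTrace_injective {R : Type u} [Ring R] {C : Type v} [Group C] [Finite C] [IsCyclic C]
    (h : Function.Injective (rat (trace (MonoidAlgebra R C)))) :
    Function.Injective (thetaTrace R C) := fun _ _ hab =>
  Subtype.ext (h (congrArg Subtype.val hab))

/-! ### Local covers of simple modules -/

section Cover

variable {A : Type u} [Ring A]

/-- A homomorphism onto a module whose kernel contains every proper submodule. -/
structure IsLocalCover {P S : Type*} [AddCommGroup P] [Module A P] [AddCommGroup S] [Module A S]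
    (π : P →ₗ[A] S) : Prop where
  surjective : Function.Surjective π
  le_ker : ∀ N : Submodule A P, N ≠ ⊤ → N ≤ LinearMap.ker π

variable {P S S' : Type*} [AddCommGroup P] [Module A P] [AddCommGroup S] [Module A S]
  [AddCommGroup S'] [Module A S'] {π : P →ₗ[A] S}

/-- The kernel of `π` is the largest proper submodule of `P`, and the kernel of a nonzero map to a
simple module is a maximal one. -/
lemma IsLocalCover.ker_eq [IsSimpleModule A S] [IsSimpleModule A S'] (hπ : IsLocalCover π)
    {f : P →ₗ[A] S'} (hf : f ≠ 0) : LinearMap.ker f = LinearMap.ker π := by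
  have h1 : IsCoatom (LinearMap.ker f) :=
    LinearMap.isCoatom_ker_of_surjective (LinearMap.surjective_of_ne_zero hf)
  have h2 : IsCoatom (LinearMap.ker π) := LinearMap.isCoatom_ker_of_surjective hπ.surjective
  exact ((h1.le_iff.1 (hπ.le_ker _ h1.1)).resolve_left h2.1).symm

lemma IsLocalCover.equiv_of_ne_zero [IsSimpleModule A S] [IsSimpleModule A S']
    (hπ : IsLocalCover π) {f : P →ₗ[A] S'} (hf : f ≠ 0) : Nonempty (S ≃ₗ[A] S') :=
  ⟨(LinearMap.quotKerEquivOfSurjective π hπ.surjective).symm.trans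
    ((Submodule.quotEquivOfEq _ _ (hπ.ker_eq hf).symm).trans
      (LinearMap.quotKerEquivOfSurjective f (LinearMap.surjective_of_ne_zero hf)))⟩

/-- By `ker_eq` every map `P → S` kills `ker π`. Thus `Hom_A(P, S)` is generated by `π` over
`End_A(S)`. -/
lemma IsLocalCover.exists_end [IsSimpleModule A S] (hπ : IsLocalCover π) (f : P →ₗ[A] S) :
    ∃ d : Module.End A S, f = d ∘ₗ π := by
  have h : LinearMap.ker π ≤ LinearMap.ker f := by
    rcases eq_or_ne f 0 with rfl | hf
    · simp
    · exact (hπ.ker_eq hf).ge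
  refine ⟨(LinearMap.ker π).liftQ f h ∘ₗ
    (LinearMap.quotKerEquivOfSurjective π hπ.surjective).symm.toLinearMap, ?_⟩
  ext x
  have : (LinearMap.quotKerEquivOfSurjective π hπ.surjective).symm (π x) =
      (LinearMap.ker π).mkQ x := by
    rw [LinearEquiv.symm_apply_eq]
    rfl
  simp [this]

lemma IsLocalCover.surjective_of_comp {Q : Type*} [AddCommGroup Q] [Module A Q]
    (hπ : IsLocalCover π) {α : Q →ₗ[A] P} (h : π ∘ₗ α ≠ 0) : Function.Surjective α := by
  rw [← LinearMap.range_eq_top]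
  by_contra hne
  refine h (LinearMap.ext fun x => ?_)
  exact hπ.le_ker _ hne ⟨x, rfl⟩

/-- Representatives of the isomorphism classes of simple modules, together with local covers by
finitely generated projective modules. -/
structure CoverSystem (A : Type u) [Ring A] where
  ι : Type u
  I : ι → Submodule A A
  isCoatom : ∀ i, IsCoatom (I i)
  eq_of_equiv : ∀ i j, Nonempty ((A ⧸ I i) ≃ₗ[A] (A ⧸ I j)) → i = j
  exists_equiv : ∀ J : Submodule A A, IsCoatom J → ∃ i, Nonempty ((A ⧸ J) ≃ₗ[A] (A ⧸ I i))
  P : ι → FGProj A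
  π : ∀ i, (P i).carrier →ₗ[A] A ⧸ I i
  isLocalCover : ∀ i, IsLocalCover (π i)

lemma exists_coverSystem (h : ∀ I : Submodule A A, IsCoatom I →
    ∃ (P : FGProj A) (π : P.carrier →ₗ[A] A ⧸ I), IsLocalCover π) :
    Nonempty (CoverSystem A) := by
  let s : Setoid {I : Submodule A A // IsCoatom I} :=
    { r := fun I J => Nonempty ((A ⧸ I.1) ≃ₗ[A] (A ⧸ J.1))
      iseqv := ⟨fun _ => ⟨LinearEquiv.refl _ _⟩, fun ⟨e⟩ => ⟨e.symm⟩,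
        fun ⟨e⟩ ⟨f⟩ => ⟨e.trans f⟩⟩ }
  choose P π hπ using h
  exact ⟨{
    ι := Quotient s
    I := fun i => i.out.1
    isCoatom := fun i => i.out.2
    eq_of_equiv := fun i j h => by
      rw [← i.out_eq, ← j.out_eq]
      exact Quotient.sound h
    exists_equiv := fun J hJ => ⟨Quotient.mk s ⟨J, hJ⟩, by
      have : s.r (Quotient.mk s ⟨J, hJ⟩).out ⟨J, hJ⟩ := Quotient.exact (Quotient.out_eq _)
      exact this.map LinearEquiv.symm⟩
    P := fun i => P _ i.out.2
    π := fun i => π _ i.out.2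
    isLocalCover := fun i => hπ _ i.out.2 }⟩

namespace CoverSystem

variable (c : CoverSystem A)

instance (i : c.ι) : IsSimpleModule A (A ⧸ c.I i) :=
  isSimpleModule_iff_isCoatom.2 (c.isCoatom i)

/-- The class of the `i`-th cover in `K₀`. -/
def cls (i : c.ι) : K0 A := Algebra.GrothendieckAddGroup.of (ProjClass.mk (c.P i).carrier)

/-- A nonzero finitely generated `P` has a simple quotient. The quotient map lifts along the cover
of that simple module because `P` is projective, and the lift is onto because the cover is local. -/
lemma exists_surjective (P : Type u) [AddCommGroup P] [Module A P] [Module.Finite A P]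
    [Module.Projective A P] [Nontrivial P] :
    ∃ i, ∃ α : P →ₗ[A] (c.P i).carrier, Function.Surjective α := by
  obtain ⟨N, hN, -⟩ := (eq_top_or_exists_le_coatom (⊥ : Submodule A P)).resolve_left
    bot_ne_top
  have := isSimpleModule_iff_isCoatom.2 hN
  obtain ⟨J, hJ, ⟨e⟩⟩ := isSimpleModule_iff_quot_maximal.1 this
  obtain ⟨i, ⟨e'⟩⟩ := c.exists_equiv J hJ.out
  let q : P →ₗ[A] A ⧸ c.I i := (e.trans e').toLinearMap ∘ₗ N.mkQ
  have hq : q ≠ 0 := by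
    intro h
    obtain ⟨x, hx⟩ := (LinearEquiv.surjective (e.trans e')).comp N.mkQ_surjective
      (c.I i |>.mkQ 1)
    refine (c.isCoatom i).1 ((Ideal.eq_top_iff_one (c.I i)).2 ?_)
    rw [← Submodule.Quotient.mk_eq_zero, ← Submodule.mkQ_apply, ← hx]
    exact LinearMap.congr_fun h x
  obtain ⟨α, hα⟩ := Module.projective_lifting_property (c.π i) q (c.isLocalCover i).surjective
  exact ⟨i, α, (c.isLocalCover i).surjective_of_comp (by rwa [hα])⟩

end CoverSystem

/-- A surjection onto a projective module splits off its target. -/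
lemma exists_prodEquiv_of_surjective {P Q : Type*} [AddCommGroup P] [Module A P]
    [AddCommGroup Q] [Module A Q] [Module.Projective A Q] (α : P →ₗ[A] Q)
    (hα : Function.Surjective α) : Nonempty (P ≃ₗ[A] LinearMap.ker α × Q) := by
  obtain ⟨β, hβ⟩ := Module.projective_lifting_property α LinearMap.id hα
  have h : ∀ x, α (β x) = x := LinearMap.congr_fun hβ
  exact ⟨LinearEquiv.ofLinearMap
    ((LinearMap.codRestrict (LinearMap.ker α) (LinearMap.id - β ∘ₗ α)
      fun x => by simp [h]).prod α)
    ((LinearMap.ker α).subtype.coprod β)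
    (by ext <;> simp [h])
    (by ext; simp)⟩

lemma finite_projective_of_prodEquiv {P K Q : Type*} [AddCommGroup P] [Module A P]
    [AddCommGroup K] [Module A K] [AddCommGroup Q] [Module A Q] [Module.Finite A P]
    [Module.Projective A P] (e : P ≃ₗ[A] K × Q) :
    Module.Finite A K ∧ Module.Projective A K :=
  ⟨Module.Finite.of_surjective (LinearMap.fst A K Q ∘ₗ e.toLinearMap)
    (fun x => ⟨e.symm (x, 0), by simp⟩),
   Module.Projective.of_split (e.symm.toLinearMap ∘ₗ LinearMap.inl A K Q)
    (LinearMap.fst A K Q ∘ₗ e.toLinearMap) (by ext; simp)⟩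

/-! ### Generation of `K₀` by the classes of local covers -/

section Span

lemma projective_restrictScalars (O : Type*) [CommRing O] [Algebra O A] [Module.Projective O A]
    (P : Type*) [AddCommGroup P] [Module A P] [Module O P] [IsScalarTower O A P]
    [Module.Finite A P] [Module.Projective A P] : Module.Projective O P := by
  obtain ⟨n, f, g, -, -, h⟩ := Module.Finite.exists_comp_eq_id_of_projective A P
  have : Module.Projective O (Fin n → A) :=
    Module.Projective.of_equiv (DFinsupp.linearEquivFunOnFintype (R := O) (M := fun _ => A))
  exact Module.Projective.of_split (g.restrictScalars O) (f.restrictScalars O)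
    (LinearMap.ext fun x => LinearMap.congr_fun h x)

variable (O : Type*) [CommRing O] [IsLocalRing O] [Algebra O A] [Module.Finite O A]
  [Module.Projective O A]

/-- The rank over the base ring of a module over an algebra. -/
def baseRank (O : Type*) [CommRing O] [Algebra O A] (P : Type*) [AddCommGroup P] [Module A P] :
    ℕ :=
  letI : Module O P := Module.compHom P (algebraMap O A)
  Module.finrank O P

/-- Finitely generated projectives over `A` are free of finite rank over the local ring `O`, so rank
is additive and positive on nonzero summands. This makes the splitting off of covers terminate. -/
lemma baseRank_lt {P K Q : Type*} [AddCommGroup P] [Module A P]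
    [AddCommGroup K] [Module A K] [AddCommGroup Q] [Module A Q] [Module.Finite A P]
    [Module.Projective A P] (e : P ≃ₗ[A] K × Q) (hQ : Nontrivial Q) :
    baseRank (A := A) O K < baseRank (A := A) O P := by
  let : Module O P := Module.compHom P (algebraMap O A)
  let : Module O K := Module.compHom K (algebraMap O A)
  let : Module O Q := Module.compHom Q (algebraMap O A)
  have : IsScalarTower O A P := .of_algebraMap_smul fun _ _ => rfl
  have : IsScalarTower O A K := .of_algebraMap_smul fun _ _ => rfl
  have : IsScalarTower O A Q := .of_algebraMap_smul fun _ _ => rfl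
  obtain ⟨_, _⟩ := finite_projective_of_prodEquiv e
  obtain ⟨_, _⟩ := finite_projective_of_prodEquiv (e.trans (LinearEquiv.prodComm A K Q))
  have : Module.Finite O K := Module.Finite.trans A K
  have : Module.Finite O Q := Module.Finite.trans A Q
  have := projective_restrictScalars O (A := A) K
  have := projective_restrictScalars O (A := A) Q
  have : Module.Free O K := Module.free_of_flat_of_isLocalRing
  have : Module.Free O Q := Module.free_of_flat_of_isLocalRing
  change Module.finrank O K < Module.finrank O P
  rw [(e.restrictScalars O).finrank_eq, Module.finrank_prod]
  have := Module.finrank_pos_iff_of_free O Q |>.2 hQ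
  omega

-- A nonzero projective maps onto some cover and splits it off; the complement has smaller rank over
-- `O`.
include O in
lemma CoverSystem.of_mem_closure (c : CoverSystem A) (P : Type u) [AddCommGroup P] [Module A P]
    [Module.Finite A P] [Module.Projective A P] :
    (Algebra.GrothendieckAddGroup.of (ProjClass.mk P) : K0 A) ∈
      AddSubgroup.closure (Set.range c.cls) := by
  induction hn : baseRank (A := A) O P using Nat.strong_induction_on generalizing P with
  | _ n ih =>
    rcases subsingleton_or_nontrivial P with hP | hP
    · rw [ProjClass.mk_zero, map_zero]
      exact zero_mem _
    · obtain ⟨i, α, hα⟩ := c.exists_surjective P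
      obtain ⟨e⟩ := exists_prodEquiv_of_surjective α hα
      obtain ⟨_, _⟩ := finite_projective_of_prodEquiv e
      have : Nontrivial (c.P i).carrier := by
        have := IsSimpleModule.nontrivial A (A ⧸ c.I i)
        exact (c.isLocalCover i).surjective.nontrivial
      rw [ProjClass.mk_eq e, ← ProjClass.mk_add, map_add]
      exact add_mem (ih _ (hn ▸ baseRank_lt O e this) _ rfl)
        (AddSubgroup.subset_closure ⟨i, rfl⟩)

include O in
lemma CoverSystem.exists_finsupp (c : CoverSystem A) (x : K0 A) :
    ∃ a : c.ι →₀ ℤ, x = a.sum fun i n => n • c.cls i := by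
  have h : QuotientAddGroup.mk' (AddSubgroup.closure (Set.range c.cls)) = 0 :=
    K0.hom_ext fun P _ _ _ _ => (QuotientAddGroup.eq_zero_iff _).2 (c.of_mem_closure O P)
  have hx : x ∈ AddSubgroup.closure (Set.range c.cls) :=
    (QuotientAddGroup.eq_zero_iff _).1 (DFunLike.congr_fun h x)
  rw [← Submodule.span_int_eq_addSubgroupClosure] at hx
  obtain ⟨a, rfl⟩ := Finsupp.mem_span_range_iff_exists_finsupp.1 hx
  exact ⟨a, rfl⟩

end Span

/-! ### Ranks at simple modules and injectivity criteria -/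

namespace CoverSystem

variable (c : CoverSystem A)

section

variable {L : Type*} [DivisionRing L] (i : c.ι) [Module L (A ⧸ c.I i)]
  [SMulCommClass A L (A ⧸ c.I i)] [Module.Finite L (A ⧸ c.I i)]

lemma homRank_cls_of_ne {j : c.ι} (h : j ≠ i) : homRank L (A ⧸ c.I i) (c.cls j) = 0 := by
  rw [cls, homRank_of]
  have : Subsingleton ((c.P j).carrier →ₗ[A] A ⧸ c.I i) := by
    refine subsingleton_of_forall_eq 0 fun f => ?_
    by_contra hf
    exact h (c.eq_of_equiv j i ((c.isLocalCover j).equiv_of_ne_zero hf))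
  rw [Module.finrank_zero_of_subsingleton]
  rfl

lemma π_ne_zero : c.π i ≠ 0 := by
  intro h
  have := IsSimpleModule.nontrivial A (A ⧸ c.I i)
  obtain ⟨y, hy⟩ := exists_ne (0 : A ⧸ c.I i)
  obtain ⟨x, rfl⟩ := (c.isLocalCover i).surjective y
  exact hy (by rw [h]; rfl)

lemma homRank_cls_self_ne_zero : homRank L (A ⧸ c.I i) (c.cls i) ≠ 0 := by
  rw [cls, homRank_of]
  have : Nontrivial ((c.P i).carrier →ₗ[A] A ⧸ c.I i) := ⟨⟨_, _, c.π_ne_zero i⟩⟩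
  have := Module.finrank_pos (R := L) (M := (c.P i).carrier →ₗ[A] A ⧸ c.I i)
  omega

/-- `Hom_A(Pᵢ, Sᵢ)` is spanned by `πᵢ` over `End_A(Sᵢ)`, hence is a line once all endomorphisms are
scalars in `L`. The exact value `1` matters in characteristic `p`, where a nonzero rank could vanish
in `L`. -/
lemma homRank_cls_self (h : ∀ d : Module.End A (A ⧸ c.I i), ∃ l : L, ∀ x, d x = l • x) :
    homRank L (A ⧸ c.I i) (c.cls i) = 1 := by
  rw [cls, homRank_of]
  norm_cast
  refine finrank_eq_one (c.π i) (c.π_ne_zero i) fun f => ?_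
  obtain ⟨d, rfl⟩ := (c.isLocalCover i).exists_end f
  obtain ⟨l, hl⟩ := h d
  exact ⟨l, LinearMap.ext fun x => (hl _).symm⟩

/-- The rank at the `i`-th simple module vanishes on all other covers, so it isolates the `i`-th
coefficient. -/
lemma homRank_sum (a : c.ι →₀ ℤ) :
    homRank L (A ⧸ c.I i) (a.sum fun j n => n • c.cls j) =
      a i * homRank L (A ⧸ c.I i) (c.cls i) := by
  classical
  rw [Finsupp.sum, map_sum, Finset.sum_eq_single i]
  · simp
  · intro j _ hj
    rw [map_zsmul, homRank_cls_of_ne c i hj, smul_zero]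
  · intro hi
    rw [Finsupp.notMem_support_iff.1 hi]
    simp

end

variable (O : Type*) [CommRing O] [IsLocalRing O] [Algebra O A] [Module.Finite O A]
  [Module.Projective O A]

include c O in
/-- The trace map is injective if all simple modules are finite dimensional over fields of
characteristic zero. -/
theorem trace_injective_of_charZero
    (h : ∀ i : c.ι, ∃ (L : Type w) (_ : Field L) (_ : CharZero L) (_ : Module L (A ⧸ c.I i))
      (_ : SMulCommClass A L (A ⧸ c.I i)), Module.Finite L (A ⧸ c.I i)) :
    Function.Injective (trace A) := by
  rw [injective_iff_map_eq_zero]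
  intro x hx
  obtain ⟨a, rfl⟩ := c.exists_finsupp O x
  have ha : a = 0 := by
    ext i
    obtain ⟨L, _, _, _, _, _⟩ := h i
    have h1 := traceFunctional_trace L (A ⧸ c.I i) (a.sum fun i n => n • c.cls i)
    rw [hx, map_zero, eq_comm, Int.cast_eq_zero, homRank_sum] at h1
    exact (mul_eq_zero.1 h1).resolve_right (c.homRank_cls_self_ne_zero i)
  simp [ha]

include c O in
/-- The trace map is injective if all simple modules are finite dimensional over their
endomorphism rings, and these are fields of characteristic `p`. -/
theorem trace_injective_of_charP {p : ℕ} (hp : p.Prime)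
    (h : ∀ i : c.ι, ∃ (L : Type w) (_ : Field L) (_ : CharP L p) (_ : Module L (A ⧸ c.I i))
      (_ : SMulCommClass A L (A ⧸ c.I i)), Module.Finite L (A ⧸ c.I i) ∧
        ∀ d : Module.End A (A ⧸ c.I i), ∃ l : L, ∀ x, d x = l • x)
    (htf : ∀ y : HH0 A, p • y = 0 → y = 0) :
    Function.Injective (trace A) := by
  rw [injective_iff_map_eq_zero]
  -- Ranks read in `L` give the coefficients modulo `p` only. Torsion freeness lets `p` be cancelled
  -- from the trace, so the quotient stays in the kernel.
  have step : ∀ x : K0 A, trace A x = 0 → ∃ y, trace A y = 0 ∧ x = p • y := by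
    intro x hx
    obtain ⟨a, rfl⟩ := c.exists_finsupp O x
    have ha : ∀ i, (p : ℤ) ∣ a i := by
      intro i
      obtain ⟨L, _, _, _, _, _, hL⟩ := h i
      have h1 := traceFunctional_trace L (A ⧸ c.I i) (a.sum fun i n => n • c.cls i)
      rwa [hx, map_zero, eq_comm, homRank_sum, homRank_cls_self c i hL, mul_one,
        CharP.intCast_eq_zero_iff L p] at h1
    choose b hb using ha
    have key : (a.sum fun i n => n • c.cls i) = p • ∑ i ∈ a.support, b i • c.cls i := by
      rw [Finsupp.sum, Finset.smul_sum]
      refine Finset.sum_congr rfl fun i _ => ?_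
      rw [hb i, mul_smul, natCast_zsmul]
    refine ⟨_, htf _ ?_, key⟩
    rw [← map_nsmul, ← key, hx]
  have iter : ∀ n : ℕ, ∀ x : K0 A, trace A x = 0 → ∃ y, x = p ^ n • y := by
    intro n
    induction n with
    | zero => exact fun x _ => ⟨x, by simp⟩
    | succ n ih =>
      intro x hx
      obtain ⟨y, hy, rfl⟩ := step x hx
      obtain ⟨z, rfl⟩ := ih y hy
      exact ⟨z, by rw [← mul_smul, pow_succ']⟩
  intro x hx
  have hx' := fun n => iter n x hx
  obtain ⟨a, rfl⟩ := c.exists_finsupp O x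
  have ha : a = 0 := by
    ext i
    obtain ⟨L, _, _, _, _, _, hL⟩ := h i
    by_contra hne
    -- The exponent `|aᵢ|` suffices: `p ^ |aᵢ|` would divide `aᵢ ≠ 0`, although `n < p ^ n` for all
    -- `n`.
    obtain ⟨y, hy⟩ := hx' (a i).natAbs
    have h1 := congrArg (homRank L (A ⧸ c.I i)) hy
    rw [homRank_sum, homRank_cls_self c i hL, mul_one, map_nsmul, nsmul_eq_mul] at h1
    have h2 : (p ^ (a i).natAbs : ℕ) ≤ (a i).natAbs :=
      Nat.le_of_dvd (Int.natAbs_pos.2 hne) (Int.natCast_dvd.1 ⟨_, h1⟩)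
    exact absurd h2 (not_le.2 (Nat.lt_pow_self hp.one_lt))
  simp [ha]

end CoverSystem

end Cover

/-! ### Averaging over a finite group -/

section Average

variable {R : Type u} [Ring R] {G : Type v} [Group G]

lemma single_one_smul {M : Type*} [AddCommGroup M] [Module (MonoidAlgebra R G) M] [Module R M]
    [IsScalarTower R (MonoidAlgebra R G) M] (r : R) (x : M) :
    MonoidAlgebra.single (1 : G) r • x = r • x := by
  rw [← smul_one_smul (MonoidAlgebra R G) r x, MonoidAlgebra.one_def, MonoidAlgebra.smul_single,
    smul_eq_mul, mul_one]

variable [Finite G]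
variable {P : Type*} [AddCommGroup P] [Module (MonoidAlgebra R G) P]
variable {Q : Type*} [AddCommGroup Q] [Module (MonoidAlgebra R G) Q]

/-- The average over `G` of an additive map that commutes with `R`. -/
def average (h : IsUnit (Nat.card G : R)) (f : P →+ Q)
    (hf : ∀ (r : R) (x : P), f (MonoidAlgebra.single (1 : G) r • x) =
      MonoidAlgebra.single (1 : G) r • f x) : P →ₗ[MonoidAlgebra R G] Q :=
  letI := Fintype.ofFinite G
  linearOfSingle (∑ g : G, (DistribSMul.toAddMonoidHom Q
      (MonoidAlgebra.single g⁻¹ ((h.unit⁻¹ : Rˣ) : R))).comp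
        (f.comp (DistribSMul.toAddMonoidHom P (MonoidAlgebra.single g (1 : R)))))
    fun k r x => by
      -- `R` need not be commutative; the inverse of `|G|` is central because the integer `|G|` is.
      have hc : Commute r ((h.unit⁻¹ : Rˣ) : R) :=
        Commute.units_inv_right (u := h.unit) (Nat.cast_commute (Nat.card G) r).symm
      simp only [AddMonoidHom.finsetSum_apply, AddMonoidHom.comp_apply,
        DistribSMul.toAddMonoidHom_apply, Finset.smul_sum]
      -- The substitution `g ↦ g k⁻¹` moves `k` from the inside of the average to the outside.
      rw [← Equiv.sum_comp (Equiv.mulRight k⁻¹)]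
      refine Finset.sum_congr rfl fun g _ => ?_
      have h1 : MonoidAlgebra.single (Equiv.mulRight k⁻¹ g) (1 : R) • MonoidAlgebra.single k r • x =
          MonoidAlgebra.single (1 : G) r • MonoidAlgebra.single g (1 : R) • x := by
        simp [← mul_smul, MonoidAlgebra.single_mul_single]
      rw [h1, hf, ← mul_smul, ← mul_smul, MonoidAlgebra.single_mul_single,
        MonoidAlgebra.single_mul_single, hc.eq]
      simp

lemma average_apply [i : Fintype G] (h : IsUnit (Nat.card G : R)) (f : P →+ Q)
    (hf : ∀ (r : R) (x : P), f (MonoidAlgebra.single (1 : G) r • x) =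
      MonoidAlgebra.single (1 : G) r • f x) (x : P) :
    average h f hf x = ∑ g : G, MonoidAlgebra.single g⁻¹ ((h.unit⁻¹ : Rˣ) : R) •
      f (MonoidAlgebra.single g (1 : R) • x) := by
  obtain rfl : i = Fintype.ofFinite G := Subsingleton.elim _ _
  let i := Fintype.ofFinite G
  change (∑ g : G, (DistribSMul.toAddMonoidHom Q
      (MonoidAlgebra.single g⁻¹ ((h.unit⁻¹ : Rˣ) : R))).comp
        (f.comp (DistribSMul.toAddMonoidHom P (MonoidAlgebra.single g (1 : R))))) x = _
  simp only [AddMonoidHom.finsetSum_apply, AddMonoidHom.comp_apply,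
    DistribSMul.toAddMonoidHom_apply]

/-- Averaging does not change a map at points whose orbit it maps equivariantly. -/
lemma average_eq (h : IsUnit (Nat.card G : R)) (f : P →+ Q)
    (hf : ∀ (r : R) (x : P), f (MonoidAlgebra.single (1 : G) r • x) =
      MonoidAlgebra.single (1 : G) r • f x) (x : P) (y : Q)
    (hx : ∀ g : G, f (MonoidAlgebra.single g (1 : R) • x) =
      MonoidAlgebra.single g (1 : R) • y) :
    average h f hf x = y := by
  have := Fintype.ofFinite G
  rw [average_apply]
  have key : ∀ g : G, MonoidAlgebra.single g⁻¹ ((h.unit⁻¹ : Rˣ) : R) •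
      f (MonoidAlgebra.single g (1 : R) • x) =
        MonoidAlgebra.single (1 : G) ((h.unit⁻¹ : Rˣ) : R) • y := fun g => by
    rw [hx, ← mul_smul, MonoidAlgebra.single_mul_single, inv_mul_cancel, mul_one]
  simp_rw [key]
  rw [Finset.sum_const, Finset.card_univ, ← Nat.card_eq_fintype_card, ← Nat.cast_smul_eq_nsmul
    (MonoidAlgebra R G), ← mul_smul, MonoidAlgebra.natCast_def, MonoidAlgebra.single_mul_single,
    one_mul]
  have : (Nat.card G : R) * ((h.unit⁻¹ : Rˣ) : R) = 1 := h.unit.mul_inv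
  rw [this, ← MonoidAlgebra.one_def, one_smul]

lemma map_average {Q' : Type*} [AddCommGroup Q'] [Module (MonoidAlgebra R G) Q']
    (h : IsUnit (Nat.card G : R)) (f : P →+ Q)
    (hf : ∀ (r : R) (x : P), f (MonoidAlgebra.single (1 : G) r • x) =
      MonoidAlgebra.single (1 : G) r • f x) (α : Q →ₗ[MonoidAlgebra R G] Q') (x : P) (y : Q')
    (hx : ∀ g : G, α (f (MonoidAlgebra.single g (1 : R) • x)) =
      MonoidAlgebra.single g (1 : R) • y) :
    α (average h f hf x) = y := by
  have := Fintype.ofFinite G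
  have h2 := average_eq h (α.toAddMonoidHom.comp f)
    (fun r x => by simp [hf]) x y hx
  rw [← h2, average_apply h f hf, map_sum]
  refine Eq.trans ?_ (average_apply h (α.toAddMonoidHom.comp f) _ x).symm
  exact Finset.sum_congr rfl fun g _ => map_smul α _ _

/-- A module over a group ring is semisimple if it is so over the coefficient ring, when the
order of the group is invertible. -/
lemma isSemisimpleModule_monoidAlgebra (h : IsUnit (Nat.card G : R)) [Module R P]
    [IsScalarTower R (MonoidAlgebra R G) P] [IsSemisimpleModule R P] :
    IsSemisimpleModule (MonoidAlgebra R G) P where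
  exists_isCompl N := by
    -- Maschke: an `R`-linear retraction onto `N` becomes equivariant by averaging and still fixes
    -- `N`, which is `G`-stable.
    obtain ⟨f, hf⟩ := IsSemisimpleModule.extension_property
      ((N.subtype.restrictScalars R)) N.injective_subtype (LinearMap.id (R := R) (M := N))
    have hf' : ∀ x : N, f x = x := LinearMap.congr_fun hf
    let p := average (G := G) h f.toAddMonoidHom fun r x => by
      rw [single_one_smul, single_one_smul]
      exact f.map_smul r x
    refine ⟨LinearMap.ker p, LinearMap.isCompl_of_proj (f := p) fun x => ?_⟩
    exact average_eq _ _ _ _ _ fun g => hf' (MonoidAlgebra.single g (1 : R) • x)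

/-- A module over a group ring is projective if it is so over the coefficient ring, when the
order of the group is invertible. -/
lemma projective_monoidAlgebra (h : IsUnit (Nat.card G : R)) [Module R P]
    [IsScalarTower R (MonoidAlgebra R G) P] [Module.Projective R P] :
    Module.Projective (MonoidAlgebra R G) P := by
  let π : (P →₀ MonoidAlgebra R G) →ₗ[MonoidAlgebra R G] P :=
    Finsupp.linearCombination (MonoidAlgebra R G) id
  have hπ : Function.Surjective π := fun x => ⟨Finsupp.single x 1, by simp [π]⟩
  -- Projectivity over `R` gives an `R`-linear section of a free cover over `RG`; its average is
  -- again a section since `π` is equivariant.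
  obtain ⟨s, hs⟩ := Module.projective_lifting_property (π.restrictScalars R) LinearMap.id hπ
  have hs' : ∀ x, π (s x) = x := LinearMap.congr_fun hs
  let σ := average (G := G) h s.toAddMonoidHom fun r x => by
      rw [single_one_smul, single_one_smul]
      exact s.map_smul r x
  refine Module.Projective.of_split σ π (LinearMap.ext fun x => ?_)
  exact map_average h s.toAddMonoidHom _ π x x fun g => hs' _

/-- Maschke's theorem over a semisimple coefficient ring. -/
lemma isSemisimpleRing_monoidAlgebra (h : IsUnit (Nat.card G : R)) [IsSemisimpleRing R] :
    IsSemisimpleRing (MonoidAlgebra R G) :=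
  isSemisimpleModule_monoidAlgebra (P := MonoidAlgebra R G) h

end Average

/-! ### Semisimple coefficients -/

section Semisimple

lemma isLocalCover_id {A S : Type*} [Ring A] [AddCommGroup S] [Module A S] [IsSimpleModule A S] :
    IsLocalCover (LinearMap.id : S →ₗ[A] S) where
  surjective := Function.surjective_id
  le_ker N hN := by
    rw [(eq_bot_or_eq_top N).resolve_right hN]
    exact bot_le

lemma isUnit_natCast_of_algebra (F : Type*) [Field F] [CharZero F] (R : Type*) [Ring R]
    [Algebra F R] {n : ℕ} (hn : n ≠ 0) : IsUnit (n : R) := by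
  have h : IsUnit (n : F) := (Nat.cast_ne_zero.2 hn).isUnit
  simpa using h.map (algebraMap F R)

/-- The trace map of a finite dimensional semisimple algebra over a field of characteristic zero
is injective. -/
theorem trace_injective_of_isSemisimpleRing (F : Type*) [Field F] [CharZero F] (A : Type*) [Ring A]
    [Algebra F A] [FiniteDimensional F A] [IsSemisimpleRing A] :
    Function.Injective (trace A) := by
  obtain ⟨c⟩ : Nonempty (CoverSystem A) := by
    refine exists_coverSystem fun I hI => ?_
    have := isSimpleModule_iff_isCoatom.2 hI
    have : Module.Projective A (A ⧸ I) := Module.projective_of_isSemisimpleRing A _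
    exact ⟨⟨A ⧸ I⟩, LinearMap.id, isLocalCover_id⟩
  refine c.trace_injective_of_charZero F fun i => ?_
  have : Module.Finite F (A ⧸ c.I i) := Module.Finite.trans A _
  exact ⟨F, inferInstance, inferInstance, inferInstance, inferInstance, this⟩

theorem trace_injective_monoidAlgebra_of_isSemisimpleRing (F : Type*) [Field F] [CharZero F]
    (R : Type*) [Ring R] [Algebra F R] [FiniteDimensional F R] [IsSemisimpleRing R]
    (G : Type*) [Group G] [Finite G] : Function.Injective (trace (MonoidAlgebra R G)) := by
  have := isSemisimpleRing_monoidAlgebra (R := R) (G := G)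
    (isUnit_natCast_of_algebra F R Nat.card_pos.ne')
  have : FiniteDimensional F (MonoidAlgebra R G) :=
    Module.Finite.equiv (MonoidAlgebra.coeffLinearEquiv (S := R) (M := G) F).symm
  exact trace_injective_of_isSemisimpleRing F _

end Semisimple

/-! ### Algebras over local rings and idempotent lifting -/

section LocalAlgebra

open IsLocalRing

variable {A : Type u} [Ring A]

/-- Since `1 - y` lies in no maximal left ideal, it has a left inverse `u`. Then `u = 1 + u y` has
the same shape, so `u` is left invertible too and the inverse is two-sided. -/
lemma isUnit_one_sub_of_mem_jacobson {y : A} (hy : y ∈ Ring.jacobson A) : IsUnit (1 - y) := by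
  have left : ∀ y ∈ Ring.jacobson A, ∃ u, u * (1 - y) = 1 := by
    intro y hy
    by_contra! h
    have hne : Ideal.span {1 - y} ≠ ⊤ := by
      rw [Ne, Ideal.eq_top_iff_one, Ideal.mem_span_singleton']
      push Not
      exact h
    obtain ⟨I, hI, hle⟩ := Ideal.exists_le_maximal _ hne
    refine hI.ne_top ((Ideal.eq_top_iff_one I).2 ?_)
    have h1 := hle (Ideal.mem_span_singleton_self (1 - y))
    have h2 := Ring.jacobson_le_of_isMaximal I hy
    simpa using I.add_mem h1 h2
  obtain ⟨u, hu⟩ := left y hy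
  obtain ⟨w, hw⟩ := left (-(u * y)) (neg_mem (Ideal.mul_mem_left _ u hy))
  have h1 : 1 - -(u * y) = u := by
    rw [mul_sub, mul_one] at hu
    rw [sub_neg_eq_add]
    exact (sub_eq_iff_eq_add.1 hu).symm
  rw [h1] at hw
  have h2 : w = 1 - y := left_inv_eq_right_inv hw hu
  exact ⟨⟨1 - y, u, by rw [← h2, hw], hu⟩, rfl⟩

variable (O : Type w) [CommRing O] [Algebra O A]

variable {O} in
lemma mul_mem_smul_top {I K : Ideal O} {x y : A} (hx : x ∈ I • (⊤ : Submodule O A))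
    (hy : y ∈ K • (⊤ : Submodule O A)) : x * y ∈ (I * K) • (⊤ : Submodule O A) := by
  rw [Submodule.mul_smul]
  induction hx using Submodule.smul_induction_on' with
  | smul r hr z _ =>
    rw [smul_mul_assoc]
    exact Submodule.smul_mem_smul hr
      (Submodule.smul_top_le_comap_smul_top K (LinearMap.mulLeft O z) hy)
  | add a _ b _ ha hb => rw [add_mul]; exact add_mem ha hb

variable {O} in
lemma mul_mem_smul_top_left {I : Ideal O} (x : A) {y : A}
    (hy : y ∈ I • (⊤ : Submodule O A)) : x * y ∈ I • (⊤ : Submodule O A) :=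
  Submodule.smul_top_le_comap_smul_top I (LinearMap.mulLeft O x) hy

variable {O} in
lemma mul_mem_smul_top_right {I : Ideal O} {x : A} (y : A)
    (hx : x ∈ I • (⊤ : Submodule O A)) : x * y ∈ I • (⊤ : Submodule O A) :=
  Submodule.smul_top_le_comap_smul_top I (LinearMap.mulRight O y) hx

variable {O} in
lemma pow_mem_smul_top {I : Ideal O} {x : A} (hx : x ∈ I • (⊤ : Submodule O A)) (n : ℕ) :
    x ^ n ∈ (I ^ n) • (⊤ : Submodule O A) := by
  induction n with
  | zero => simp
  | succ n ih => rw [pow_succ, pow_succ]; exact mul_mem_smul_top ih hx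

variable [IsLocalRing O] [Module.Finite O A]

/-- A simple module over a finite algebra over a local ring is killed by the maximal ideal. -/
lemma maximalIdeal_smul_top_le (I : Ideal A) [hI : I.IsMaximal] :
    maximalIdeal O • (⊤ : Submodule O A) ≤ I.restrictScalars O := by
  intro x hx
  by_contra hxI
  -- Otherwise `A = I + Ax ⊆ I + 𝔪A`, and Nakayama's lemma over `O` gives `I = A`.
  have h1 : I ⊔ Ideal.span {x} = ⊤ := by
    refine hI.out.2 _ (lt_of_le_of_ne le_sup_left fun h => hxI ?_)
    change x ∈ I
    rw [h]
    exact Ideal.mem_sup_right (Ideal.mem_span_singleton_self x)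
  have h2 : (⊤ : Submodule O A) ≤ I.restrictScalars O ⊔ maximalIdeal O • ⊤ := by
    intro y _
    obtain ⟨z, hz, t, ht, rfl⟩ := Submodule.mem_sup.1 (h1 ▸ Submodule.mem_top : y ∈ I ⊔ _)
    obtain ⟨b, rfl⟩ := Ideal.mem_span_singleton'.1 ht
    exact Submodule.add_mem_sup hz (mul_mem_smul_top_left b hx)
  have h3 := Submodule.le_of_le_smul_of_le_jacobson_bot (Module.Finite.fg_top (R := O) (M := A))
    (IsLocalRing.maximalIdeal_le_jacobson _) h2
  exact hI.ne_top (eq_top_iff.2 fun y hy => h3 hy)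

lemma maximalIdeal_smul_top_le_jacobson :
    maximalIdeal O • (⊤ : Submodule O A) ≤ (Ring.jacobson A).restrictScalars O := by
  intro x hx
  change x ∈ Ring.jacobson A
  rw [Ring.jacobson_eq_sInf_isMaximal]
  refine Submodule.mem_sInf.2 fun (I : Ideal A) (hI : I.IsMaximal) => ?_
  exact maximalIdeal_smul_top_le O I hx

instance isArtinian_quotient_maximalIdeal :
    IsArtinian O (A ⧸ maximalIdeal O • (⊤ : Submodule O A)) := by
  let : Field (O ⧸ maximalIdeal O) := Ideal.Quotient.field _
  have : Module.Finite (O ⧸ maximalIdeal O) (A ⧸ maximalIdeal O • (⊤ : Submodule O A)) :=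
    Module.Finite.of_restrictScalars_finite O _ _
  exact isArtinian_of_surjective_algebraMap (R := O ⧸ maximalIdeal O) (S := O)
    Ideal.Quotient.mk_surjective

include O in
lemma isArtinian_quotient_jacobson : IsArtinian A (A ⧸ Ring.jacobson A) := by
  have : IsArtinian O (A ⧸ Ring.jacobson A) := by
    refine isArtinian_of_surjective (P := A ⧸ Ring.jacobson A)
      (A ⧸ maximalIdeal O • (⊤ : Submodule O A))
      ((maximalIdeal O • (⊤ : Submodule O A)).liftQ
        ((Ring.jacobson A).mkQ.restrictScalars O) fun x hx => ?_) ?_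
    · exact (Submodule.Quotient.mk_eq_zero _).2 (maximalIdeal_smul_top_le_jacobson O hx)
    · intro y
      obtain ⟨x, rfl⟩ := Submodule.mkQ_surjective _ y
      exact ⟨Submodule.Quotient.mk x, rfl⟩
  exact isArtinian_of_tower O this

/-- Elements of the Jacobson radical are nilpotent modulo the maximal ideal. -/
lemma exists_pow_mem_of_mem_jacobson {c : A} (hc : c ∈ Ring.jacobson A) :
    ∃ n, c ^ n ∈ maximalIdeal O • (⊤ : Submodule O A) := by
  -- The images of the right ideals `cⁿA` in the Artinian module `A / 𝔪A` become stationary. Hence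
  -- `cⁿ ≡ cⁿ⁺¹ b` modulo `𝔪A` for some `b`, and `1 - cb` is a unit.
  let f : ℕ →o (Submodule O (A ⧸ maximalIdeal O • (⊤ : Submodule O A)))ᵒᵈ :=
    { toFun := fun n => OrderDual.toDual
        (Submodule.map (maximalIdeal O • (⊤ : Submodule O A)).mkQ
          (LinearMap.range (LinearMap.mulLeft O (c ^ n))))
      monotone' := by
        intro n m h
        refine Submodule.map_mono ?_
        rintro _ ⟨x, rfl⟩
        exact ⟨c ^ (m - n) * x, by simp [← mul_assoc, ← pow_add, h]⟩ }
  obtain ⟨n, hn⟩ := IsArtinian.monotone_stabilizes f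
  have h1 : (maximalIdeal O • (⊤ : Submodule O A)).mkQ (c ^ n) ∈ OrderDual.ofDual (f n) :=
    ⟨c ^ n, ⟨1, by simp⟩, rfl⟩
  rw [hn (n + 1) n.le_succ] at h1
  obtain ⟨_, ⟨b, rfl⟩, hb⟩ := h1
  rw [eq_comm, ← sub_eq_zero, ← map_sub, Submodule.mkQ_apply, Submodule.Quotient.mk_eq_zero,
    LinearMap.mulLeft_apply] at hb
  obtain ⟨u, hu⟩ := isUnit_one_sub_of_mem_jacobson (Ideal.mul_mem_right b _ hc)
  refine ⟨n, ?_⟩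
  have h2 := mul_mem_smul_top_right (↑u⁻¹ : A) hb
  have h3 : c ^ n - c ^ (n + 1) * b = c ^ n * u := by
    rw [hu, mul_sub, mul_one, pow_succ, mul_assoc]
  rwa [h3, mul_assoc, Units.mul_inv, mul_one] at h2

end LocalAlgebra

/-! ### Newton iteration for idempotents -/

section Newton

open Polynomial

/-- The Newton iteration `p ↦ 3p² - 2p³` for idempotents. -/
def idempotentPoly : ℕ → ℤ[X]
  | 0 => X
  | n + 1 => 3 * idempotentPoly n ^ 2 - 2 * idempotentPoly n ^ 3

/-- Convergence is quadratic: one step replaces the defect `p² - p` by a multiple of its square. -/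
lemma dvd_idempotentPoly (n : ℕ) :
    ((X : ℤ[X]) ^ 2 - X) ^ (2 ^ n) ∣ idempotentPoly n ^ 2 - idempotentPoly n := by
  induction n with
  | zero => simp [idempotentPoly]
  | succ n ih =>
    have h : idempotentPoly (n + 1) ^ 2 - idempotentPoly (n + 1) =
        (idempotentPoly n ^ 2 - idempotentPoly n) ^ 2 *
          (4 * idempotentPoly n ^ 2 - 4 * idempotentPoly n - 3) := by
      rw [idempotentPoly]
      ring
    rw [h, pow_succ 2, pow_mul]
    exact Dvd.dvd.mul_right (pow_dvd_pow_of_dvd ih 2) _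

/-- A step moves `p` by `(p² - p)(1 - 2p)`, a multiple of the defect, so the iterates form a Cauchy
sequence. -/
lemma dvd_idempotentPoly_sub {n m : ℕ} (h : n ≤ m) :
    ((X : ℤ[X]) ^ 2 - X) ^ (2 ^ n) ∣ idempotentPoly m - idempotentPoly n := by
  induction m, h using Nat.le_induction with
  | base => simp
  | succ m h ih =>
    have h1 : idempotentPoly (m + 1) - idempotentPoly n =
        (idempotentPoly m ^ 2 - idempotentPoly m) * (1 - 2 * idempotentPoly m) +
          (idempotentPoly m - idempotentPoly n) := by
      rw [idempotentPoly]
      ring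
    rw [h1]
    refine dvd_add (Dvd.dvd.mul_right ((pow_dvd_pow _ ?_).trans (dvd_idempotentPoly m)) _) ih
    exact Nat.pow_le_pow_right two_pos h

end Newton

/-! ### Lifting idempotents and constructing local covers -/

section Complete

open IsLocalRing Polynomial

variable {A : Type u} [Ring A] {O : Type w} [CommRing O] [Algebra O A]

lemma Basis.mem_smul_top_iff {M ι : Type*} [AddCommGroup M] [Module O M] [Finite ι]
    (b : Module.Basis ι O M) (I : Ideal O) (x : M) :
    x ∈ I • (⊤ : Submodule O M) ↔ ∀ i, b.repr x i ∈ I := by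
  have := Fintype.ofFinite ι
  constructor
  · intro hx i
    have := Submodule.smul_top_le_comap_smul_top I (b.coord i) hx
    simpa using this
  · intro h
    rw [← b.sum_repr x]
    exact sum_mem fun i _ => Submodule.smul_mem_smul (h i) trivial

/-- In a basis of `A` over `O` the limit can be taken coordinate by coordinate. -/
lemma exists_limit (I : Ideal O) [IsAdicComplete I O] [Module.Finite O A] [Module.Free O A]
    (f : ℕ → A)
    (hf : ∀ {m n}, m ≤ n → f n - f m ∈ (I ^ m) • (⊤ : Submodule O A)) :
    ∃ L, ∀ n, L - f n ∈ (I ^ n) • (⊤ : Submodule O A) := by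
  let b := Module.Free.chooseBasis O A
  have h : ∀ i, ∃ l : O, ∀ n, b.repr (f n) i ≡ l [SMOD (I ^ n • ⊤ : Submodule O O)] := by
    intro i
    refine IsPrecomplete.prec (I := I) (M := O) inferInstance
      (f := fun n => b.repr (f n) i) fun {m n} hmn => ?_
    rw [SModEq.comm, SModEq.sub_mem]
    have := (Basis.mem_smul_top_iff b _ _).1 (hf hmn) i
    simpa using this
  choose l hl using h
  refine ⟨b.repr.symm (Finsupp.equivFunOnFinite.symm l), fun n => ?_⟩
  rw [Basis.mem_smul_top_iff b]
  intro i
  have := SModEq.sub_mem.1 (hl i n).symm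
  simpa using this

lemma eq_zero_of_forall_mem (I : Ideal O) [IsAdicComplete I O] [Module.Finite O A]
    [Module.Free O A] {x : A} (h : ∀ n, x ∈ (I ^ n) • (⊤ : Submodule O A)) : x = 0 := by
  let b := Module.Free.chooseBasis O A
  refine b.repr.injective (Finsupp.ext fun i => ?_)
  rw [map_zero, Finsupp.zero_apply]
  refine IsHausdorff.haus (I := I) (M := O) inferInstance _ fun n => ?_
  rw [SModEq.zero]
  have := (Basis.mem_smul_top_iff b _ _).1 (h n) i
  simpa using this

variable [IsLocalRing O] [IsAdicComplete (maximalIdeal O) O] [Module.Finite O A] [Module.Free O A]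

variable (O) in
include O in
/-- Idempotents lift modulo the Jacobson radical. -/
lemma exists_idempotent_sub_mem_jacobson {a : A} (ha : a ^ 2 - a ∈ Ring.jacobson A) :
    ∃ e : A, e * e = e ∧ e - a ∈ Ring.jacobson A := by
  obtain ⟨n, hn⟩ := exists_pow_mem_of_mem_jacobson O ha
  -- As `(a² - a)ⁿ ∈ 𝔪A` and `2 ^ (nN) ≥ nN`, the Newton iterate of index `nN` is idempotent modulo
  -- `𝔪ᴺ`; hence the indexing by multiples of `n`.
  have hdvd : ∀ {N : ℕ} {q : ℤ[X]}, (X ^ 2 - X) ^ (2 ^ (n * N)) ∣ q →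
      aeval a q ∈ (maximalIdeal O ^ N) • (⊤ : Submodule O A) := by
    intro N q hq
    obtain ⟨r, rfl⟩ := (pow_dvd_pow _ (Nat.lt_two_pow_self (n := n * N)).le).trans hq
    rw [map_mul, map_pow, pow_mul]
    refine mul_mem_smul_top_right _ (pow_mem_smul_top ?_ N)
    simpa using hn
  obtain ⟨e, he⟩ := exists_limit (maximalIdeal O)
    (fun N => aeval a (idempotentPoly (n * N))) fun {N M} h => by
      rw [← map_sub]
      exact hdvd (dvd_idempotentPoly_sub (Nat.mul_le_mul_left n h))
  refine ⟨e, ?_, ?_⟩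
  · rw [← sub_eq_zero]
    refine eq_zero_of_forall_mem (maximalIdeal O) fun N => ?_
    have h1 := hdvd (N := N) (dvd_idempotentPoly (n * N))
    have h2 := he N
    set y := aeval a (idempotentPoly (n * N)) with hy
    rw [map_sub, map_pow, ← hy] at h1
    have h3 : e * e - e = (y ^ 2 - y) + ((e - y) * e + y * (e - y) - (e - y)) := by
      rw [pow_two]
      noncomm_ring
    rw [h3]
    exact add_mem h1 (sub_mem (add_mem (mul_mem_smul_top_right _ h2)
      (mul_mem_smul_top_left _ h2)) h2)
  · have h1 : e - aeval a (idempotentPoly (n * 1)) ∈ Ring.jacobson A :=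
      maximalIdeal_smul_top_le_jacobson O (by simpa using he 1)
    have h2 : aeval a (idempotentPoly (n * 1)) - a ∈ Ring.jacobson A := by
      obtain ⟨q, hq⟩ := dvd_idempotentPoly_sub (Nat.zero_le (n * 1))
      have h3 := congrArg (aeval a) hq
      rw [idempotentPoly, map_sub, aeval_X, pow_zero, pow_one, map_mul] at h3
      rw [h3]
      refine Ideal.mul_mem_right _ _ ?_
      simpa using ha
    simpa using add_mem h1 h2

variable (O) in
include O in
/-- Local covers of simple modules over a finite free algebra over a complete local ring. -/
lemma exists_isLocalCover (I : Submodule A A) (hI : IsCoatom I) :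
    ∃ (P : FGProj A) (π : P.carrier →ₗ[A] A ⧸ I), IsLocalCover π := by
  set J : Submodule A A := Ring.jacobson A with hJ
  have hJI : J ≤ I := sInf_le hI
  have := isArtinian_quotient_jacobson (A := A) O
  have : IsSemisimpleModule A (A ⧸ J) :=
    (IsArtinian.isSemisimpleModule_iff_jacobson A (A ⧸ J)).2 (Module.jacobson_quotient_jacobson A A)
  have hmap : ∀ x, J.mkQ x ∈ I.map J.mkQ ↔ x ∈ I := fun x => by
    rw [← Submodule.mem_comap, Submodule.comap_map_mkQ, sup_eq_right.2 hJI]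
  -- `C` is a complement of `I / J` in the semisimple module `A / J`, and `a` represents the
  -- component of `1` in `C`. Then `a² - a` lies in `C` and in `I` modulo `J`, hence in `J`.
  obtain ⟨C, hC⟩ := exists_isCompl (I.map J.mkQ)
  have hzero : ∀ x, J.mkQ x ∈ C → x ∈ I → x ∈ J := fun x h1 h2 => by
    rw [← Submodule.Quotient.mk_eq_zero, ← Submodule.mkQ_apply]
    exact Submodule.disjoint_def.1 hC.disjoint _ ((hmap x).2 h2) h1
  obtain ⟨a, ha, haI⟩ : ∃ a, J.mkQ a ∈ C ∧ 1 - a ∈ I := by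
    obtain ⟨v, hv, u, hu, huv⟩ := Submodule.mem_sup.1
      (hC.sup_eq_top ▸ Submodule.mem_top : J.mkQ 1 ∈ I.map J.mkQ ⊔ C)
    obtain ⟨a, rfl⟩ := J.mkQ_surjective u
    refine ⟨a, hu, (hmap _).1 ?_⟩
    rwa [map_sub, ← huv, add_sub_cancel_right]
  obtain ⟨e, he, hea⟩ := exists_idempotent_sub_mem_jacobson O (a := a) <| by
    refine hzero _ ?_ ?_
    · rw [map_sub, pow_two, ← smul_eq_mul, map_smul]
      exact sub_mem (C.smul_mem a ha) ha
    · have : a ^ 2 - a = -(a • (1 - a)) := by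
        rw [smul_eq_mul]
        noncomm_ring
      rw [this]
      exact neg_mem (I.smul_mem a haI)
  have heI : 1 - e ∈ I := by
    have : 1 - e = (1 - a) - (e - a) := by abel
    rw [this]
    exact sub_mem haI (hJI hea)
  have heC : J.mkQ e ∈ C := by
    have : J.mkQ e = J.mkQ a := by
      rw [← sub_eq_zero, ← map_sub]
      exact (Submodule.Quotient.mk_eq_zero _).2 hea
    rwa [this]
  let P : Submodule A A := Submodule.span A {e}
  have heP : e ∈ P := Submodule.mem_span_singleton_self e
  have hP : ∀ x ∈ P, x * e = x := by
    intro x hx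
    obtain ⟨b, rfl⟩ := Submodule.mem_span_singleton.1 hx
    rw [smul_eq_mul, mul_assoc, he]
  have hproj : Module.Projective A P := by
    refine Module.Projective.of_split P.subtype
      (LinearMap.toSpanSingleton A P ⟨e, heP⟩) (LinearMap.ext fun x => Subtype.ext ?_)
    exact hP x x.2
  have hfin : Module.Finite A P := Module.Finite.span_singleton A e
  let π : P →ₗ[A] A ⧸ I := I.mkQ ∘ₗ P.subtype
  have hbe : ∀ b : A, I.mkQ (b * e) = I.mkQ b := fun b => by
    rw [eq_comm, ← sub_eq_zero, ← map_sub, Submodule.mkQ_apply, Submodule.Quotient.mk_eq_zero]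
    have : b - b * e = b • (1 - e) := by rw [smul_eq_mul, mul_sub, mul_one]
    rw [this]
    exact I.smul_mem b heI
  refine ⟨⟨P⟩, π, ⟨fun y => ?_, fun N hN => ?_⟩⟩
  · obtain ⟨b, rfl⟩ := I.mkQ_surjective y
    exact ⟨⟨b * e, P.smul_mem b heP⟩, hbe b⟩
  · by_contra hle
    apply hN
    have := isSimpleModule_iff_isCoatom.2 hI
    have htop : N.map π = ⊤ := (eq_bot_or_eq_top _).resolve_left fun h => hle fun x hx => by
      have : π x ∈ N.map π := ⟨x, hx, rfl⟩
      rwa [h] at this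
    obtain ⟨n, hn, hne⟩ : π ⟨e, heP⟩ ∈ N.map π := htop ▸ trivial
    -- The difference lies both in `C` and in `I` modulo `J`. So `u = 1 - (e - n)` is a unit with `u
    -- e = n`, which puts `e` into `N` and forces `N = Ae`.
    have hy : e - n ∈ J := by
      refine hzero _ ?_ ?_
      · rw [← hP n n.2, map_sub, ← smul_eq_mul, map_smul]
        exact sub_mem heC (C.smul_mem _ heC)
      · rw [← Submodule.Quotient.mk_eq_zero, ← Submodule.mkQ_apply, map_sub, sub_eq_zero]
        exact hne.symm
    obtain ⟨u, hu⟩ := isUnit_one_sub_of_mem_jacobson hy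
    have h1 : (u : A) * e = n := by
      rw [hu, sub_mul, one_mul, sub_mul, he, hP n n.2]
      abel
    have h2 : (⟨e, heP⟩ : P) ∈ N := by
      have : (⟨e, heP⟩ : P) = (↑u⁻¹ : A) • n := Subtype.ext (by
        rw [Submodule.coe_smul, ← h1, smul_eq_mul, ← mul_assoc, Units.inv_mul, one_mul])
      rw [this]
      exact N.smul_mem _ hn
    refine eq_top_iff.2 fun x _ => ?_
    have : x = (x : A) • (⟨e, heP⟩ : P) := Subtype.ext (hP x x.2).symm
    rw [this]
    exact N.smul_mem _ h2

end Complete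

/-! ### Commutativity of endomorphism rings -/

section EndComm

variable {Λ : Type*} [Ring Λ] {S : Type*} [AddCommGroup S] [Module Λ S]
  {R : Type*} [CommRing R] [Module R S] [SMulCommClass R Λ S] [SMulCommClass Λ R S]

/-- Every homomorphism from a simple submodule `T` into the sum of its `R`-translates is a sum of
`R`-multiples of endomorphisms of `T`. -/
lemma mem_closure_of_iSup_map_eq_top (T : Submodule Λ S) [IsSimpleModule Λ T]
    (hT : ⨆ r : R, T.map (DistribSMul.toLinearMap Λ S r) = ⊤) (w : T →ₗ[Λ] S) :
    w ∈ AddSubgroup.closure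
      {w : T →ₗ[Λ] S | ∃ (r : R) (ε : Module.End Λ T), w = r • (T.subtype ∘ₗ ε)} := by
  classical
  let m : R → Submodule Λ S := fun r => T.map (DistribSMul.toLinearMap Λ S r)
  let φ : ∀ r : R, T →ₗ[Λ] S := fun r => DistribSMul.toLinearMap Λ S r ∘ₗ T.subtype
  have hm : ∀ r, m r = LinearMap.range (φ r) := fun r => by
    simp [m, φ, LinearMap.range_comp]
  have hφ : ∀ r, φ r ≠ 0 → Function.Injective (φ r) := fun r h =>
    LinearMap.injective_of_ne_zero h
  have hss : ∀ r, IsSemisimpleModule Λ (m r) := fun r => by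
    rw [hm]
    exact IsSemisimpleModule.range (φ r)
  have hS : IsSemisimpleModule Λ S :=
    isSemisimpleModule_of_isSemisimpleModule_submodule' hss hT
  -- Each translate `rT` is zero or a copy of `T`, so it is contained in a given submodule or meets
  -- it trivially.
  have hsimple : ∀ r (U : Submodule Λ S), m r ≤ U ∨ Disjoint (m r) U := by
    intro r U
    by_cases h0 : φ r = 0
    · left
      rw [hm, h0, LinearMap.range_zero]
      exact bot_le
    · have : IsSimpleModule Λ (m r) := by
        rw [hm]
        exact IsSimpleModule.congr (LinearEquiv.ofInjective _ (hφ r h0)).symm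
      have hat : IsAtom (m r) := isSimpleModule_iff_isAtom.1 this
      rcases hat.le_iff.1 (inf_le_left : m r ⊓ U ≤ m r) with h | h
      · exact Or.inr (disjoint_iff.2 h)
      · exact Or.inl (inf_eq_left.1 h)
  have key : ∀ (J : Finset R) (w : T →ₗ[Λ] S), LinearMap.range w ≤ ⨆ r ∈ J, m r →
      w ∈ AddSubgroup.closure
        {w : T →ₗ[Λ] S | ∃ (r : R) (ε : Module.End Λ T), w = r • (T.subtype ∘ₗ ε)} := by
    intro J
    induction J using Finset.induction_on with
    | empty =>
      intro w hw
      have : w = 0 := by simpa [LinearMap.range_eq_bot] using hw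
      rw [this]
      exact zero_mem _
    | insert r J _ ih =>
      intro w hw
      rw [Finset.iSup_insert] at hw
      rcases hsimple r (⨆ s ∈ J, m s) with h | h
      · exact ih w (hw.trans (sup_le h le_rfl))
      · by_cases h0 : φ r = 0
        · refine ih w (hw.trans (sup_le ?_ le_rfl))
          rw [hm, h0, LinearMap.range_zero]
          exact bot_le
        -- The projection of `w` to `rT`, along a complement containing the remaining translates,
        -- has the form `r ε` with `ε` an endomorphism of `T`. Subtracting it leaves a map into the
        -- remaining translates.
        · obtain ⟨C, hC, hcompl⟩ := h.symm.exists_isCompl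
          let p := (m r).projectionOnto C hcompl.symm
          let e : T ≃ₗ[Λ] m r := (LinearEquiv.ofInjective _ (hφ r h0)).trans
            (LinearEquiv.ofEq _ _ (hm r).symm)
          have he : ∀ x, ((e x : m r) : S) = r • (x : S) := fun x => rfl
          let ε : Module.End Λ T := e.symm.toLinearMap ∘ₗ p ∘ₗ w
          have hε : ∀ x, r • ((ε x : T) : S) = (p (w x) : S) := fun x => by
            rw [← he]
            simp [ε]
          have hmem : w - r • (T.subtype ∘ₗ ε) ∈ AddSubgroup.closure
              {w : T →ₗ[Λ] S | ∃ (r : R) (ε : Module.End Λ T), w = r • (T.subtype ∘ₗ ε)} := by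
            refine ih _ ?_
            rintro _ ⟨x, rfl⟩
            obtain ⟨n, hn, u, hu, hnu⟩ := Submodule.mem_sup.1 (hw ⟨x, rfl⟩)
            have h1 : (p (w x) : S) = n := by
              rw [← hnu, map_add]
              have h2 : p n = ⟨n, hn⟩ := Submodule.projectionOnto_apply_left hcompl.symm ⟨n, hn⟩
              have h3 : p u = 0 := (Submodule.projectionOnto_apply_eq_zero_iff hcompl.symm).2 (hC hu)
              rw [h2, h3, add_zero]
            have h4 : (w - r • (T.subtype ∘ₗ ε)) x = u := by
              change w x - r • ((ε x : T) : S) = u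
              rw [hε, h1, ← hnu, add_sub_cancel_left]
            rw [h4]
            exact hu
          have := add_mem hmem (AddSubgroup.subset_closure ⟨r, ε, rfl⟩)
          rwa [sub_add_cancel] at this
  -- `T` is finitely generated, so finitely many translates contain the image of `w`.
  have hfg : ∃ J : Finset R, LinearMap.range w ≤ ⨆ r ∈ J, m r := by
    have : Module.Finite Λ T := inferInstance
    have hr : (LinearMap.range w).FG := by
      rw [← Submodule.map_top]
      exact (Module.Finite.fg_top (R := Λ) (M := T)).map w
    obtain ⟨s, hs⟩ := hr
    have h1 : ∀ x : S, ∃ J : Finset R, x ∈ ⨆ r ∈ J, m r := fun x =>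
      (Submodule.mem_iSup_iff_exists_finset (p := m)).1 (by rw [hT]; trivial)
    choose J hJ using h1
    refine ⟨s.biUnion J, ?_⟩
    rw [← hs, Submodule.span_le]
    intro x hx
    refine (biSup_mono fun r hr => ?_ : ⨆ r ∈ J x, m r ≤ ⨆ r ∈ s.biUnion J, m r) (hJ x)
    exact Finset.mem_biUnion.2 ⟨x, hx, hr⟩
  obtain ⟨J, hJ⟩ := hfg
  exact key J w hJ

/-- Endomorphisms that commute with `R` commute with each other, if the module is the sum of the
`R`-translates of a simple submodule with commutative endomorphism ring. -/
lemma end_comm_of_iSup_map_eq_top (T : Submodule Λ S) [IsSimpleModule Λ T]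
    (hT : ⨆ r : R, T.map (DistribSMul.toLinearMap Λ S r) = ⊤)
    (hcomm : ∀ ε η : Module.End Λ T, ε * η = η * ε) (d d' : Module.End Λ S)
    (hd : ∀ (r : R) x, d (r • x) = r • d x) (hd' : ∀ (r : R) x, d' (r • x) = r • d' x) (x : S) :
    d (d' x) = d' (d x) := by
  -- For `w = ∑ rᵢ εᵢ` (inclusion of `T` suppressed) the operator is `Ψ v = ∑ rᵢ v εᵢ`. It sends `d`
  -- to `d w` because `d` commutes with the `rᵢ`, and `s η` to `s w η` because `η` commutes with the
  -- `εᵢ`.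
  have step : ∀ w ∈ AddSubgroup.closure
      {w : T →ₗ[Λ] S | ∃ (r : R) (ε : Module.End Λ T), w = r • (T.subtype ∘ₗ ε)},
      ∃ Ψ : (T →ₗ[Λ] S) →+ (T →ₗ[Λ] S), Ψ (d ∘ₗ T.subtype) = d ∘ₗ w ∧
        ∀ (s : R) (η : Module.End Λ T), Ψ (s • (T.subtype ∘ₗ η)) = s • (w ∘ₗ η) := by
    intro w hw
    induction hw using AddSubgroup.closure_induction with
    | mem w hw =>
      obtain ⟨r, ε, rfl⟩ := hw
      refine ⟨AddMonoidHom.mk' (fun v => r • (v ∘ₗ ε)) fun a b => ?_, ?_, fun s η => ?_⟩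
      · rw [LinearMap.add_comp, smul_add]
      · ext x
        simp [hd]
      · ext x
        have := LinearMap.congr_fun (hcomm η ε) x
        simp only [Module.End.mul_apply] at this
        simp [smul_comm r s, this]
    | zero => exact ⟨0, by simp, by simp⟩
    | add w w' _ _ h h' =>
      obtain ⟨Ψ, h1, h2⟩ := h
      obtain ⟨Ψ', h1', h2'⟩ := h'
      exact ⟨Ψ + Ψ', by simp [h1, h1', LinearMap.comp_add],
        fun s η => by simp [h2, h2', LinearMap.add_comp]⟩
    | neg w _ h =>
      obtain ⟨Ψ, h1, h2⟩ := h
      exact ⟨-Ψ, by simp [h1, LinearMap.comp_neg], fun s η => by simp [h2, LinearMap.neg_comp]⟩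
  obtain ⟨Ψ, h1, h2⟩ := step _ (mem_closure_of_iSup_map_eq_top (R := R) T hT (d' ∘ₗ T.subtype))
  -- For `w = d'` restricted to `T`, the operator `Ψ` is composition with `d'` on all sums of maps
  -- `r ε`. The restriction of `d` is such a sum, so `d d' = Ψ(d) = d' d` on `T`.
  have h3 : ∀ v ∈ AddSubgroup.closure
      {w : T →ₗ[Λ] S | ∃ (r : R) (ε : Module.End Λ T), w = r • (T.subtype ∘ₗ ε)},
      Ψ v = d' ∘ₗ v := by
    intro v hv
    induction hv using AddSubgroup.closure_induction with
    | mem v hv =>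
      obtain ⟨r, ε, rfl⟩ := hv
      rw [h2]
      ext x
      simp [hd']
    | zero => simp
    | add v v' _ _ h h' => rw [map_add, h, h', LinearMap.comp_add]
    | neg v _ h => rw [map_neg, h, LinearMap.comp_neg]
  have h4 : ∀ t : T, d (d' t) = d' (d t) := by
    have := h3 _ (mem_closure_of_iSup_map_eq_top (R := R) T hT (d ∘ₗ T.subtype))
    rw [h1] at this
    exact LinearMap.congr_fun this
  have hx : x ∈ ⨆ r : R, T.map (DistribSMul.toLinearMap Λ S r) := hT ▸ Submodule.mem_top
  induction hx using Submodule.iSup_induction' with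
  | mem r x hx =>
    obtain ⟨t, ht, rfl⟩ := hx
    simp only [DistribSMul.toLinearMap_apply, hd, hd']
    rw [h4 ⟨t, ht⟩]
  | zero => simp
  | add x y _ _ hx hy => simp only [map_add, hx, hy]

end EndComm

/-! ### Group rings over complete local domains -/

section GroupRing

variable (R : Type u) [CommRing R] (G : Type v) [Group G] [Finite G]

/-- In positive characteristic, the endomorphism ring of a simple module over the group ring of
a finite group is commutative. -/
lemma end_comm_of_isSimpleModule {p : ℕ} (hp : p ≠ 0) (S : Type*) [AddCommGroup S]
    [Module (MonoidAlgebra R G) S] [IsSimpleModule (MonoidAlgebra R G) S]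
    (hS : ∀ x : S, p • x = 0) (d d' : Module.End (MonoidAlgebra R G) S) : d * d' = d' * d := by
  let : Module R S := Module.compHom S (algebraMap R (MonoidAlgebra R G))
  have : IsScalarTower R (MonoidAlgebra R G) S := .of_algebraMap_smul fun _ _ => rfl
  let φ := MonoidAlgebra.mapRingHom G (Int.castRingHom R)
  let : Module (MonoidAlgebra ℤ G) S := Module.compHom S φ
  have hΛ : ∀ (a : MonoidAlgebra ℤ G) (x : S), a • x = φ a • x := fun _ _ => rfl
  have : SMulCommClass R (MonoidAlgebra ℤ G) S := ⟨fun r a x => by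
    rw [hΛ, hΛ, smul_comm]⟩
  have : SMulCommClass (MonoidAlgebra ℤ G) R S := SMulCommClass.symm _ _ _
  have := IsSimpleModule.nontrivial (MonoidAlgebra R G) S
  obtain ⟨v, hv⟩ := exists_ne (0 : S)
  let N : Submodule (MonoidAlgebra ℤ G) S := Submodule.span _ {v}
  -- `N` is finitely generated over `ℤ` and killed by `p ≠ 0`.
  have hfinN : Finite N := by
    have h1 : Module.Finite ℤ (MonoidAlgebra ℤ G) :=
      Module.Finite.equiv (MonoidAlgebra.coeffLinearEquiv (S := ℤ) (M := G) ℤ).symm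
    have h2 : Module.Finite (MonoidAlgebra ℤ G) N := Module.Finite.span_singleton _ v
    have h3 : Module.Finite ℤ N := Module.Finite.trans (MonoidAlgebra ℤ G) N
    refine Module.finite_of_fg_torsion N fun x => ⟨⟨(p : ℤ), ?_⟩, ?_⟩
    · exact mem_nonZeroDivisors_of_ne_zero (by exact_mod_cast hp)
    · ext
      simpa using hS x
  have hN : N ≠ ⊥ := by simpa [N] using hv
  obtain ⟨T, hT, hTN⟩ : ∃ T : Submodule (MonoidAlgebra ℤ G) S, IsAtom T ∧ T ≤ N := by
    have : Nontrivial N := Submodule.nontrivial_iff_ne_bot.2 hN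
    have : IsArtinian (MonoidAlgebra ℤ G) N := inferInstance
    obtain ⟨T, hT⟩ := IsAtomic.exists_atom (Submodule (MonoidAlgebra ℤ G) N)
    have := isSimpleModule_iff_isAtom.2 hT
    refine ⟨T.map N.subtype, isSimpleModule_iff_isAtom.1 ?_, Submodule.map_subtype_le N T⟩
    exact IsSimpleModule.congr (N := T)
      (Submodule.equivMapOfInjective N.subtype N.injective_subtype T).symm
  have hTs : IsSimpleModule (MonoidAlgebra ℤ G) T := isSimpleModule_iff_isAtom.2 hT
  have hTfin : Finite T := Finite.of_injective _ (Submodule.inclusion_injective hTN)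
  -- By Schur's lemma the endomorphism ring is a division ring; it is finite because `T` is, so
  -- Wedderburn's theorem applies.
  have hcomm : ∀ ε η : Module.End (MonoidAlgebra ℤ G) T, ε * η = η * ε := by
    classical
    have : Finite (Module.End (MonoidAlgebra ℤ G) T) := DFunLike.finite _
    exact (littleWedderburn (Module.End (MonoidAlgebra ℤ G) T)).mul_comm
  -- The sum of the translates is stable under `R` and under `G`, so it is a nonzero `RG`-submodule
  -- of the simple module `S`.
  have htop : ⨆ r : R, T.map (DistribSMul.toLinearMap (MonoidAlgebra ℤ G) S r) = ⊤ := by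
    set W := ⨆ r : R, T.map (DistribSMul.toLinearMap (MonoidAlgebra ℤ G) S r) with hW
    have hR : ∀ (r : R) (x : S), x ∈ W → r • x ∈ W := by
      intro r x hx
      induction hx using Submodule.iSup_induction' with
      | mem s x hx =>
        obtain ⟨t, ht, rfl⟩ := hx
        exact Submodule.mem_iSup_of_mem (r * s) ⟨t, ht, mul_smul r s t⟩
      | zero => simp
      | add x y _ _ hx hy =>
        rw [smul_add]
        exact add_mem hx hy
    let W' : Submodule (MonoidAlgebra R G) S :=
      { W.toAddSubmonoid with
        smul_mem' := fun a x hx => by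
          induction a using MonoidAlgebra.induction_linear with
          | zero =>
            rw [zero_smul]
            exact W.zero_mem
          | add a b ha hb =>
            rw [add_smul]
            exact W.add_mem ha hb
          | single g r =>
            have h1 : MonoidAlgebra.single g r • x =
                r • (MonoidAlgebra.single g (1 : ℤ) • x) := by
              rw [hΛ, ← single_one_smul (G := G) r, ← mul_smul, MonoidAlgebra.mapRingHom_single,
                MonoidAlgebra.single_mul_single]
              simp
            rw [h1]
            exact hR r _ (W.smul_mem _ hx) }
    have hmem : ∀ x, x ∈ W' ↔ x ∈ W := fun _ => Iff.rfl
    rcases eq_bot_or_eq_top W' with h | h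
    · obtain ⟨t, ht, ht0⟩ := (Submodule.ne_bot_iff _).1 hT.1
      have h1 : t ∈ W' := (hmem t).2 (Submodule.mem_iSup_of_mem (1 : R) ⟨t, ht, one_smul R t⟩)
      rw [h] at h1
      exact absurd h1 ht0
    · rw [eq_top_iff]
      intro x _
      rw [← hmem, h]
      trivial
  let toΛ : Module.End (MonoidAlgebra R G) S → Module.End (MonoidAlgebra ℤ G) S := fun d =>
    { toFun := d
      map_add' := d.map_add
      map_smul' := fun a x => d.map_smul (φ a) x }
  ext x
  exact end_comm_of_iSup_map_eq_top (R := R) T htop hcomm (toΛ d) (toΛ d')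
    (fun r x => (d.restrictScalars R).map_smul r x)
    (fun r x => (d'.restrictScalars R).map_smul r x) x

variable {G} in
/-- The sum of the coefficients over a conjugacy class. -/
def classSum (c : ConjClasses G) : MonoidAlgebra R G →+ R :=
  letI := Fintype.ofFinite G
  letI := Classical.decEq (ConjClasses G)
  AddMonoidHom.mk' (fun a => ∑ g : G with ConjClasses.mk g = c, a.coeff g) fun a b => by
    simp [Finset.sum_add_distrib]

variable {R G} in
lemma classSum_apply [Fintype G] [DecidableEq (ConjClasses G)] (c : ConjClasses G)
    (a : MonoidAlgebra R G) :
    classSum R c a = ∑ g : G with ConjClasses.mk g = c, a.coeff g := by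
  simp only [classSum, AddMonoidHom.mk'_apply]
  congr!

/-- On group elements this holds because `gk` and `kg` are conjugate. -/
lemma classSum_mul_comm (c : ConjClasses G) (a b : MonoidAlgebra R G) :
    classSum R c (a * b) = classSum R c (b * a) := by
  classical
  have := Fintype.ofFinite G
  induction a using MonoidAlgebra.induction_linear with
  | zero => simp
  | add a a' h h' => rw [add_mul, mul_add, map_add, map_add, h, h']
  | single g r =>
    induction b using MonoidAlgebra.induction_linear with
    | zero => simp
    | add b b' h h' => rw [add_mul, mul_add, map_add, map_add, h, h']
    | single k s =>
      have hgk : ConjClasses.mk (g * k) = ConjClasses.mk (k * g) :=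
        ConjClasses.mk_eq_mk_iff_isConj.2 (isConj_iff.2 ⟨k, by group⟩)
      rw [MonoidAlgebra.single_mul_single, MonoidAlgebra.single_mul_single, classSum_apply,
        classSum_apply]
      simp [MonoidAlgebra.coeff_single, Finsupp.single_apply, hgk, mul_comm s r]

/-- The class in `HH₀` of an element with vanishing class sums is zero. -/
lemma mk_eq_zero_of_classSum (a : MonoidAlgebra R G) (h : ∀ c, classSum R c a = 0) :
    HH0.mk _ a = 0 := by
  classical
  have := Fintype.ofFinite G
  -- In `HH₀` every `r g` may be moved to the chosen representative of the conjugacy class of `g`,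
  -- so only the class sums remain.
  have h1 : ∀ (g : G) (r : R), HH0.mk _ (MonoidAlgebra.single g r) =
      HH0.mk _ (MonoidAlgebra.single (ConjClasses.mk g).out r) := by
    intro g r
    obtain ⟨k, hk⟩ := isConj_iff.1 (ConjClasses.mk_eq_mk_iff_isConj.1 (Quotient.out_eq
      (ConjClasses.mk g)))
    have h2 := HH0.mk_mul_comm (MonoidAlgebra.single (k * (ConjClasses.mk g).out) r)
      (MonoidAlgebra.single k⁻¹ (1 : R))
    rw [MonoidAlgebra.single_mul_single, MonoidAlgebra.single_mul_single, hk] at h2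
    simpa using h2
  have h3 : a = ∑ g, MonoidAlgebra.single g (a.coeff g) := by
    conv_lhs => rw [← MonoidAlgebra.sum_coeff_single a]
    exact Finsupp.sum_fintype _ _ (by simp)
  rw [h3, map_sum]
  rw [← Finset.sum_fiberwise _ ConjClasses.mk]
  refine Finset.sum_eq_zero fun c _ => ?_
  have h4 : ∀ g ∈ Finset.univ.filter fun g : G => ConjClasses.mk g = c,
      HH0.mk _ (MonoidAlgebra.single g (a.coeff g)) =
      HH0.mk _ (MonoidAlgebra.single c.out (a.coeff g)) := by
    intro g hg
    rw [h1, (Finset.mem_filter.1 hg).2]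
  have h5 : ∀ r : R, HH0.mk _ (MonoidAlgebra.single c.out r) =
      (HH0.mk (MonoidAlgebra R G)).comp (MonoidAlgebra.singleAddHom c.out) r := fun _ => rfl
  rw [Finset.sum_congr rfl h4]
  simp_rw [h5]
  rw [← map_sum, ← classSum_apply, h, map_zero]

/-- `HH₀` of the group ring of a finite group over a commutative domain of characteristic zero is
torsion free. -/
lemma hh0_eq_zero_of_nsmul_eq_zero [IsDomain R] [CharZero R] {n : ℕ} (hn : n ≠ 0)
    (y : HH0 (MonoidAlgebra R G)) (hy : n • y = 0) : y = 0 := by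
  obtain ⟨a, rfl⟩ := HH0.mk_surjective y
  refine mk_eq_zero_of_classSum R G a fun c => ?_
  rw [← map_nsmul] at hy
  have h1 : commutatorSubgroup (MonoidAlgebra R G) ≤ (classSum R c).ker := by
    refine (AddSubgroup.closure_le _).2 ?_
    rintro _ ⟨a, b, rfl⟩
    rw [SetLike.mem_coe, AddMonoidHom.mem_ker, map_sub, classSum_mul_comm, sub_self]
  have h2 := h1 ((QuotientAddGroup.eq_zero_iff _).1 hy)
  rw [AddMonoidHom.mem_ker, map_nsmul, nsmul_eq_mul] at h2
  exact (mul_eq_zero.1 h2).resolve_left (Nat.cast_ne_zero.2 hn)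

open IsLocalRing in
/-- The trace map is injective for complete local domains of characteristic zero. -/
theorem trace_injective_of_isAdicComplete [IsDomain R] [CharZero R] [IsLocalRing R]
    [IsAdicComplete (maximalIdeal R) R] : Function.Injective (trace (MonoidAlgebra R G)) := by
  have : Module.Finite R (MonoidAlgebra R G) :=
    Module.Finite.equiv (MonoidAlgebra.coeffLinearEquiv (S := R) (M := G) R).symm
  have : Module.Free R (MonoidAlgebra R G) :=
    Module.Free.of_equiv (MonoidAlgebra.coeffLinearEquiv (S := R) (M := G) R).symm
  obtain ⟨c⟩ := exists_coverSystem fun I hI => exists_isLocalCover (A := MonoidAlgebra R G) R I hI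
  have htors : ∀ (i : c.ι) (r : R) (x : MonoidAlgebra R G ⧸ c.I i), r ∈ maximalIdeal R →
      r • x = 0 := by
    intro i r x hr
    obtain ⟨a, rfl⟩ := Submodule.mkQ_surjective _ x
    have : Ideal.IsMaximal (c.I i) := ⟨c.isCoatom i⟩
    have h1 : r • a ∈ (c.I i).restrictScalars R :=
      maximalIdeal_smul_top_le R (c.I i) (Submodule.smul_mem_smul hr trivial)
    exact (Submodule.Quotient.mk_eq_zero (c.I i)).2 h1
  obtain ⟨p, hp⟩ := CharP.exists (ResidueField R)
  rcases (CharP.char_is_prime_or_zero (ResidueField R) p).symm with rfl | hprime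
  · have : CharZero (ResidueField R) := CharP.charP_to_charZero _
    refine c.trace_injective_of_charZero R fun i => ?_
    let : Module (ResidueField R) (MonoidAlgebra R G ⧸ c.I i) :=
      Module.IsTorsionBySet.module (R := R) (I := maximalIdeal R) fun x r => htors i r x r.2
    have : IsScalarTower R (ResidueField R) (MonoidAlgebra R G ⧸ c.I i) :=
      Module.IsTorsionBySet.isScalarTower _
    refine ⟨ResidueField R, inferInstance, inferInstance, inferInstance, ?_, ?_⟩
    · refine ⟨fun a l x => ?_⟩
      obtain ⟨r, rfl⟩ := residue_surjective l
      have h1 : ∀ x : MonoidAlgebra R G ⧸ c.I i, residue R r • x = r • x := fun x =>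
        algebraMap_smul (ResidueField R) r x
      rw [h1, h1, smul_comm]
    · exact Module.Finite.of_restrictScalars_finite R _ _
  -- The residue field can be too small: over it `Hom(P_S, S)` could have dimension divisible by
  -- `p`. The full endomorphism ring of `S`, a field here, makes it a line.
  · refine c.trace_injective_of_charP R hprime (fun i => ?_)
      (hh0_eq_zero_of_nsmul_eq_zero R G hprime.ne_zero)
    have hpS : ∀ x : MonoidAlgebra R G ⧸ c.I i, p • x = 0 := by
      intro x
      rw [← Nat.cast_smul_eq_nsmul R]
      refine htors i _ x ((residue_eq_zero_iff _).1 ?_)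
      rw [map_natCast, CharP.cast_eq_zero]
    classical
    let L := Module.End (MonoidAlgebra R G) (MonoidAlgebra R G ⧸ c.I i)
    let : Field L := { (inferInstance : DivisionRing L) with
      mul_comm := end_comm_of_isSimpleModule R G hprime.ne_zero _ hpS }
    refine ⟨L, inferInstance, ?_, inferInstance, inferInstance, ?_, fun d => ⟨d, fun x => rfl⟩⟩
    · refine (CharP.charP_iff_prime_eq_zero hprime).2 ?_
      refine LinearMap.ext fun x => ?_
      change ((p : Module.End (MonoidAlgebra R G) _)) x = 0
      rw [Module.End.natCast_apply, hpS]
    · exact Module.Finite.of_restrictScalars_finite R _ _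

end GroupRing

/-! ### The coefficient at a generator -/

section Coefficient

variable {R : Type u} [Ring R] {G : Type v} [Group G]

/-- In the basis `s ⊗ 1` of `ℤS ⊗ RG`, the diagonal entry at `s` of the map induced by right
multiplication by `a` is the part of `a` supported on the stabilizer of `s`. -/
lemma hh0_act_mk (S : Type v) [MulAction G S] [Fintype S] (a : MonoidAlgebra R G) :
    HH0.act R G S (HH0.mk _ a) = ∑ s : S, HH0.mk _ (supportPart R s s a) := by
  rw [HH0.act_mk]
  let ε := Fintype.equivFin S
  rw [hsTrace_eq (e := fun i => PermTensor.of (ε.symm i) (1 : MonoidAlgebra R G))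
    (f := fun i => PermTensor.coord R (ε.symm i))]
  · rw [Equiv.sum_comp ε.symm fun s => HH0.mk _ (PermTensor.coord R s
      (PermTensor.map S (rightMul a) (PermTensor.of s 1)))]
    refine Finset.sum_congr rfl fun s _ => ?_
    rw [PermTensor.map_of]
    change HH0.mk _ (PermTensor.lift (fun t => supportPart R s t)
      (PermTensor.of s (rightMul a 1))) = _
    rw [PermTensor.lift_of, rightMul, LinearMap.toSpanSingleton_apply_one]
  · intro x
    rw [Equiv.sum_comp ε.symm fun s => PermTensor.coord R s x •
      PermTensor.of s (1 : MonoidAlgebra R G)]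
    have := LinearMap.congr_fun (PermTensor.sum_coord (R := R) (G := G) (S := S)) x
    rw [LinearMap.sum_apply] at this
    exact this

variable {F : Type*} [Field F] (τ : R →+ F) (hτ : ∀ a b, τ (a * b) = τ (b * a))
  (g : G) (hg : ∀ h, g * h = h * g)

/-- The functional on `HH₀(RG)` that applies a trace on `R` to the coefficient at a central
element. -/
def coeffTrace : HH0 (MonoidAlgebra R G) →+ F :=
  QuotientAddGroup.lift (commutatorSubgroup (MonoidAlgebra R G))
    (AddMonoidHom.mk' (fun a => τ (a.coeff g)) fun a b => by simp) <| by
    classical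
    refine (AddSubgroup.closure_le _).2 ?_
    rintro _ ⟨a, b, rfl⟩
    rw [SetLike.mem_coe, AddMonoidHom.mem_ker, map_sub, sub_eq_zero]
    simp only [AddMonoidHom.mk'_apply]
    induction a using MonoidAlgebra.induction_linear with
    | zero => simp
    | add a a' h h' => simp only [add_mul, mul_add, MonoidAlgebra.coeff_add, Finsupp.add_apply,
        map_add, h, h']
    | single k r =>
      induction b using MonoidAlgebra.induction_linear with
      | zero => simp
      | add b b' h h' => simp only [add_mul, mul_add, MonoidAlgebra.coeff_add, Finsupp.add_apply,
          map_add, h, h']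
      | single l s =>
        -- Centrality of `g` enters only here.
        have hkl : k * l = g ↔ l * k = g := by
          constructor <;> intro h
          · rw [← mul_right_inj k, ← mul_assoc, h, hg]
          · rw [← mul_right_inj l, ← mul_assoc, h, hg]
        rw [MonoidAlgebra.single_mul_single, MonoidAlgebra.single_mul_single,
          MonoidAlgebra.coeff_single, MonoidAlgebra.coeff_single, Finsupp.single_apply,
          Finsupp.single_apply]
        simp only [hkl]
        split_ifs
        · exact hτ r s
        · rfl

lemma coeffTrace_mk (a : MonoidAlgebra R G) :
    coeffTrace τ hτ g hg (HH0.mk _ a) = τ (a.coeff g) := rfl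

/-- The coefficient of `a` at `g` occurs in the diagonal entry at `s` exactly when `g` fixes `s`. -/
lemma coeffTrace_act (S : Type v) [MulAction G S] [Finite S] (x : HH0 (MonoidAlgebra R G)) :
    coeffTrace τ hτ g hg (HH0.act R G S x) =
      Nat.card {s : S // g • s = s} * coeffTrace τ hτ g hg x := by
  classical
  have := Fintype.ofFinite S
  obtain ⟨a, rfl⟩ := HH0.mk_surjective x
  rw [hh0_act_mk, map_sum]
  simp only [coeffTrace_mk]
  induction a using MonoidAlgebra.induction_linear with
  | zero => simp
  | add a b ha hb => simp only [map_add, MonoidAlgebra.coeff_add, Finsupp.add_apply,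
      Finset.sum_add_distrib, ha, hb, mul_add]
  | single h r =>
    simp only [supportPart_single]
    by_cases hh : h = g
    · subst hh
      have : ∀ s : S, τ ((if h • s = s then MonoidAlgebra.single h r else 0 :
          MonoidAlgebra R G).coeff h) = if h • s = s then τ r else 0 := fun s => by
        split_ifs <;> simp [MonoidAlgebra.coeff_single]
      simp only [this]
      rw [Finset.sum_ite, Finset.sum_const_zero, add_zero, Finset.sum_const, nsmul_eq_mul,
        Nat.card_eq_fintype_card, Fintype.card_subtype]
      simp [MonoidAlgebra.coeff_single]
    · have : ∀ s : S, τ ((if h • s = s then MonoidAlgebra.single h r else 0 :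
          MonoidAlgebra R G).coeff g) = 0 := fun s => by
        split_ifs <;> simp [MonoidAlgebra.coeff_single, hh]
      simp [this, MonoidAlgebra.coeff_single, hh]

-- A point fixed by a generator is fixed by the whole group, so the multiplier is the mark of `b` at
-- the full group.
variable {g} in
lemma coeffTrace_burnsideAct (hgen : ∀ x : G, x ∈ Subgroup.zpowers g) (b : Burnside G)
    (x : HH0 (MonoidAlgebra R G)) :
    coeffTrace τ hτ g hg (HH0.burnsideAct R G b x) =
      (chi G b ⊤ : F) * coeffTrace τ hτ g hg x := by
  refine DFunLike.congr_fun (F := Burnside G →+ F)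
    (f := (coeffTrace τ hτ g hg).comp ((AddMonoidHom.eval x).comp (HH0.burnsideAct R G)))
    (g := (AddMonoidHom.mulRight (coeffTrace τ hτ g hg x)).comp ((Int.castAddHom F).comp
      ((Pi.evalAddMonoidHom _ ⊤).comp (chi G))))
    (Burnside.hom_ext fun S _ _ => ?_) b
  change coeffTrace τ hτ g hg (HH0.burnsideAct R G (Burnside.mk G S) x) =
    (chi G (Burnside.mk G S) ⊤ : F) * _
  have h2 : HH0.burnsideAct R G (Burnside.mk G S) = HH0.act R G S := lift_of _ _
  rw [h2]
  refine (coeffTrace_act τ hτ g hg S x).trans ?_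
  rw [chi_mk]
  congr 1
  norm_cast
  refine congrArg _ (Nat.card_congr (Equiv.subtypeEquivRight fun s => ?_))
  rw [MulAction.mem_fixedPoints]
  constructor
  · rintro h ⟨y, -⟩
    obtain ⟨n, rfl⟩ := Subgroup.mem_zpowers_iff.1 (hgen y)
    have : g ∈ MulAction.stabilizer G s := h
    exact zpow_mem this n
  · exact fun h => h ⟨g, trivial⟩

variable [CharZero F]

/-- The rationalization of `coeffTrace`. -/
def ratCoeffTrace : ℚ ⊗[ℤ] HH0 (MonoidAlgebra R G) →ₗ[ℚ] F :=
  LinearMap.liftBaseChange ℚ (coeffTrace τ hτ g hg).toIntLinearMap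

lemma ratCoeffTrace_tmul (q : ℚ) (x : HH0 (MonoidAlgebra R G)) :
    ratCoeffTrace τ hτ g hg (q ⊗ₜ x) = q • coeffTrace τ hτ g hg x := rfl

variable {g} in
lemma ratCoeffTrace_ratAct (hgen : ∀ x : G, x ∈ Subgroup.zpowers g) (t : ℚ ⊗[ℤ] Burnside G)
    (y : ℚ ⊗[ℤ] HH0 (MonoidAlgebra R G)) :
    ratCoeffTrace τ hτ g hg (ratAct (HH0.burnsideAct R G) t y) =
      chiQ G t ⊤ • ratCoeffTrace τ hτ g hg y := by
  induction t using TensorProduct.induction_on with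
  | zero => simp
  | add a b ha hb => simp only [map_add, LinearMap.add_apply, Pi.add_apply, add_smul, ha, hb]
  | tmul q b =>
    induction y using TensorProduct.induction_on with
    | zero => simp
    | add a b ha hb => simp only [map_add, smul_add, ha, hb]
    | tmul q' x =>
      rw [ratAct_tmul, ratCoeffTrace_tmul, coeffTrace_burnsideAct τ hτ hg hgen,
        ratCoeffTrace_tmul]
      change _ = (q * ((chi G b ⊤ : ℤ) : ℚ)) • _
      simp only [Rat.smul_def]
      push_cast
      ring

end Coefficient

/-- The class in `K₀` of the projective module generated by an idempotent. -/
lemma exists_trace_eq_mk_of_isIdempotentElem {A : Type u} [Ring A] {e : A}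
    (he : IsIdempotentElem e) : ∃ x : K0 A, trace A x = HH0.mk A e := by
  let P : Submodule A A := Submodule.span A {e}
  have hmem : ∀ x ∈ P, x * e = x := by
    intro x hx
    obtain ⟨a, rfl⟩ := Submodule.mem_span_singleton.1 hx
    rw [smul_eq_mul, mul_assoc, he]
  have : Module.Finite A P := Module.Finite.span_singleton A e
  have : Module.Projective A P := by
    refine Module.Projective.of_split P.subtype (LinearMap.toSpanSingleton A P
      ⟨e, Submodule.mem_span_singleton_self e⟩) ?_
    ext x
    exact hmem x x.2
  refine ⟨Algebra.GrothendieckAddGroup.of (ProjClass.mk P), ?_⟩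
  rw [trace, lift_of]
  change hsTrace P LinearMap.id = _
  rw [hsTrace_eq (n := 1) (e := fun _ => ⟨e, Submodule.mem_span_singleton_self e⟩)
    (f := fun _ => P.subtype)]
  · simp
  · intro x
    ext
    simpa using hmem x x.2

/-- The idempotent `e = |C|⁻¹ ∑ k` has coefficient `|C|⁻¹` at a generator `g`, and `θ_C` multiplies
coefficients at `g` by its mark at `C`, which is `1`. Hence `θ_C` applied to the class of `RC e` has
nonzero trace. -/
lemma nontrivial_range_thetaK0 {R : Type u} [Ring R] {C : Type v} [Group C] [Finite C] [IsCyclic C]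
    {F : Type*} [Field F] [CharZero F] (τ : R →+ F) (hτ : ∀ a b, τ (a * b) = τ (b * a))
    (h1 : τ 1 ≠ 0) (h : IsUnit (Nat.card C : R)) :
    Nontrivial (LinearMap.range (thetaK0 R C)) := by
  classical
  have := Fintype.ofFinite C
  obtain ⟨g, hgen⟩ := IsCyclic.exists_generator (α := C)
  have hg : ∀ x, g * x = x * g := fun x => mul_comm_of_cyclic C g x
  let c : R := ((h.unit⁻¹ : Rˣ) : R)
  have hc : (Nat.card C : R) * c = 1 := h.unit.mul_inv
  let e : MonoidAlgebra R C := ∑ k : C, MonoidAlgebra.single k c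
  have hk : ∀ k, MonoidAlgebra.single k c * e = MonoidAlgebra.single 1 c * e := by
    intro k
    simp only [e, Finset.mul_sum, MonoidAlgebra.single_mul_single]
    rw [← Equiv.sum_comp (Equiv.mulLeft k) fun x => MonoidAlgebra.single (1 * x) (c * c)]
    simp
  have he : IsIdempotentElem e := by
    change e * e = e
    conv_lhs => enter [1]; change ∑ k : C, MonoidAlgebra.single k c
    rw [Finset.sum_mul, Finset.sum_congr rfl fun k _ => hk k, Finset.sum_const, Finset.card_univ,
      ← Nat.card_eq_fintype_card, nsmul_eq_mul, ← mul_assoc, MonoidAlgebra.natCast_def,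
      MonoidAlgebra.single_mul_single, hc, one_mul, ← MonoidAlgebra.one_def, one_mul]
  obtain ⟨x, hx⟩ := exists_trace_eq_mk_of_isIdempotentElem he
  have hcoeff : e.coeff g = c := by
    simp [e, MonoidAlgebra.coeff_sum, MonoidAlgebra.coeff_single, Finsupp.single_apply]
  have hτc : τ c ≠ 0 := by
    intro h0
    apply h1
    rw [← hc, ← nsmul_eq_mul, map_nsmul, h0, smul_zero]
  have htop : chiQ C (theta C) ⊤ = 1 := by
    have h2 : chiQ C (theta C) = fun D => if D = ⊤ then 1 else 0 :=
      (LinearEquiv.ofBijective (chiQ C) (chiQ_bijective (mul_comm_of_cyclic C))).apply_symm_apply _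
    rw [h2]
    simp
  refine ⟨⟨⟨_, (1 : ℚ) ⊗ₜ[ℤ] x, rfl⟩, 0, fun h0 => hτc ?_⟩⟩
  have h3 : thetaK0 R C ((1 : ℚ) ⊗ₜ[ℤ] x) = 0 := congrArg Subtype.val h0
  have h4 := ratCoeffTrace_ratAct τ hτ hg hgen (theta C)
    (rat (trace _) ((1 : ℚ) ⊗ₜ[ℤ] x))
  rw [← rat_trace_ratAct, ← thetaK0, h3, map_zero, map_zero, htop, one_smul] at h4
  have h5 : rat (trace (MonoidAlgebra R C)) ((1 : ℚ) ⊗ₜ[ℤ] x) = 1 ⊗ₜ[ℤ] trace _ x := rfl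
  rw [h5, ratCoeffTrace_tmul, hx, coeffTrace_mk, hcoeff, one_smul] at h4
  exact h4.symm

/-- The trace of the regular representation serves as `τ`: its value at `1` is `dim_F R`, nonzero in
characteristic zero. -/
lemma nontrivial_range_thetaK0_of_algebra (F : Type*) [Field F] [CharZero F] (R : Type u) [Ring R]
    [Algebra F R] [FiniteDimensional F R] [Nontrivial R] (C : Type v) [Group C] [Finite C]
    [IsCyclic C] : Nontrivial (LinearMap.range (thetaK0 R C)) := by
  refine nontrivial_range_thetaK0
    (LinearMap.trace F R ∘ₗ (Algebra.lmul F R).toLinearMap).toAddMonoidHom (fun a b => ?_) ?_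
    (isUnit_natCast_of_algebra F R Nat.card_pos.ne')
  · change LinearMap.trace F R (Algebra.lmul F R (a * b)) =
      LinearMap.trace F R (Algebra.lmul F R (b * a))
    rw [map_mul (Algebra.lmul F R), map_mul (Algebra.lmul F R), LinearMap.trace_mul_comm]
  · change LinearMap.trace F R (Algebra.lmul F R 1) ≠ 0
    rw [map_one, LinearMap.trace_one]
    exact Nat.cast_ne_zero.2 Module.finrank_pos.ne'

/-! ### Classes of modules over hereditary rings -/

section Rationally

/-- A homomorphism is rationally injective if its kernel is torsion. -/
lemma rat_injective_of_torsion {M N : Type*} [AddCommGroup M] [AddCommGroup N] (f : M →+ N)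
    (hf : ∀ x, f x = 0 → x ∈ AddCommGroup.torsion M) : Function.Injective (rat f) := by
  rw [injective_iff_map_eq_zero]
  intro y hy
  -- By flatness of `ℚ` the kernel of the rationalization comes from `ℚ ⊗ ker f`, and `q ⊗ x = (q /
  -- n) ⊗ n x` vanishes when `n x = 0`.
  have hex : Function.Exact (LinearMap.ker f.toIntLinearMap).subtype f.toIntLinearMap :=
    LinearMap.exact_subtype_ker_map _
  obtain ⟨z, rfl⟩ := (Module.Flat.lTensor_exact ℚ hex y).1 hy
  induction z using TensorProduct.induction_on with
  | zero => exact map_zero _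
  | add a b ha hb =>
    have h0 : ∀ z, (LinearMap.lTensor ℚ f.toIntLinearMap)
      ((LinearMap.lTensor ℚ (LinearMap.ker f.toIntLinearMap).subtype) z) = 0 :=
      fun z => (Module.Flat.lTensor_exact ℚ hex _).2 ⟨z, rfl⟩
    rw [map_add, ha (h0 a), hb (h0 b), add_zero]
  | tmul q x =>
    obtain ⟨n, hn, hx⟩ := isOfFinAddOrder_iff_nsmul_eq_zero.1 (hf x x.2)
    have h1 : q = (q / n) * (n : ℤ) := by
      rw [Int.cast_natCast, div_mul_cancel₀]
      exact_mod_cast hn.ne'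
    change q ⊗ₜ[ℤ] (x : M) = 0
    rw [h1, mul_comm, ← zsmul_eq_mul, TensorProduct.smul_tmul, natCast_zsmul, hx,
      TensorProduct.tmul_zero]

end Rationally

/-! ### Euler classes over hereditary rings -/

section Chi

variable {A : Type u} [Ring A]

/-- The class in `K₀` of a finitely generated projective module. -/
def cls (P : Type u) [AddCommGroup P] [Module A P] [Module.Finite A P] [Module.Projective A P] :
    K0 A :=
  Algebra.GrothendieckAddGroup.of (ProjClass.mk P)

section

variable {P Q : Type u} [AddCommGroup P] [Module A P] [Module.Finite A P] [Module.Projective A P]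
  [AddCommGroup Q] [Module A Q] [Module.Finite A Q] [Module.Projective A Q]

lemma cls_congr (e : P ≃ₗ[A] Q) : cls (A := A) P = cls Q := by
  rw [cls, ProjClass.mk_eq e, cls]

lemma cls_of_subsingleton [Subsingleton P] : cls (A := A) P = 0 := by
  rw [cls, ProjClass.mk_zero, map_zero]

lemma cls_prodEquiv {K : Type u} [AddCommGroup K] [Module A K] [Module.Finite A K]
    [Module.Projective A K] (e : P ≃ₗ[A] K × Q) : cls (A := A) P = cls K + cls Q := by
  rw [cls, ProjClass.mk_eq e, ← ProjClass.mk_add, map_add, cls, cls]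

end

variable (A) in
/-- Left noetherian left hereditary rings. -/
class IsHereditary : Prop where
  isNoetherianRing : IsNoetherianRing A
  projective : ∀ (P : Type u) [AddCommGroup P] [Module A P] [Module.Finite A P]
    [Module.Projective A P] (N : Submodule A P), Module.Projective A N

attribute [instance] IsHereditary.isNoetherianRing

variable [IsHereditary A]

instance {P : Type u} [AddCommGroup P] [Module A P] [Module.Finite A P] [Module.Projective A P]
    (N : Submodule A P) : Module.Projective A N := IsHereditary.projective P N

section

variable {P Q : Type u} [AddCommGroup P] [Module A P] [Module.Finite A P] [Module.Projective A P]
  [AddCommGroup Q] [Module A Q] [Module.Finite A Q] [Module.Projective A Q]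

lemma cls_eq_ker_add (π : P →ₗ[A] Q) (hπ : Function.Surjective π) :
    cls (A := A) P = cls (LinearMap.ker π) + cls Q := by
  obtain ⟨e⟩ := exists_prodEquiv_of_surjective π hπ
  exact cls_prodEquiv e

variable {X : Type*} [AddCommGroup X] [Module A X]

/-- Schanuel's lemma. -/
lemma cls_sub_ker_eq {π : P →ₗ[A] X} {π' : Q →ₗ[A] X} (hπ : Function.Surjective π)
    (hπ' : Function.Surjective π') :
    cls (A := A) P - cls (LinearMap.ker π) = cls Q - cls (LinearMap.ker π') := by
  -- `E` is the fibre product of `P` and `Q` over `X`. It maps onto `P` with kernel `ker π'` and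
  -- onto `Q` with kernel `ker π`.
  let E := LinearMap.ker (π ∘ₗ LinearMap.fst A P Q - π' ∘ₗ LinearMap.snd A P Q)
  have hE : ∀ x : P × Q, x ∈ E ↔ π x.1 = π' x.2 := fun x => by simp [E, sub_eq_zero]
  let p : E →ₗ[A] P := LinearMap.fst A P Q ∘ₗ E.subtype
  let q : E →ₗ[A] Q := LinearMap.snd A P Q ∘ₗ E.subtype
  have hp : Function.Surjective p := fun x => by
    obtain ⟨y, hy⟩ := hπ' (π x)
    exact ⟨⟨(x, y), (hE _).2 hy.symm⟩, rfl⟩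
  have hq : Function.Surjective q := fun x => by
    obtain ⟨y, hy⟩ := hπ (π' x)
    exact ⟨⟨(y, x), (hE _).2 hy⟩, rfl⟩
  let ep : LinearMap.ker p ≃ₗ[A] LinearMap.ker π' :=
    { toFun := fun x => ⟨x.1.1.2, by
        have h1 := (hE _).1 x.1.2
        have h2 : x.1.1.1 = 0 := x.2
        rw [LinearMap.mem_ker, ← h1, h2, map_zero]⟩
      map_add' := fun _ _ => rfl
      map_smul' := fun _ _ => rfl
      invFun := fun y => ⟨⟨(0, y), (hE _).2 (by simp)⟩, rfl⟩
      left_inv := fun x => by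
        have h2 : x.1.1.1 = 0 := x.2
        ext
        · exact h2.symm
        · rfl
      right_inv := fun _ => rfl }
  let eq : LinearMap.ker q ≃ₗ[A] LinearMap.ker π :=
    { toFun := fun x => ⟨x.1.1.1, by
        have h1 := (hE _).1 x.1.2
        have h2 : x.1.1.2 = 0 := x.2
        rw [LinearMap.mem_ker, h1, h2, map_zero]⟩
      map_add' := fun _ _ => rfl
      map_smul' := fun _ _ => rfl
      invFun := fun y => ⟨⟨(y, 0), (hE _).2 (by simp)⟩, rfl⟩
      left_inv := fun x => by
        have h2 : x.1.1.2 = 0 := x.2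
        ext
        · rfl
        · exact h2.symm
      right_inv := fun _ => rfl }
  have h1 := cls_eq_ker_add p hp
  have h2 := cls_eq_ker_add q hq
  rw [show cls (A := A) (LinearMap.ker p) = _ from cls_congr ep] at h1
  rw [show cls (A := A) (LinearMap.ker q) = _ from cls_congr eq] at h2
  rw [sub_eq_sub_iff_add_eq_add, add_comm, ← h1, h2, add_comm]

end

/-- The class in `K₀` of a finitely generated module over a hereditary ring. -/
def chi0 (A : Type u) [Ring A] [IsHereditary A] (X : Type*) [AddCommGroup X] [Module A X]
    [Module.Finite A X] : K0 A :=
  cls (Fin (Module.Finite.exists_fin' A X).choose → A) -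
    cls (LinearMap.ker (Module.Finite.exists_fin' A X).choose_spec.choose)

variable {X Y : Type*} [AddCommGroup X] [Module A X] [Module.Finite A X]
  [AddCommGroup Y] [Module A Y] [Module.Finite A Y]

lemma chi0_eq {P : Type u} [AddCommGroup P] [Module A P] [Module.Finite A P]
    [Module.Projective A P] {π : P →ₗ[A] X} (hπ : Function.Surjective π) :
    chi0 A X = cls P - cls (LinearMap.ker π) :=
  cls_sub_ker_eq (Module.Finite.exists_fin' A X).choose_spec.choose_spec hπ

lemma chi0_projective (P : Type u) [AddCommGroup P] [Module A P] [Module.Finite A P]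
    [Module.Projective A P] : chi0 A P = cls P := by
  rw [chi0_eq (π := LinearMap.id (R := A) (M := P)) Function.surjective_id]
  have : Subsingleton (LinearMap.ker (LinearMap.id (R := A) (M := P))) := by
    rw [LinearMap.ker_id]
    infer_instance
  rw [cls_of_subsingleton (P := LinearMap.ker (LinearMap.id (R := A) (M := P))), sub_zero]

lemma chi0_congr (e : X ≃ₗ[A] Y) : chi0 A X = chi0 A Y := by
  obtain ⟨n, π, hπ⟩ := Module.Finite.exists_fin' A X
  rw [chi0_eq hπ, chi0_eq (π := e.toLinearMap ∘ₗ π) (e.surjective.comp hπ)]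
  rw [cls_congr (LinearEquiv.ofEq _ _ (LinearEquiv.ker_comp e π).symm)]

/-- A presentation `π` of `X` also presents `Y` through `f ∘ π`. The new relation module `ker (f ∘
π)` maps onto `ker f` with kernel `ker π`, and it is projective by heredity. -/
lemma chi0_eq_ker_add (f : X →ₗ[A] Y) (hf : Function.Surjective f) :
    chi0 A X = chi0 A (LinearMap.ker f) + chi0 A Y := by
  obtain ⟨n, π, hπ⟩ := Module.Finite.exists_fin' A X
  let g : LinearMap.ker (f ∘ₗ π) →ₗ[A] LinearMap.ker f := π.restrict fun x hx => hx
  have hg : Function.Surjective g := by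
    rintro ⟨y, hy⟩
    obtain ⟨x, rfl⟩ := hπ y
    exact ⟨⟨x, hy⟩, rfl⟩
  let e : LinearMap.ker g ≃ₗ[A] LinearMap.ker π :=
    { toFun := fun x => ⟨x.1.1, congrArg Subtype.val (show g x.1 = 0 from x.2)⟩
      map_add' := fun _ _ => rfl
      map_smul' := fun _ _ => rfl
      invFun := fun x => ⟨⟨x.1, by
        have h : π x.1 = 0 := x.2
        simp [h]⟩, Subtype.ext x.2⟩
      left_inv := fun _ => rfl
      right_inv := fun _ => rfl }
  rw [chi0_eq hπ, chi0_eq hg, chi0_eq (π := f ∘ₗ π) (hf.comp hπ),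
    show cls (A := A) (LinearMap.ker g) = _ from cls_congr e]
  abel

lemma chi0_eq_add (N : Submodule A X) : chi0 A X = chi0 A N + chi0 A (X ⧸ N) := by
  rw [chi0_eq_ker_add N.mkQ N.mkQ_surjective,
    chi0_congr (LinearEquiv.ofEq _ _ N.ker_mkQ)]

lemma chi0_of_subsingleton [Subsingleton X] : chi0 A X = 0 := by
  have h := chi0_eq_add (⊥ : Submodule A X)
  have h1 : chi0 A X = chi0 A (⊥ : Submodule A X) :=
    chi0_congr ((Submodule.topEquiv.symm).trans (LinearEquiv.ofEq _ _ (Subsingleton.elim _ _)))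
  have h2 : chi0 A X = chi0 A (X ⧸ (⊥ : Submodule A X)) :=
    chi0_congr (Submodule.quotEquivOfEqBot ⊥ rfl).symm
  rw [← h1, ← h2] at h
  exact left_eq_add.1 h

/-- A finite length module whose composition factors are isomorphic to `T` has class a multiple
of that of `T`. -/
lemma chi0_eq_nsmul_of_isFiniteLength {X : Type w} [AddCommGroup X] [Module A X]
    [Module.Finite A X] (hX : IsFiniteLength A X) (s : Set A) (hs : ∀ a ∈ s, ∀ x : X, a • x = 0)
    {T : Type*} [AddCommGroup T] [Module A T] [Module.Finite A T]
    (hT : ∀ (S : Type w) [AddCommGroup S] [Module A S] [IsSimpleModule A S],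
      (∀ a ∈ s, ∀ x : S, a • x = 0) → Nonempty (S ≃ₗ[A] T)) :
    ∃ m : ℕ, chi0 A X = m • chi0 A T ∧ (Nontrivial X → m ≠ 0) := by
  -- The induction ranges over all modules, with `s` recording annihilating elements; these pass to
  -- submodules and quotients.
  have key : ∀ (X : Type w) [AddCommGroup X] [Module A X], IsFiniteLength A X →
      ∀ [Module.Finite A X], (∀ a ∈ s, ∀ x : X, a • x = 0) →
      ∃ m : ℕ, chi0 A X = m • chi0 A T ∧ (Nontrivial X → m ≠ 0) := by
    intro X _ _ h
    induction h with
    | of_subsingleton =>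
      intro _ _
      exact ⟨0, by rw [chi0_of_subsingleton, zero_smul], fun h => absurd h (by
        rw [not_nontrivial_iff_subsingleton]; assumption)⟩
    | of_simple_quotient h ih =>
      rename_i X _ _ N _
      intro _ hs
      obtain ⟨m, hm, -⟩ := ih fun a ha x => Subtype.ext (hs a ha x)
      obtain ⟨e⟩ := hT (X ⧸ N) fun a ha x => by
        obtain ⟨y, rfl⟩ := N.mkQ_surjective x
        rw [← map_smul, hs a ha, map_zero]
      exact ⟨m + 1, by rw [chi0_eq_add N, hm, chi0_congr e, add_smul, one_smul], fun _ => by omega⟩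
  exact key X hX hs

/-- The class of a finite length module lies in a subgroup if those of its composition factors
do. -/
lemma chi0_mem_of_isFiniteLength {X : Type w} [AddCommGroup X] [Module A X]
    [Module.Finite A X] (hX : IsFiniteLength A X) (s : Set A) (hs : ∀ a ∈ s, ∀ x : X, a • x = 0)
    (H : AddSubgroup (K0 A))
    (hH : ∀ (S : Type w) [AddCommGroup S] [Module A S] [IsSimpleModule A S],
      (∀ a ∈ s, ∀ x : S, a • x = 0) → chi0 A S ∈ H) :
    chi0 A X ∈ H := by
  have key : ∀ (X : Type w) [AddCommGroup X] [Module A X], IsFiniteLength A X →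
      ∀ [Module.Finite A X], (∀ a ∈ s, ∀ x : X, a • x = 0) → chi0 A X ∈ H := by
    intro X _ _ h
    induction h with
    | of_subsingleton =>
      intro _ _
      rw [chi0_of_subsingleton]
      exact zero_mem H
    | of_simple_quotient h ih =>
      rename_i X _ _ N _
      intro _ hs
      rw [chi0_eq_add N]
      refine add_mem (ih fun a ha x => Subtype.ext (hs a ha x)) (hH (X ⧸ N) fun a ha x => ?_)
      obtain ⟨y, rfl⟩ := N.mkQ_surjective x
      rw [← map_smul, hs a ha, map_zero]
  exact key X hX hs

end Chi

/-- Finitely generated torsion modules over finite algebras over Dedekind domains have finite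
length. -/
lemma isFiniteLength_of_smul_eq_zero {R : Type*} [CommRing R] [IsDedekindDomain R] {A : Type*}
    [Ring A] [Algebra R A] [Module.Finite R A] {X : Type*} [AddCommGroup X] [Module A X]
    [Module.Finite A X] {r : R} (hr : r ≠ 0) (h : ∀ x : X, algebraMap R A r • x = 0) :
    IsFiniteLength A X := by
  let : Module R X := Module.compHom X (algebraMap R A)
  have : IsScalarTower R A X := .of_algebraMap_smul fun _ _ => rfl
  have : Module.Finite R X := Module.Finite.trans A X
  have : IsNoetherian A X := isNoetherian_of_tower R inferInstance
  let : Module (R ⧸ Ideal.span {r}) X := Module.IsTorsionBySet.module (R := R) (fun x y => by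
    obtain ⟨y, hy⟩ := y
    obtain ⟨s, rfl⟩ := Ideal.mem_span_singleton'.1 hy
    change (s * r) • x = 0
    rw [mul_smul]
    exact (congrArg (s • ·) (h x)).trans (smul_zero s))
  have : IsScalarTower R (R ⧸ Ideal.span {r}) X := Module.IsTorsionBySet.isScalarTower _
  have : Module.Finite (R ⧸ Ideal.span {r}) X := Module.Finite.of_restrictScalars_finite R _ _
  have : IsArtinianRing (R ⧸ Ideal.span {r}) := by
    have := (isFiniteLength_iff_isNoetherian_isArtinian.1
      (isFiniteLength_quotient_span_singleton R (mem_nonZeroDivisors_of_ne_zero hr))).2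
    exact isArtinian_of_tower R this
  have : IsArtinian (R ⧸ Ideal.span {r}) X := inferInstance
  have : IsArtinian R X :=
    isArtinian_of_surjective_algebraMap (R := R ⧸ Ideal.span {r}) Ideal.Quotient.mk_surjective
  have : IsArtinian A X := isArtinian_of_tower R inferInstance
  exact isFiniteLength_iff_isNoetherian_isArtinian.2 ⟨inferInstance, inferInstance⟩

/-! ### Lattices over orders -/

section Lattice

variable (R : Type v) [CommRing R] (A : Type u) [Ring A] [Algebra R A]

/-- Torsion freeness of a module over an algebra with respect to the base ring. -/
def TorsionFreeOver (X : Type*) [AddCommGroup X] [Module A X] : Prop :=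
  ∀ r : R, r ≠ 0 → ∀ x : X, algebraMap R A r • x = 0 → x = 0

/-- Algebras, finite over a Dedekind domain, all of whose lattices are projective. -/
class IsHereditaryOrder : Prop where
  torsionFree : TorsionFreeOver R A A
  projective : ∀ (N : Type u) [AddCommGroup N] [Module A N] [Module.Finite A N],
    TorsionFreeOver R A N → Module.Projective A N

variable {A}

lemma algebraMap_smul_comm {X : Type*} [AddCommGroup X] [Module A X] (r : R) (a : A) (x : X) :
    algebraMap R A r • a • x = a • algebraMap R A r • x := by
  rw [← mul_smul, Algebra.commutes, mul_smul]

variable {R}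

lemma TorsionFreeOver.of_injective {X Y : Type*} [AddCommGroup X] [Module A X] [AddCommGroup Y]
    [Module A Y] (h : TorsionFreeOver R A Y) (f : X →ₗ[A] Y) (hf : Function.Injective f) :
    TorsionFreeOver R A X := fun r hr x hx => hf (by
  rw [map_zero]
  exact h r hr _ (by rw [← map_smul, hx, map_zero]))

variable (R)

lemma torsionFreeOver_of_projective [IsHereditaryOrder R A] (P : Type*) [AddCommGroup P]
    [Module A P] [Module.Finite A P] [Module.Projective A P] : TorsionFreeOver R A P := by
  obtain ⟨n, e, f, h⟩ := exists_dualBasis A P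
  intro r hr x hx
  rw [← h x]
  refine Finset.sum_eq_zero fun i _ => ?_
  have h1 : f i x = 0 := IsHereditaryOrder.torsionFree (R := R) r hr _ (by
    rw [← map_smul, hx, map_zero])
  rw [h1, zero_smul]

variable (A) in
lemma isHereditary_of_isHereditaryOrder [IsNoetherianRing R] [Module.Finite R A]
    [IsHereditaryOrder R A] : IsHereditary A where
  isNoetherianRing := isNoetherian_of_tower R inferInstance
  projective P _ _ _ _ N := by
    have : IsNoetherianRing A := isNoetherian_of_tower R inferInstance
    exact IsHereditaryOrder.projective N
      ((torsionFreeOver_of_projective R P).of_injective N.subtype N.injective_subtype)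

variable [IsDomain R]

/-- The product of the denominators of finitely many generators is a common denominator, since
scalars from `R` are central in `A`. -/
lemma exists_smul_mem_of_forall {X : Type*} [AddCommGroup X] [Module A X] [Module.Finite A X]
    (N : Submodule A X) (h : ∀ x : X, ∃ r : R, r ≠ 0 ∧ algebraMap R A r • x ∈ N) :
    ∃ r : R, r ≠ 0 ∧ ∀ x : X, algebraMap R A r • x ∈ N := by
  obtain ⟨s, hs⟩ := Module.Finite.fg_top (R := A) (M := X)
  choose r hr hrx using h
  refine ⟨∏ x ∈ s, r x, Finset.prod_ne_zero_iff.2 fun x _ => hr x, fun x => ?_⟩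
  have hx : x ∈ Submodule.span A (s : Set X) := hs ▸ Submodule.mem_top
  induction hx using Submodule.span_induction with
  | mem x hx =>
    classical
    rw [← Finset.prod_erase_mul s r hx, map_mul, mul_smul]
    exact N.smul_mem _ (hrx x)
  | zero => simp
  | add x y _ _ hx hy =>
    rw [smul_add]
    exact N.add_mem hx hy
  | smul a x _ hx =>
    rw [algebraMap_smul_comm]
    exact N.smul_mem a hx

/-- Lattices all of whose proper quotients are torsion. -/
structure IsIrreducibleLattice (N : Type*) [AddCommGroup N] [Module A N] : Prop where
  nontrivial : Nontrivial N
  torsionFree : TorsionFreeOver R A N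
  exists_smul_mem : ∀ N₁ : Submodule A N, N₁ ≠ ⊥ → ∀ x : N, ∃ r : R, r ≠ 0 ∧
    algebraMap R A r • x ∈ N₁

section Hom

variable {R} {N N' : Type*} [AddCommGroup N] [Module A N] [AddCommGroup N'] [Module A N']

-- A nonzero kernel would make the image a torsion submodule of a torsion free module.
omit [IsDomain R] in
lemma IsIrreducibleLattice.injective (hN : IsIrreducibleLattice R (A := A) N)
    (hN' : TorsionFreeOver R A N') {f : N →ₗ[A] N'} (hf : f ≠ 0) : Function.Injective f := by
  rw [← LinearMap.ker_eq_bot]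
  by_contra hne
  refine hf (LinearMap.ext fun x => ?_)
  obtain ⟨r, hr, hx⟩ := hN.exists_smul_mem _ hne x
  refine hN' r hr _ ?_
  rw [← map_smul]
  exact hx

lemma IsIrreducibleLattice.exists_smul_mem_range [Module.Finite A N']
    (hN' : IsIrreducibleLattice R (A := A) N') {f : N →ₗ[A] N'} (hf : f ≠ 0) :
    ∃ r : R, r ≠ 0 ∧ ∀ x, algebraMap R A r • x ∈ LinearMap.range f :=
  exists_smul_mem_of_forall R _ (hN'.exists_smul_mem _ fun h => hf (LinearMap.range_eq_bot.1 h))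

omit [IsDomain R] in
/-- Lifting a multiple of a homomorphism along an injection. -/
lemma exists_smul_lift {X : Type*} [AddCommGroup X] [Module A X] (ι : N →ₗ[A] N')
    (hι : Function.Injective ι) (f : X →ₗ[A] N') (r : R)
    (h : ∀ x, algebraMap R A r • f x ∈ LinearMap.range ι) :
    ∃ g : X →ₗ[A] N, ∀ x, ι (g x) = algebraMap R A r • f x := by
  let f' : X →ₗ[A] LinearMap.range ι :=
    { toFun := fun x => ⟨algebraMap R A r • f x, h x⟩
      map_add' := fun x y => Subtype.ext (by simp)
      map_smul' := fun a x => Subtype.ext (by simp [algebraMap_smul_comm]) }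
  refine ⟨(LinearEquiv.ofInjective ι hι).symm.toLinearMap ∘ₗ f', fun x => ?_⟩
  have := (LinearEquiv.ofInjective ι hι).apply_symm_apply (f' x)
  exact congrArg Subtype.val this

/-- The image of `f` contains `r N'` for some `r ≠ 0`; multiplication by `r` followed by the inverse
of the injection `f` is a map back. This is the symmetry of the relation that classifies irreducible
lattices. -/
lemma IsIrreducibleLattice.exists_hom_symm [Module.Finite A N']
    (hN : IsIrreducibleLattice R (A := A) N) (hN' : IsIrreducibleLattice R (A := A) N')
    {f : N →ₗ[A] N'} (hf : f ≠ 0) : ∃ g : N' →ₗ[A] N, g ≠ 0 := by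
  obtain ⟨r, hr, h⟩ := hN'.exists_smul_mem_range hf
  obtain ⟨g, hg⟩ := exists_smul_lift f (hN.injective hN'.torsionFree hf) LinearMap.id r h
  refine ⟨g, ?_⟩
  rintro rfl
  have := hN'.nontrivial
  obtain ⟨x, hx⟩ := exists_ne (0 : N')
  refine hx (hN'.torsionFree r hr x ?_)
  rw [← LinearMap.id_apply (R := A) x, ← hg]
  simp

end Hom

section Extension

variable (F : Type w) [Field F] [Algebra R F] [IsFractionRing R F] [Module.Finite R A]

/-- Extension of scalars of a lattice to the fraction field. -/
lemma exists_extension (N : Type u) [AddCommGroup N] [Module A N] [Module.Finite A N]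
    (hN : TorsionFreeOver R A N) :
    ∃ (V : Type max u w) (_ : AddCommGroup V) (_ : Module F V) (_ : Module A V)
      (_ : SMulCommClass A F V) (_ : Module.Finite F V) (ι : N →ₗ[A] V),
      Function.Injective ι ∧ TorsionFreeOver R A V ∧
      ∀ (X : Type u) [AddCommGroup X] [Module A X] [Module.Finite A X] (f : X →ₗ[A] V),
        ∃ r : R, r ≠ 0 ∧ ∃ g : X →ₗ[A] N, ∀ x, ι (g x) = algebraMap R A r • f x := by
  let : Module R N := Module.compHom N (algebraMap R A)
  have : IsScalarTower R A N := .of_algebraMap_smul fun _ _ => rfl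
  have : Module.Finite R N := Module.Finite.trans A N
  let φ : A →+* Module.End F (F ⊗[R] N) :=
    { toFun := fun a => LinearMap.baseChange F (Module.toModuleEnd R N a)
      map_one' := by rw [map_one, Module.End.one_eq_id, LinearMap.baseChange_id]; rfl
      map_mul' := fun a b => by
        rw [map_mul, Module.End.mul_eq_comp, LinearMap.baseChange_comp]; rfl
      map_zero' := by rw [map_zero, LinearMap.baseChange_zero]
      map_add' := fun a b => by rw [map_add, LinearMap.baseChange_add] }
  let : Module A (F ⊗[R] N) := Module.compHom _ φ
  have hφ : ∀ (a : A) (c : F) (x : N), a • (c ⊗ₜ[R] x) = c ⊗ₜ[R] (a • x) := fun a c x => rfl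
  have hr : ∀ (r : R) (v : F ⊗[R] N), algebraMap R A r • v = r • v := by
    intro r v
    induction v using TensorProduct.induction_on with
    | zero => simp
    | add x y hx hy => rw [smul_add, smul_add, hx, hy]
    | tmul c x =>
      rw [hφ, ← TensorProduct.tmul_smul]
      rfl
  have hcomm : SMulCommClass A F (F ⊗[R] N) := ⟨fun a c v => (φ a).map_smul c v⟩
  have htf : TorsionFreeOver R A (F ⊗[R] N) := fun r h v hv => by
    rw [hr, ← algebraMap_smul F r v] at hv
    exact (smul_eq_zero.1 hv).resolve_left
      ((map_ne_zero_iff _ (FaithfulSMul.algebraMap_injective R F)).2 h)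
  let ι : N →ₗ[A] F ⊗[R] N :=
    { toFun := fun x => 1 ⊗ₜ x
      map_add' := fun x y => TensorProduct.tmul_add 1 x y
      map_smul' := fun a x => rfl }
  have hloc : IsLocalizedModule (nonZeroDivisors R) (TensorProduct.mk R F N 1) := inferInstance
  have hι : Function.Injective ι := by
    rw [injective_iff_map_eq_zero]
    intro x hx
    obtain ⟨s, hs⟩ := (IsLocalizedModule.eq_zero_iff (nonZeroDivisors R)
      (TensorProduct.mk R F N 1)).1 hx
    exact hN s (nonZeroDivisors.ne_zero s.2) x hs
  refine ⟨F ⊗[R] N, inferInstance, inferInstance, inferInstance, hcomm, inferInstance, ι, hι,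
    htf, fun X _ _ _ f => ?_⟩
  -- Each value of `f` in `F ⊗ N` has a denominator; finite generation then provides a common one.
  have h1 : ∀ x : X, ∃ r : R, r ≠ 0 ∧ algebraMap R A r • x ∈ (LinearMap.range ι).comap f := by
    intro x
    obtain ⟨⟨m, s⟩, hs⟩ := IsLocalizedModule.surj (nonZeroDivisors R)
      (TensorProduct.mk R F N 1) (f x)
    refine ⟨s, nonZeroDivisors.ne_zero s.2, m, ?_⟩
    rw [map_smul, hr]
    exact hs.symm
  obtain ⟨r, hr0, h2⟩ := exists_smul_mem_of_forall R _ h1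
  refine ⟨r, hr0, exists_smul_lift ι hι f r fun x => ?_⟩
  rw [← map_smul]
  exact h2 x

end Extension

/-! ### `K₀` modulo torsion and irreducible lattices -/

section Decomposition

variable [Module.Finite R A] [IsHereditaryOrder R A] [IsHereditary A]

omit [IsHereditaryOrder R A] [IsHereditary A] in
lemma baseRank_quotient_add {P : Type*} [AddCommGroup P] [Module A P] [Module.Finite A P]
    (K : Submodule A P) [Nontrivial (P ⧸ K)] (h : TorsionFreeOver R A (P ⧸ K)) :
    baseRank (A := A) R K < baseRank (A := A) R P := by
  let : Module R P := Module.compHom P (algebraMap R A)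
  have : IsScalarTower R A P := .of_algebraMap_smul fun _ _ => rfl
  have : Module.Finite R P := Module.Finite.trans A P
  change Module.finrank R (K.restrictScalars R) < Module.finrank R P
  have h1 := Submodule.finrank_quotient_add_finrank (K.restrictScalars R)
  have : Module.IsTorsionFree R (P ⧸ K.restrictScalars R) := by
    rw [Module.isTorsionFree_iff_smul_eq_zero]
    exact fun r x hx => or_iff_not_imp_left.2 fun hr => h r hr x hx
  have : Nontrivial (P ⧸ K.restrictScalars R) := ‹Nontrivial (P ⧸ K)›
  have := Module.finrank_pos (R := R) (M := P ⧸ K.restrictScalars R)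
  omega

-- `K` is taken maximal among the proper submodules with torsion free quotient. The saturation of
-- anything strictly larger is then all of `P`.
omit [Module.Finite R A] in
lemma exists_irreducible_quotient (P : Type u) [AddCommGroup P] [Module A P] [Module.Finite A P]
    [Module.Projective A P] [Nontrivial P] :
    ∃ K : Submodule A P, IsIrreducibleLattice R (A := A) (P ⧸ K) := by
  let s : Set (Submodule A P) := {K | K ≠ ⊤ ∧ TorsionFreeOver R A (P ⧸ K)}
  have hs : s.Nonempty := ⟨⊥, bot_ne_top, (torsionFreeOver_of_projective R P).of_injective
    (Submodule.quotEquivOfEqBot ⊥ rfl).toLinearMap (LinearEquiv.injective _)⟩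
  obtain ⟨K, ⟨hK, htf⟩, hmax⟩ := (inferInstance : WellFoundedGT (Submodule A P)).wf.has_min s hs
  refine ⟨K, Submodule.Quotient.nontrivial_iff.2 hK, htf, fun N₁ hN₁ => ?_⟩
  let K₁ := N₁.comap K.mkQ
  have hK₁ : K < K₁ := by
    refine lt_of_le_of_ne (fun x hx => ?_) fun h => hN₁ ?_
    · change K.mkQ x ∈ N₁
      rw [Submodule.mkQ_apply, (Submodule.Quotient.mk_eq_zero K).2 hx]
      exact zero_mem _
    · rw [eq_bot_iff]
      intro y hy
      obtain ⟨x, rfl⟩ := K.mkQ_surjective y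
      have : x ∈ K := h ▸ (show x ∈ K₁ from hy)
      exact (Submodule.Quotient.mk_eq_zero K).2 this
  let K₂ : Submodule A P :=
    { carrier := {x | ∃ r : R, r ≠ 0 ∧ algebraMap R A r • x ∈ K₁}
      zero_mem' := ⟨1, one_ne_zero, by simp⟩
      add_mem' := by
        rintro x y ⟨r, hr, hx⟩ ⟨s, hs, hy⟩
        refine ⟨r * s, mul_ne_zero hr hs, ?_⟩
        rw [smul_add]
        refine K₁.add_mem ?_ ?_
        · rw [mul_comm, map_mul, mul_smul]
          exact K₁.smul_mem _ hx
        · rw [map_mul, mul_smul]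
          exact K₁.smul_mem _ hy
      smul_mem' := by
        rintro a x ⟨r, hr, hx⟩
        refine ⟨r, hr, ?_⟩
        rw [algebraMap_smul_comm]
        exact K₁.smul_mem a hx }
  have hle : K₁ ≤ K₂ := fun x hx => ⟨1, one_ne_zero, by simpa using hx⟩
  have htop : K₂ = ⊤ := by
    by_contra hne
    refine hmax K₂ ⟨hne, fun r hr x hx => ?_⟩ (lt_of_lt_of_le hK₁ hle)
    obtain ⟨y, rfl⟩ := K₂.mkQ_surjective x
    rw [← map_smul] at hx
    obtain ⟨s, hs, hy⟩ := (Submodule.Quotient.mk_eq_zero K₂).1 hx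
    refine (Submodule.Quotient.mk_eq_zero K₂).2 ⟨s * r, mul_ne_zero hs hr, ?_⟩
    rwa [map_mul, mul_smul]
  intro x
  obtain ⟨y, rfl⟩ := K.mkQ_surjective x
  obtain ⟨r, hr, hy⟩ : y ∈ K₂ := htop ▸ Submodule.mem_top
  exact ⟨r, hr, hy⟩

/-- `K₀` is generated by the classes of irreducible lattices. -/
lemma cls_mem_of_irreducible (H : AddSubgroup (K0 A))
    (hH : ∀ (N : Type u) [AddCommGroup N] [Module A N] [Module.Finite A N]
      [Module.Projective A N], IsIrreducibleLattice R (A := A) N → cls N ∈ H)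
    (P : Type u) [AddCommGroup P] [Module A P] [Module.Finite A P] [Module.Projective A P] :
    cls (A := A) P ∈ H := by
  induction hn : baseRank (A := A) R P using Nat.strong_induction_on generalizing P with
  | _ n ih =>
    rcases subsingleton_or_nontrivial P with hP | hP
    · rw [cls_of_subsingleton]
      exact zero_mem _
    · obtain ⟨K, hK⟩ := exists_irreducible_quotient R (A := A) P
      have := hK.nontrivial
      have : Module.Projective A (P ⧸ K) := IsHereditaryOrder.projective (R := R) _ hK.torsionFree
      rw [cls_eq_ker_add K.mkQ K.mkQ_surjective]
      refine add_mem ?_ (hH _ hK)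
      rw [show cls (A := A) (LinearMap.ker K.mkQ) = cls K from
        cls_congr (LinearEquiv.ofEq _ _ K.ker_mkQ)]
      exact ih _ (hn ▸ baseRank_quotient_add R K hK.torsionFree) _ rfl

-- The map `f` is injective, so the difference is the class of its cokernel, which is torsion.
omit [Module.Finite R A] [IsHereditaryOrder R A] in
lemma cls_sub_mem_of_hom (H : AddSubgroup (K0 A))
    (hH : ∀ (X : Type u) [AddCommGroup X] [Module A X] [Module.Finite A X] (r : R), r ≠ 0 →
      (∀ x : X, algebraMap R A r • x = 0) → chi0 A X ∈ H)
    {N N' : Type u} [AddCommGroup N] [Module A N] [Module.Finite A N] [Module.Projective A N]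
    [AddCommGroup N'] [Module A N'] [Module.Finite A N'] [Module.Projective A N']
    (hN : IsIrreducibleLattice R (A := A) N) (hN' : IsIrreducibleLattice R (A := A) N')
    {f : N →ₗ[A] N'} (hf : f ≠ 0) : cls (A := A) N' - cls N ∈ H := by
  obtain ⟨r, hr, h⟩ := hN'.exists_smul_mem_range hf
  have h1 := hH (N' ⧸ LinearMap.range f) r hr fun x => by
    obtain ⟨y, rfl⟩ := (LinearMap.range f).mkQ_surjective x
    rw [← map_smul]
    exact (Submodule.Quotient.mk_eq_zero _).2 (h y)
  have h2 := chi0_eq_add (LinearMap.range f)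
  rw [chi0_projective, ← chi0_congr (LinearEquiv.ofInjective f (hN.injective hN'.torsionFree hf)),
    chi0_projective] at h2
  rw [h2]
  simpa using h1

variable (A) in
/-- If torsion modules have torsion classes in `K₀`, then the kernel of the trace map is torsion. -/
theorem mem_torsion_of_trace_eq_zero (F : Type w) [Field F] [CharZero F] [Algebra R F]
    [IsFractionRing R F]
    (hH : ∀ (X : Type u) [AddCommGroup X] [Module A X] [Module.Finite A X] (r : R), r ≠ 0 →
      (∀ x : X, algebraMap R A r • x = 0) → chi0 A X ∈ AddCommGroup.torsion (K0 A))
    (x : K0 A) (hx : trace A x = 0) : x ∈ AddCommGroup.torsion (K0 A) := by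
  classical
  -- Related lattices are those that span the same simple module over the fraction field.
  let s : Setoid {N : FGProj A // IsIrreducibleLattice R (A := A) N.carrier} :=
    { r := fun N N' => ∃ f : N.1.carrier →ₗ[A] N'.1.carrier, f ≠ 0
      iseqv :=
        ⟨fun N => by
          have := N.2.nontrivial
          obtain ⟨x, hx⟩ := exists_ne (0 : N.1.carrier)
          exact ⟨LinearMap.id, fun h => hx (LinearMap.congr_fun h x)⟩,
        fun {N N'} ⟨f, hf⟩ => N.2.exists_hom_symm N'.2 hf,
        fun {N N' N''} ⟨f, hf⟩ ⟨g, hg⟩ => ⟨g ∘ₗ f, fun h => by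
          have := N.2.nontrivial
          obtain ⟨x, hx⟩ := exists_ne (0 : N.1.carrier)
          refine hx (N.2.injective N'.2.torsionFree hf
            (N'.2.injective N''.2.torsionFree hg ?_))
          rw [map_zero, map_zero]
          exact LinearMap.congr_fun h x⟩⟩ }
  let b : Quotient s → K0 A := fun i => cls i.out.1.carrier
  let H := AddSubgroup.closure (Set.range b) ⊔ AddCommGroup.torsion (K0 A)
  have hcls : ∀ (P : Type u) [AddCommGroup P] [Module A P] [Module.Finite A P]
      [Module.Projective A P], cls (A := A) P ∈ H := fun P _ _ _ _ => by
    refine cls_mem_of_irreducible R H (fun N _ _ _ _ hN => ?_) P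
    obtain ⟨f, hf⟩ : s.r (Quotient.mk s ⟨⟨N⟩, hN⟩).out ⟨⟨N⟩, hN⟩ :=
      Quotient.exact (Quotient.out_eq _)
    have h1 := cls_sub_mem_of_hom R (AddCommGroup.torsion (K0 A)) hH
      (Quotient.mk s ⟨⟨N⟩, hN⟩).out.2 hN hf
    have h2 : b (Quotient.mk s ⟨⟨N⟩, hN⟩) ∈ H :=
      AddSubgroup.mem_sup_left (AddSubgroup.subset_closure ⟨_, rfl⟩)
    have h3 := H.add_mem (AddSubgroup.mem_sup_right h1 : _ ∈ H) h2
    rwa [sub_add_cancel] at h3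
  have hxH : x ∈ H := by
    have h : QuotientAddGroup.mk' H = 0 :=
      K0.hom_ext fun P _ _ _ _ => (QuotientAddGroup.eq_zero_iff _).2 (hcls P)
    exact (QuotientAddGroup.eq_zero_iff _).1 (DFunLike.congr_fun h x)
  obtain ⟨y, hy, t, ht, rfl⟩ := AddSubgroup.mem_sup.1 hxH
  rw [← Submodule.span_int_eq_addSubgroupClosure] at hy
  obtain ⟨a, rfl⟩ := Finsupp.mem_span_range_iff_exists_finsupp.1 hy
  have ha : a = 0 := by
    ext j
    -- `V` is the extension of the `j`-th lattice to `F`. A nonzero map from another lattice to `V`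
    -- would, after clearing denominators, land in the `j`-th lattice, so the rank at `V` isolates
    -- the `j`-th coefficient; torsion classes have rank zero.
    obtain ⟨V, _, _, _, _, _, ι, hι, hV, hlift⟩ :=
      exists_extension R F j.out.1.carrier j.out.2.torsionFree
    have h1 := traceFunctional_trace F V ((a.sum fun i n => n • b i) + t)
    rw [hx, map_zero, eq_comm, Int.cast_eq_zero, map_add] at h1
    have h2 : homRank F V t = 0 := by
      obtain ⟨n, hn, hnt⟩ := isOfFinAddOrder_iff_nsmul_eq_zero.1 ht
      have h3 := congrArg (homRank F V) hnt
      rw [map_nsmul, map_zero, nsmul_eq_mul] at h3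
      exact (mul_eq_zero.1 h3).resolve_left (by exact_mod_cast hn.ne')
    have h3 : ∀ i, i ≠ j → homRank F V (b i) = 0 := by
      intro i hi
      change homRank F V (Algebra.GrothendieckAddGroup.of _) = 0
      rw [homRank_of]
      have : Subsingleton (i.out.1.carrier →ₗ[A] V) := by
        refine subsingleton_of_forall_eq 0 fun f => ?_
        by_contra hf
        obtain ⟨r, hr, g, hg⟩ := hlift _ f
        refine hi ?_
        rw [← i.out_eq, ← j.out_eq]
        refine Quotient.sound ⟨g, ?_⟩
        rintro rfl
        refine hf (LinearMap.ext fun x => hV r hr _ ?_)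
        rw [← hg, LinearMap.zero_apply, map_zero]
      rw [Module.finrank_zero_of_subsingleton]
      rfl
    have h4 : homRank F V (b j) ≠ 0 := by
      change homRank F V (Algebra.GrothendieckAddGroup.of _) ≠ 0
      rw [homRank_of]
      have : Nontrivial (j.out.1.carrier →ₗ[A] V) := by
        have := j.out.2.nontrivial
        obtain ⟨x, hx⟩ := exists_ne (0 : j.out.1.carrier)
        refine ⟨ι, 0, fun h => hx (hι ?_)⟩
        rw [h, map_zero]
        rfl
      have := Module.finrank_pos (R := F) (M := j.out.1.carrier →ₗ[A] V)
      omega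
    rw [h2, add_zero, Finsupp.sum, map_sum, Finset.sum_eq_single j] at h1
    · rw [map_zsmul, smul_eq_mul] at h1
      exact (mul_eq_zero.1 h1).resolve_right h4
    · intro i _ hi
      rw [map_zsmul, h3 i hi, smul_zero]
    · intro hj
      rw [Finsupp.notMem_support_iff.1 hj]
      simp
  rw [ha]
  simpa using ht

end Decomposition

end Lattice

/-! ### Number fields attached to finite algebras -/

section NumberTheory

open NumberField

/-- A prime ideal of a finite torsion free algebra over a domain contains the kernel of a
homomorphism to a finite extension of the fraction field. -/
lemma exists_numberField_of_isPrime (R : Type v) [CommRing R] [IsDomain R] (F : Type w) [Field F]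
    [NumberField F] [Algebra R F] [IsFractionRing R F] (W : Type u) [CommRing W] [Algebra R W]
    [Module.Finite R W] (htf : ∀ r : R, r ≠ 0 → ∀ x : W, r • x = 0 → x = 0) (m : Ideal W)
    [m.IsPrime] :
    ∃ (L : Type u) (_ : Field L) (_ : NumberField L) (_ : Algebra W L),
      RingHom.ker (algebraMap W L) ≤ m ∧ ∀ r : R, r ≠ 0 → algebraMap W L (algebraMap R W r) ≠ 0 := by
  -- A minimal prime below `m` consists of zero divisors, whereas nonzero elements of `R` act
  -- injectively on `W`. So `R` embeds into `W / K`.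
  obtain ⟨K, hK, hKm⟩ := Ideal.exists_minimalPrimes_le (I := (⊥ : Ideal W)) (J := m) bot_le
  have hKp : K.IsPrime := hK.1.1
  have hRK : ∀ r : R, r ≠ 0 → algebraMap R W r ∉ K := by
    intro r hr hmem
    refine Set.disjoint_left.1 (Ideal.disjoint_nonZeroDivisors_of_mem_minimalPrimes hK) hmem ?_
    refine mem_nonZeroDivisors_iff_right.2 fun x hx => htf r hr x ?_
    rw [Algebra.smul_def, mul_comm, hx]
  let S := W ⧸ K
  have hRS : Function.Injective (algebraMap R S) := by
    rw [injective_iff_map_eq_zero]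
    intro r hr
    by_contra h
    exact hRK r h (Ideal.Quotient.eq_zero_iff_mem.1 hr)
  let M := Algebra.algebraMapSubmonoid S (nonZeroDivisors R)
  have hM : M ≤ nonZeroDivisors S := by
    rintro _ ⟨r, hr, rfl⟩
    refine mem_nonZeroDivisors_of_ne_zero fun h => nonZeroDivisors.ne_zero hr (hRS ?_)
    rw [map_zero]
    exact h
  -- Inverting the nonzero elements of `R` in `W / K` gives a domain that is finite over the number
  -- field `F`, hence a number field.
  let L := Localization M
  have : IsDomain L := IsLocalization.isDomain_localization hM
  let : Algebra F L := localizationAlgebra (nonZeroDivisors R) S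
  have : IsScalarTower R F L := isScalarTower_localizationAlgebra _ _
  have hfin : Module.Finite F L := Module.Finite.of_isLocalization R S (nonZeroDivisors R)
  have : IsArtinianRing L := isArtinian_of_tower F inferInstance
  have hfield : IsField L := IsArtinianRing.isField_of_isDomain L
  let : Field L := hfield.toField
  have hchar : CharZero L := charZero_of_injective_algebraMap (algebraMap F L).injective
  have hfinL : FiniteDimensional ℚ L := by
    have : IsScalarTower ℚ F L := .of_algebraMap_eq fun q => by simp
    exact Module.Finite.trans F L
  have hSL : Function.Injective (algebraMap S L) := IsLocalization.injective L hM
  refine ⟨L, inferInstance, ⟨⟩, ((algebraMap S L).comp (Ideal.Quotient.mk K)).toAlgebra, ?_, ?_⟩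
  · intro x hx
    refine hKm (Ideal.Quotient.eq_zero_iff_mem.1 (hSL ?_))
    rw [map_zero]
    exact hx
  · intro r hr h
    refine hRK r hr (Ideal.Quotient.eq_zero_iff_mem.1 (hSL ?_))
    rw [map_zero]
    exact h

variable {L : Type u} [Field L] [NumberField L]

/-- The ideal generated by `1` and `x` is invertible. -/
lemma exists_denominators (x : L) :
    ∃ d e₁ e₂ : 𝓞 L, (e₁ : L) = (1 - e₂) * x ∧ (e₂ : L) = d * x := by
  obtain ⟨a, b, hb, rfl⟩ := IsFractionRing.div_surjective (A := 𝓞 L) x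
  have hb0 : (algebraMap (𝓞 L) L) b ≠ 0 := by
    simpa using nonZeroDivisors.ne_zero hb
  -- In a Dedekind domain to contain is to divide, so `(b) = (a, b) J` and `a J ⊆ (b)`. Writing `b =
  -- a j₁ + b j₂` gives the witnesses: `d = j₁`, `e₂ = j₁ a / b` and `e₁ = j₂ a / b`.
  have hdvd : Ideal.span {a} ⊔ Ideal.span {b} ∣ Ideal.span {b} := Ideal.dvd_iff_le.2 le_sup_right
  obtain ⟨J, hJ⟩ := hdvd
  have hmem : ∀ j ∈ J, ∃ k, a * j = k * b := by
    intro j hj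
    have : a * j ∈ Ideal.span {b} := by
      rw [hJ]
      exact Ideal.mul_mem_mul (Ideal.mem_sup_left (Ideal.mem_span_singleton_self a)) hj
    obtain ⟨k, hk⟩ := Ideal.mem_span_singleton'.1 this
    exact ⟨k, hk.symm⟩
  have hb1 : b ∈ (Ideal.span {a} ⊔ Ideal.span {b}) * J := hJ ▸ Ideal.mem_span_singleton_self b
  rw [Ideal.sup_mul] at hb1
  obtain ⟨y, hy, z, hz, hyz⟩ := Submodule.mem_sup.1 hb1
  obtain ⟨j₁, hj₁, rfl⟩ := Ideal.mem_span_singleton_mul.1 hy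
  obtain ⟨j₂, hj₂, rfl⟩ := Ideal.mem_span_singleton_mul.1 hz
  obtain ⟨k₁, hk₁⟩ := hmem j₁ hj₁
  obtain ⟨k₂, hk₂⟩ := hmem j₂ hj₂
  have hk₁' : k₁ + j₂ = 1 := by
    have hb2 : b ≠ 0 := nonZeroDivisors.ne_zero hb
    refine mul_right_cancel₀ hb2 ?_
    rw [add_mul, ← hk₁, mul_comm j₂, hyz, one_mul]
  refine ⟨j₁, k₂, k₁, ?_, ?_⟩
  · have h1 : (1 : L) - (k₁ : L) = (j₂ : L) := by
      rw [sub_eq_iff_eq_add']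
      exact_mod_cast (congrArg (algebraMap (𝓞 L) L) hk₁').symm.trans (map_add _ _ _)
    rw [h1, mul_div_assoc', eq_div_iff hb0, ← map_mul, ← hk₂, mul_comm, map_mul]
  · rw [mul_div_assoc', eq_div_iff hb0, ← map_mul, ← hk₁, mul_comm, map_mul]

/-- Some power of a nonzero ideal of the ring of integers is principal. -/
lemma exists_pow_eq_span (p : Ideal (𝓞 L)) (hp : p ≠ ⊥) :
    ∃ (h : ℕ) (c : 𝓞 L), h ≠ 0 ∧ c ≠ 0 ∧ p ^ h = Ideal.span {c} := by
  have hp0 : p ∈ nonZeroDivisors (Ideal (𝓞 L)) := mem_nonZeroDivisors_of_ne_zero hp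
  -- The exponent is the class number.
  let n := Fintype.card (ClassGroup (𝓞 L))
  have h1 : ClassGroup.mk0 (⟨p, hp0⟩ ^ n) = 1 := by rw [map_pow, pow_card_eq_one]
  have h2 : (p ^ n).IsPrincipal := (ClassGroup.mk0_eq_one_iff (pow_mem hp0 n)).1 h1
  obtain ⟨c, hc⟩ := h2.principal
  refine ⟨n, c, Fintype.card_ne_zero, ?_, hc⟩
  rintro rfl
  refine pow_ne_zero n hp ?_
  rw [hc]
  simp

end NumberTheory

/-! ### Lattices attached to ideals of number fields -/

section IdealLattice

open NumberField

variable {A : Type u} [Ring A] {W : Type u} [CommRing W] [Algebra W A]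
  {L : Type u} [Field L] [Algebra W L]

variable (A W) in
/-- The submodule of `A ⊗ L` generated by an ideal of the ring of integers. -/
def idealLattice (I : Ideal (𝓞 L)) : Submodule A (A ⊗[W] L) :=
  Submodule.span A ((fun c : 𝓞 L => (1 : A) ⊗ₜ[W] (c : L)) '' I)

lemma tmul_mem_idealLattice {I : Ideal (𝓞 L)} {c : 𝓞 L} (hc : c ∈ I) (a : A) :
    a ⊗ₜ[W] (c : L) ∈ idealLattice A W I := by
  have : a ⊗ₜ[W] (c : L) = a • ((1 : A) ⊗ₜ[W] (c : L)) := by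
    rw [TensorProduct.smul_tmul', smul_eq_mul, mul_one]
  rw [this]
  exact Submodule.smul_mem _ _ (Submodule.subset_span ⟨c, hc, rfl⟩)

lemma idealLattice_mono {I J : Ideal (𝓞 L)} (h : I ≤ J) :
    idealLattice A W I ≤ idealLattice A W J :=
  Submodule.span_mono (Set.image_mono h)

instance [NumberField L] (I : Ideal (𝓞 L)) : Module.Finite A (idealLattice A W I) := by
  classical
  have hI : (I.restrictScalars ℤ).FG := IsNoetherian.noetherian _
  obtain ⟨s, hs⟩ := hI
  refine Module.Finite.iff_fg.2 ⟨s.image fun c : 𝓞 L => (1 : A) ⊗ₜ[W] (c : L), ?_⟩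
  refine le_antisymm (Submodule.span_le.2 ?_) (Submodule.span_le.2 ?_)
  · intro x hx
    obtain ⟨c, hc, rfl⟩ := Finset.mem_image.1 (Finset.mem_coe.1 hx)
    have : c ∈ I.restrictScalars ℤ := hs ▸ Submodule.subset_span hc
    exact tmul_mem_idealLattice this 1
  · rintro _ ⟨c, hc, rfl⟩
    have hc' : c ∈ Submodule.span ℤ (s : Set (𝓞 L)) := hs ▸ hc
    clear hc
    induction hc' using Submodule.span_induction with
    | mem c hc =>
      exact Submodule.subset_span (Finset.mem_coe.2 (Finset.mem_image_of_mem _ hc))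
    | zero => simp
    | add x y _ _ hx hy =>
      simp only [map_add, TensorProduct.tmul_add]
      exact Submodule.add_mem _ hx hy
    | smul n x _ hx =>
      simp only [map_zsmul, TensorProduct.tmul_smul] at hx ⊢
      exact zsmul_mem hx n

/-- Multiplication by a scalar on `A ⊗ L`. -/
def tensorMul (A : Type u) [Ring A] (W : Type u) [CommRing W] [Algebra W A] [Algebra W L] (c : L) :
    A ⊗[W] L →ₗ[A] A ⊗[W] L :=
  TensorProduct.AlgebraTensorModule.map LinearMap.id (LinearMap.mulLeft W c)

lemma tensorMul_tmul (c d : L) (a : A) : tensorMul A W c (a ⊗ₜ d) = a ⊗ₜ (c * d) := rfl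

lemma tensorMul_tensorMul (c d : L) (x : A ⊗[W] L) :
    tensorMul A W c (tensorMul A W d x) = tensorMul A W (c * d) x := by
  induction x using TensorProduct.induction_on with
  | zero => simp
  | add x y hx hy => simp only [map_add, hx, hy]
  | tmul a e => simp only [tensorMul_tmul, mul_assoc]

lemma tensorMul_one (x : A ⊗[W] L) : tensorMul A W 1 x = x := by
  induction x using TensorProduct.induction_on with
  | zero => simp
  | add x y hx hy => simp only [map_add, hx, hy]
  | tmul a e => simp only [tensorMul_tmul, one_mul]

lemma tensorMul_algebraMap (z : W) (x : A ⊗[W] L) :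
    tensorMul A W (algebraMap W L z) x = algebraMap W A z • x := by
  induction x using TensorProduct.induction_on with
  | zero => simp
  | add x y hx hy => simp only [map_add, smul_add, hx, hy]
  | tmul a e =>
    rw [tensorMul_tmul, TensorProduct.smul_tmul', ← Algebra.smul_def, smul_eq_mul,
      ← Algebra.smul_def, TensorProduct.smul_tmul]

lemma tensorMul_injective {c : L} (hc : c ≠ 0) : Function.Injective (tensorMul A W c) := by
  refine Function.LeftInverse.injective (g := tensorMul A W c⁻¹) fun x => ?_
  rw [tensorMul_tensorMul, inv_mul_cancel₀ hc, tensorMul_one]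

/-- The lattices of principal ideals are isomorphic. -/
lemma idealLattice_span_equiv {c : 𝓞 L} (hc : c ≠ 0) :
    Nonempty (idealLattice A W (⊤ : Ideal (𝓞 L)) ≃ₗ[A] idealLattice A W (Ideal.span {c})) := by
  have hc' : (c : L) ≠ 0 := by simpa using hc
  refine ⟨(Submodule.equivMapOfInjective _ (tensorMul_injective hc') _).trans
    (LinearEquiv.ofEq _ _ ?_)⟩
  rw [idealLattice, idealLattice, Submodule.map_span]
  congr 1
  ext x
  constructor
  · rintro ⟨_, ⟨d, -, rfl⟩, rfl⟩
    refine ⟨c * d, Ideal.mul_mem_right _ _ (Ideal.mem_span_singleton_self c), ?_⟩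
    simp only [tensorMul_tmul, map_mul]
  · rintro ⟨d, hd, rfl⟩
    obtain ⟨e, rfl⟩ := Ideal.mem_span_singleton'.1 hd
    refine ⟨_, ⟨e, trivial, rfl⟩, ?_⟩
    simp only [tensorMul_tmul, map_mul, mul_comm]

/-- An element of `W` whose numerators lie in `p` maps the lattice of `I` to that of `I p`. -/
lemma smul_mem_idealLattice {z : W} {p I : Ideal (𝓞 L)} {e₁ e₂ : 𝓞 L} (h₁ : e₁ ∈ p) (h₂ : e₂ ∈ p)
    (h : (e₁ : L) = (1 - e₂) * algebraMap W L z) {x : A ⊗[W] L} (hx : x ∈ idealLattice A W I) :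
    algebraMap W A z • x ∈ idealLattice A W (I * p) := by
  induction hx using Submodule.span_induction with
  | mem x hx =>
    obtain ⟨c, hc, rfl⟩ := hx
    -- The identity is `z c = c e₁ + z (c e₂)`. It is needed because the image of `z` in `L` need
    -- not be an algebraic integer.
    have h1 : algebraMap W A z • ((1 : A) ⊗ₜ[W] (c : L)) = (1 : A) ⊗ₜ[W] ((c * e₁ : 𝓞 L) : L) +
        algebraMap W A z • ((1 : A) ⊗ₜ[W] ((c * e₂ : 𝓞 L) : L)) := by
      simp only [← tensorMul_algebraMap, tensorMul_tmul, ← TensorProduct.tmul_add, map_mul]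
      congr 1
      linear_combination -(algebraMap (𝓞 L) L c) * h
    simp only at h1 ⊢
    rw [h1]
    exact Submodule.add_mem _ (tmul_mem_idealLattice (Ideal.mul_mem_mul hc h₁) 1)
      (Submodule.smul_mem _ _ (tmul_mem_idealLattice (Ideal.mul_mem_mul hc h₂) 1))
  | zero => simp
  | add x y _ _ hx hy =>
    rw [smul_add]
    exact Submodule.add_mem _ hx hy
  | smul a x _ hx =>
    rw [← mul_smul, Algebra.commutes, mul_smul]
    exact Submodule.smul_mem _ _ hx

/-- The lattice of a proper ideal is proper, if `W` is a direct summand of `A`. -/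
lemma one_tmul_notMem_idealLattice (ρ : A →ₗ[W] W) (hρ : ρ 1 = 1)
    (q : Ideal (integralClosure W L)) (hq : q ≠ ⊤) {p : Ideal (𝓞 L)}
    (hp : ∀ c ∈ p, ∃ y ∈ q, (y : L) = c) :
    (1 : A) ⊗ₜ[W] (1 : L) ∉ idealLattice A W p := by
  -- The retraction `ρ` extends to `A ⊗ L → L`; it maps the lattice of `p` into the proper ideal
  -- `q`, but `1 ⊗ 1` to `1`.
  let Φ : A ⊗[W] L →ₗ[W] L := TensorProduct.lift
    ((LinearMap.lsmul W L).comp ρ)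
  have hΦ : ∀ (a : A) (c : L), Φ (a ⊗ₜ c) = ρ a • c := fun _ _ => rfl
  have key : ∀ x ∈ idealLattice A W p, ∀ a : A, ∃ y ∈ q, (y : L) = Φ (a • x) := by
    intro x hx
    induction hx using Submodule.span_induction with
    | mem x hx =>
      obtain ⟨c, hc, rfl⟩ := hx
      intro a
      obtain ⟨y, hy, hyc⟩ := hp c hc
      refine ⟨ρ a • y, ?_, ?_⟩
      · rw [Algebra.smul_def]
        exact q.mul_mem_left _ hy
      · simp only [TensorProduct.smul_tmul', smul_eq_mul, mul_one, hΦ, ← hyc]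
        rfl
    | zero => exact fun a => ⟨0, q.zero_mem, by simp⟩
    | add x y _ _ hx hy =>
      intro a
      obtain ⟨s, hs, hs'⟩ := hx a
      obtain ⟨t, ht, ht'⟩ := hy a
      exact ⟨s + t, q.add_mem hs ht, by rw [smul_add, map_add, ← hs', ← ht']; rfl⟩
    | smul b x _ hx =>
      intro a
      obtain ⟨s, hs, hs'⟩ := hx (a * b)
      exact ⟨s, hs, by rw [hs', mul_smul]⟩
  intro hmem
  obtain ⟨y, hy, hy1⟩ := key _ hmem 1
  rw [one_smul, hΦ, hρ, one_smul] at hy1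
  have : y = 1 := Subtype.ext hy1
  exact hq ((Ideal.eq_top_iff_one q).2 (this ▸ hy))

end IdealLattice

/-! ### Classes of simple torsion modules -/

section SimpleTorsion

open NumberField

variable {A : Type u} [Ring A] {W : Type u} [CommRing W] [Algebra W A]

/-- Elements of `W` act on `T` by `A`-endomorphisms, which are zero or bijective by Schur's lemma.
-/
lemma isPrime_comap_annihilator (T : Type*) [AddCommGroup T] [Module A T] [IsSimpleModule A T] :
    ((Module.annihilator A T).comap (algebraMap W A)).IsPrime := by
  have := IsSimpleModule.nontrivial A T
  refine ⟨fun h => ?_, fun {y z} hyz => ?_⟩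
  · obtain ⟨x, hx⟩ := exists_ne (0 : T)
    have h1 : (1 : W) ∈ (Module.annihilator A T).comap (algebraMap W A) := h ▸ Submodule.mem_top
    rw [Ideal.mem_comap, map_one, Module.mem_annihilator] at h1
    exact hx (by rw [← h1 x, one_smul])
  · simp only [Ideal.mem_comap, Module.mem_annihilator, map_mul, mul_smul] at hyz ⊢
    let f : T →ₗ[A] T :=
      { toFun := fun x => algebraMap W A z • x
        map_add' := fun _ _ => smul_add _ _ _
        map_smul' := fun a x => algebraMap_smul_comm W z a x }
    rcases LinearMap.bijective_or_eq_zero f with h | h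
    · refine Or.inl fun x => ?_
      obtain ⟨x', rfl⟩ := h.2 x
      exact hyz x'
    · exact Or.inr fun x => LinearMap.congr_fun h x

variable [IsHereditary A]

/-- Simple torsion modules have torsion classes in `K₀`, if they are determined by their central
annihilators. -/
theorem chi0_mem_torsion_of_isSimpleModule (R : Type v) [CommRing R] [IsDedekindDomain R]
    (F : Type w) [Field F] [NumberField F] [Algebra R F] [IsFractionRing R F] [Algebra R W]
    [Algebra R A] [IsScalarTower R W A] [Module.Finite R W] [Module.Finite R A]
    (htf : ∀ r : R, r ≠ 0 → ∀ x : W, r • x = 0 → x = 0) (ρ : A →ₗ[W] W) (hρ : ρ 1 = 1)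
    (T : Type u) [AddCommGroup T] [Module A T] [IsSimpleModule A T]
    (huniq : ∀ (S : Type u) [AddCommGroup S] [Module A S] [IsSimpleModule A S],
      (∀ z : W, (∀ x : T, algebraMap W A z • x = 0) → ∀ x : S, algebraMap W A z • x = 0) →
      Nonempty (S ≃ₗ[A] T))
    {r : R} (hr : r ≠ 0) (hrT : ∀ x : T, algebraMap R A r • x = 0) :
    chi0 A T ∈ AddCommGroup.torsion (K0 A) := by
  let m := (Module.annihilator A T).comap (algebraMap W A)
  have hmem : ∀ z, z ∈ m ↔ ∀ x : T, algebraMap W A z • x = 0 := fun z => by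
    rw [Ideal.mem_comap, Module.mem_annihilator]
  have hm : m.IsPrime := isPrime_comap_annihilator T
  obtain ⟨L, _, _, _, hker, hL⟩ := exists_numberField_of_isPrime R F W htf m
  -- The kernel of `W → L` lies in `m`, so by lying over some prime `q` of the integral closure of
  -- `W` in `L` contracts to `m`. The prime of `𝓞 L` used below is the contraction of `q`.
  obtain ⟨q, hq, hqm⟩ := Ideal.exists_ideal_over_prime_of_isIntegral_of_isDomain
    (S := integralClosure W L) m (fun z hz => hker (congrArg Subtype.val hz))
  let j : 𝓞 L →+* integralClosure W L :=
    (algebraMap (𝓞 L) L).codRestrict (integralClosure W L) fun c => (c.2 : IsIntegral ℤ _).tower_top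
  let p := q.comap j
  have hden : ∀ z ∈ m, ∃ e₁ ∈ p, ∃ e₂ ∈ p,
      algebraMap (𝓞 L) L e₁ = (1 - algebraMap (𝓞 L) L e₂) * algebraMap W L z := by
    intro z hz
    obtain ⟨d, e₁, e₂, h₁, h₂⟩ := exists_denominators (algebraMap W L z)
    have hzq : algebraMap W (integralClosure W L) z ∈ q := by
      rw [← hqm] at hz
      exact hz
    have h2 : j e₂ = j d * algebraMap W (integralClosure W L) z := Subtype.ext h₂
    have h1 : j e₁ = (1 - j e₂) * algebraMap W (integralClosure W L) z := Subtype.ext h₁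
    refine ⟨e₁, ?_, e₂, ?_, h₁⟩
    · rw [Ideal.mem_comap, h1]
      exact q.mul_mem_left _ hzq
    · rw [Ideal.mem_comap, h2]
      exact q.mul_mem_left _ hzq
  have hrm : algebraMap R W r ∈ m := (hmem _).2 fun x => by
    rw [← IsScalarTower.algebraMap_apply R W A]
    exact hrT x
  have hp : p ≠ ⊥ := by
    intro hp
    obtain ⟨e₁, h₁, e₂, h₂, h⟩ := hden _ hrm
    rw [hp, Ideal.mem_bot] at h₁ h₂
    rw [h₁, h₂, map_zero, sub_zero, one_mul] at h
    exact hL r hr h.symm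
  obtain ⟨n, c, hn, hc, hpc⟩ := exists_pow_eq_span p hp
  -- Elements of `m` map the lattice of `pⁱ` into that of `pⁱ⁺¹`, so by `huniq` every composition
  -- factor of the quotient is `T`. The first quotient is nonzero, which makes the total
  -- multiplicity positive.
  have hstep : ∀ i : ℕ, ∃ k : ℕ, chi0 A (idealLattice A W (p ^ i)) =
      chi0 A (idealLattice A W (p ^ (i + 1))) + k • chi0 A T ∧ (i = 0 → k ≠ 0) := by
    intro i
    let M := idealLattice A W (p ^ i)
    let N := idealLattice A W (p ^ (i + 1))
    have hNM : N ≤ M := idealLattice_mono (Ideal.pow_le_pow_right i.le_succ)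
    have hkill : ∀ z ∈ m, ∀ x : M ⧸ N.submoduleOf M, algebraMap W A z • x = 0 := by
      intro z hz x
      obtain ⟨y, rfl⟩ := Submodule.mkQ_surjective _ x
      rw [← map_smul]
      refine (Submodule.Quotient.mk_eq_zero _).2 ?_
      obtain ⟨e₁, h₁, e₂, h₂, h⟩ := hden z hz
      have h3 := smul_mem_idealLattice h₁ h₂ h y.2
      rwa [← pow_succ] at h3
    have hfin : IsFiniteLength A (M ⧸ N.submoduleOf M) :=
      isFiniteLength_of_smul_eq_zero hr fun x => by
        rw [IsScalarTower.algebraMap_apply R W A]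
        exact hkill _ hrm x
    obtain ⟨k, hk, hk0⟩ := chi0_eq_nsmul_of_isFiniteLength hfin (algebraMap W A '' m)
      (by rintro _ ⟨z, hz, rfl⟩; exact hkill z hz) (T := T)
      fun S _ _ _ hS => huniq S fun z hz => hS _ ⟨z, (hmem z).2 hz, rfl⟩
    refine ⟨k, ?_, fun hi => hk0 ?_⟩
    · rw [← hk, chi0_eq_add (N.submoduleOf M), chi0_congr (Submodule.submoduleOfEquivOfLe hNM)]
    · subst hi
      refine Submodule.Quotient.nontrivial_iff.2 fun h => ?_
      have h1 : (1 : A) ⊗ₜ[W] (algebraMap (𝓞 L) L 1) ∈ M :=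
        tmul_mem_idealLattice (by simp) 1
      have h2 : (⟨_, h1⟩ : M) ∈ N.submoduleOf M := h ▸ Submodule.mem_top
      have h3 : (1 : A) ⊗ₜ[W] (algebraMap (𝓞 L) L 1) ∈ N := h2
      rw [map_one] at h3
      refine one_tmul_notMem_idealLattice ρ hρ q hq.ne_top (p := p ^ (0 + 1)) (fun c hc => ?_) h3
      rw [zero_add, pow_one] at hc
      exact ⟨j c, hc, rfl⟩
  have hsum : ∀ i : ℕ, ∃ k : ℕ, chi0 A (idealLattice A W (p ^ 0)) =
      chi0 A (idealLattice A W (p ^ i)) + k • chi0 A T ∧ (i ≠ 0 → k ≠ 0) := by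
    intro i
    induction i with
    | zero => exact ⟨0, by simp, fun h => absurd rfl h⟩
    | succ i ih =>
      obtain ⟨k, hk, hk0⟩ := ih
      obtain ⟨l, hl, hl0⟩ := hstep i
      refine ⟨l + k, by rw [hk, hl, add_assoc, add_smul], fun _ => ?_⟩
      by_cases hi : i = 0
      · have := hl0 hi
        omega
      · have := hk0 hi
        omega
  obtain ⟨k, hk, hk0⟩ := hsum n
  -- The lattice of the principal ideal `pⁿ` is isomorphic to that of the unit ideal; their classes
  -- cancel and leave `k [T] = 0` with `k ≠ 0`.
  obtain ⟨e⟩ := idealLattice_span_equiv (A := A) (W := W) hc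
  rw [hpc, ← chi0_congr e, pow_zero, Ideal.one_eq_top, left_eq_add] at hk
  exact isOfFinAddOrder_iff_nsmul_eq_zero.2 ⟨k, Nat.pos_of_ne_zero (hk0 hn), hk⟩

end SimpleTorsion

/-! ### Group rings over Dedekind domains -/

section Density

/-- Over a finite algebra, two non-isomorphic simple modules are separated by an element. -/
lemma exists_smul_eq_self_smul_eq_zero (R : Type*) [CommRing R] {A : Type*} [Ring A] [Algebra R A]
    [Module.Finite R A] (S T : Type*) [AddCommGroup S] [Module A S] [IsSimpleModule A S]
    [AddCommGroup T] [Module A T] [IsSimpleModule A T] (h : IsEmpty (S ≃ₗ[A] T)) :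
    ∃ a : A, (∀ x : S, a • x = x) ∧ ∀ y : T, a • y = 0 := by
  have hST : ∀ φ : S →ₗ[A] T, φ = 0 := fun φ => by
    rcases LinearMap.bijective_or_eq_zero φ with hφ | hφ
    · exact (h.false (LinearEquiv.ofBijective φ hφ)).elim
    · exact hφ
  have hTS : ∀ φ : T →ₗ[A] S, φ = 0 := fun φ => by
    rcases LinearMap.bijective_or_eq_zero φ with hφ | hφ
    · exact (h.false (LinearEquiv.ofBijective φ hφ).symm).elim
    · exact hφ
  -- As there are no nonzero maps between `S` and `T`, the projection to `S` commutes with all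
  -- `A`-endomorphisms of `S × T`. Density realizes it by an element of `A` on a finite set of
  -- `R`-generators, hence everywhere.
  let f : Module.End (Module.End A (S × T)) (S × T) :=
    { toFun := fun x => (x.1, 0)
      map_add' := fun x y => by simp
      map_smul' := fun φ x => by
        have h1 := LinearMap.congr_fun (hST (LinearMap.snd A S T ∘ₗ φ ∘ₗ LinearMap.inl A S T)) x.1
        have h2 := LinearMap.congr_fun (hTS (LinearMap.fst A S T ∘ₗ φ ∘ₗ LinearMap.inr A S T)) x.2
        have h3 : φ x = φ (x.1, 0) + φ (0, x.2) := by rw [← map_add]; simp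
        refine Prod.ext ?_ ?_
        · change (φ x).1 = (φ (x.1, 0)).1
          rw [h3, Prod.fst_add]
          exact add_eq_left.2 h2
        · exact h1.symm }
  let : Module R (S × T) := Module.compHom _ (algebraMap R A)
  have : IsScalarTower R A (S × T) := .of_algebraMap_smul fun _ _ => rfl
  have : Module.Finite R (S × T) := Module.Finite.trans A _
  obtain ⟨s, hs⟩ := Module.Finite.fg_top (R := R) (M := S × T)
  have hsup := IsSemisimpleModule.sup (R := A)
    (IsSemisimpleModule.range (LinearMap.inl A S T)) (IsSemisimpleModule.range (LinearMap.inr A S T))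
  rw [LinearMap.sup_range_inl_inr] at hsup
  have : IsSemisimpleModule A (S × T) := .congr Submodule.topEquiv.symm
  obtain ⟨a, ha⟩ := jacobson_density (R := A) f s
  have key : ∀ x : S × T, f x = a • x := by
    intro x
    have hx : x ∈ Submodule.span R (s : Set (S × T)) := hs ▸ Submodule.mem_top
    induction hx using Submodule.span_induction with
    | mem x hx => exact ha x hx
    | zero => rw [map_zero, smul_zero]
    | add x y _ _ hx hy => rw [map_add, smul_add, hx, hy]
    | smul r x _ hx =>
      have h1 : f (algebraMap R A r • x) = algebraMap R A r • f x := by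
        refine Prod.ext rfl ?_
        exact (smul_zero _).symm
      change f (algebraMap R A r • x) = a • algebraMap R A r • x
      rw [h1, hx, algebraMap_smul_comm]
  refine ⟨a, fun x => ?_, fun y => ?_⟩
  · exact (congrArg Prod.fst (key (x, 0))).symm
  · exact (congrArg Prod.snd (key (0, y))).symm

end Density

/-! ### Conjugation averages and the centre of the group ring -/

section GroupRing

variable {R : Type u} [CommRing R] {G : Type v} [Group G] [Finite G]

instance : Module.Finite R (MonoidAlgebra R G) :=
  Module.Finite.equiv (MonoidAlgebra.coeffLinearEquiv (R := R) (S := R) (M := G)).symm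

/-- The average of the conjugates of an element of the group ring. -/
def conjAverage (h : IsUnit (Nat.card G : R)) (a : MonoidAlgebra R G) : MonoidAlgebra R G :=
  letI := Fintype.ofFinite G
  ((h.unit⁻¹ : Rˣ) : R) • ∑ g : G, MonoidAlgebra.single g 1 * a * MonoidAlgebra.single g⁻¹ 1

variable (h : IsUnit (Nat.card G : R))
include h

lemma conjAverage_mem_center (a : MonoidAlgebra R G) :
    conjAverage h a ∈ Subring.center (MonoidAlgebra R G) := by
  let := Fintype.ofFinite G
  rw [Subring.mem_center_iff]
  intro b
  induction b using MonoidAlgebra.induction_linear with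
  | zero => simp
  | add x y hx hy => rw [add_mul, mul_add, hx, hy]
  | single k r =>
    have hk : (MonoidAlgebra.single k r : MonoidAlgebra R G) = r • MonoidAlgebra.single k 1 := by
      rw [MonoidAlgebra.smul_single, smul_eq_mul, mul_one]
    rw [hk, conjAverage, smul_mul_assoc, mul_smul_comm, mul_smul_comm, smul_mul_assoc,
      Finset.mul_sum, Finset.sum_mul]
    congr 2
    refine Fintype.sum_equiv (Equiv.mulLeft k) (M := MonoidAlgebra R G) _ _ fun g => ?_
    rw [Equiv.coe_mulLeft, mul_assoc _ (MonoidAlgebra.single (k * g)⁻¹ 1),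
      MonoidAlgebra.single_mul_single, mul_inv_rev, inv_mul_cancel_right, ← mul_assoc, ← mul_assoc,
      MonoidAlgebra.single_mul_single, mul_one]

/-- Averaging fixes central elements. -/
lemma conjAverage_eq_self {a : MonoidAlgebra R G} (ha : a ∈ Subring.center (MonoidAlgebra R G)) :
    conjAverage h a = a := by
  let := Fintype.ofFinite G
  have h1 : ∀ g : G, MonoidAlgebra.single g (1 : R) * a * MonoidAlgebra.single g⁻¹ 1 = a := fun g => by
    rw [Subring.mem_center_iff.1 ha, mul_assoc, MonoidAlgebra.single_mul_single, mul_inv_cancel,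
      one_mul, ← MonoidAlgebra.one_def, mul_one]
  rw [conjAverage, Finset.sum_congr rfl fun g _ => h1 g, Finset.sum_const, Finset.card_univ,
    ← Nat.card_eq_fintype_card, ← Nat.cast_smul_eq_nsmul R, smul_smul]
  have h2 : ((h.unit⁻¹ : Rˣ) : R) * (Nat.card G : R) = 1 := h.unit.inv_mul
  rw [h2, one_smul]

/-- Averaging, as a linear map to the centre. -/
def centralAverage :
    MonoidAlgebra R G →ₗ[Subring.center (MonoidAlgebra R G)]
      Subring.center (MonoidAlgebra R G) where
  toFun a := ⟨conjAverage h a, conjAverage_mem_center h a⟩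
  map_add' a b := Subtype.ext (by
    simp only [conjAverage, mul_add, add_mul, Finset.sum_add_distrib, smul_add]
    rfl)
  map_smul' z a := Subtype.ext (by
    change conjAverage h (z.1 * a) = z.1 * conjAverage h a
    rw [conjAverage, conjAverage, mul_smul_comm, Finset.mul_sum]
    congr 2
    ext1 g
    rw [← mul_assoc, ← mul_assoc, ← mul_assoc, Subring.mem_center_iff.1 z.2])

lemma centralAverage_one : centralAverage h 1 = 1 :=
  Subtype.ext (conjAverage_eq_self h (one_mem _))

lemma conjAverage_smul_eq_zero {T : Type*} [AddCommGroup T] [Module (MonoidAlgebra R G) T]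
    {a : MonoidAlgebra R G} (ha : ∀ x : T, a • x = 0) (x : T) : conjAverage h a • x = 0 := by
  rw [conjAverage, Algebra.smul_def, mul_smul, Finset.sum_smul, Finset.sum_eq_zero, smul_zero]
  exact fun g _ => by rw [mul_smul, mul_smul, ha, smul_zero]

lemma conjAverage_smul_eq_self {T : Type*} [AddCommGroup T] [Module (MonoidAlgebra R G) T]
    {a : MonoidAlgebra R G} (ha : ∀ x : T, a • x = x) (x : T) : conjAverage h a • x = x := by
  have h1 := conjAverage_smul_eq_zero h (T := T) (a := 1 - a)
    (fun x => by rw [sub_smul, ha, one_smul, sub_self]) x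
  have h2 : conjAverage h (1 - a) = conjAverage h 1 - conjAverage h a :=
    congrArg Subtype.val (map_sub (centralAverage h) 1 a)
  rwa [h2, conjAverage_eq_self h (one_mem _), sub_smul, one_smul, sub_eq_zero, eq_comm] at h1

/-- Simple modules over a group ring are determined by their central annihilators, if the order
of the group is invertible. -/
lemma nonempty_linearEquiv_of_center {S T : Type*} [AddCommGroup S] [Module (MonoidAlgebra R G) S]
    [IsSimpleModule (MonoidAlgebra R G) S] [AddCommGroup T] [Module (MonoidAlgebra R G) T]
    [IsSimpleModule (MonoidAlgebra R G) T]
    (hST : ∀ z ∈ Subring.center (MonoidAlgebra R G), (∀ x : T, z • x = 0) → ∀ x : S, z • x = 0) :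
    Nonempty (S ≃ₗ[MonoidAlgebra R G] T) := by
  by_contra hne
  rw [not_nonempty_iff] at hne
  -- The conjugation average of `a` is central and still acts as `1` on `S` and as `0` on `T`.
  obtain ⟨a, ha, ha'⟩ := exists_smul_eq_self_smul_eq_zero R S T hne
  have := IsSimpleModule.nontrivial (MonoidAlgebra R G) S
  obtain ⟨x, hx⟩ := exists_ne (0 : S)
  refine hx ?_
  rw [← conjAverage_smul_eq_self h ha x]
  exact hST _ (conjAverage_mem_center h a) (conjAverage_smul_eq_zero h ha') x

end GroupRing

section Dedekind

variable (R : Type u) [CommRing R] [IsDedekindDomain R] (G : Type v) [Group G] [Finite G]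

/-- Over a Dedekind domain finitely generated torsion free modules are projective; averaging lifts
this to the group ring. -/
lemma isHereditaryOrder_monoidAlgebra (h : IsUnit (Nat.card G : R)) :
    IsHereditaryOrder R (MonoidAlgebra R G) where
  torsionFree r hr x hx := by
    rw [smul_eq_mul, ← Algebra.smul_def] at hx
    exact (smul_eq_zero.1 hx).resolve_left hr
  projective N _ _ _ hN := by
    let : Module R N := Module.compHom N (algebraMap R (MonoidAlgebra R G))
    have : IsScalarTower R (MonoidAlgebra R G) N := .of_algebraMap_smul fun _ _ => rfl
    have : Module.Finite R N := Module.Finite.trans (MonoidAlgebra R G) N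
    have : Module.IsTorsionFree R N := by
      rw [Module.isTorsionFree_iff_smul_eq_zero]
      exact fun r x hx => or_iff_not_imp_left.2 fun hr => hN r hr x hx
    have : Module.FinitePresentation R N := Module.finitePresentation_of_finite R N
    have : Module.Projective R N := Module.Flat.projective_of_finitePresentation
    exact projective_monoidAlgebra h

/-- The trace map of a group ring over a ring of algebraic numbers is rationally injective, if
the order of the group is invertible. -/
theorem rat_trace_injective_of_isDedekindDomain (F : Type w) [Field F] [NumberField F] [Algebra R F]
    [IsFractionRing R F] (h : IsUnit (Nat.card G : R)) :
    Function.Injective (rat (trace (MonoidAlgebra R G))) := by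
  have := isHereditaryOrder_monoidAlgebra R G h
  have := isHereditary_of_isHereditaryOrder R (A := MonoidAlgebra R G)
  -- The centre serves as `W`; conjugation averaging is the `W`-linear retraction that keeps
  -- lattices of proper ideals proper.
  let W := Subring.center (MonoidAlgebra R G)
  let : Algebra R W := ((algebraMap R (MonoidAlgebra R G)).codRestrict W fun r =>
    Subring.mem_center_iff.2 fun b => (Algebra.commutes r b).symm).toAlgebra
  have : IsScalarTower R W (MonoidAlgebra R G) := .of_algebraMap_eq fun r => rfl
  have : Module.Finite R W := Module.Finite.of_injective
    ((Algebra.linearMap W (MonoidAlgebra R G)).restrictScalars R) Subtype.val_injective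
  have htf : ∀ r : R, r ≠ 0 → ∀ x : W, r • x = 0 → x = 0 := fun r hr x hx => by
    refine Subtype.ext (IsHereditaryOrder.torsionFree (A := MonoidAlgebra R G) r hr _ ?_)
    rw [Algebra.smul_def] at hx
    exact congrArg Subtype.val hx
  refine rat_injective_of_torsion _ fun x hx => mem_torsion_of_trace_eq_zero R _ F ?_ x hx
  intro X _ _ _ r hr hX
  refine chi0_mem_of_isFiniteLength (isFiniteLength_of_smul_eq_zero hr hX)
    {algebraMap R (MonoidAlgebra R G) r} (by rintro _ rfl; exact hX) _ fun T _ _ _ hT => ?_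
  exact chi0_mem_torsion_of_isSimpleModule R F (W := W) htf (centralAverage h)
    (centralAverage_one h) T
    (fun S _ _ _ hS => nonempty_linearEquiv_of_center h fun z hz => hS ⟨z, hz⟩) hr (hT _ rfl)

end Dedekind

end BurnsideTrace

end

theorem proposition2p2
    {G : Type*} [Group G] [Finite G]
    {C : Type*} [Group C] [Finite C] [IsCyclic C] :
    -- case (i): a finite dimensional semisimple algebra over a field of characteristic zero
    (∀ (F : Type*) [Field F] [CharZero F] (R : Type*) [Ring R] [Algebra F R]
        [FiniteDimensional F R] [IsSemisimpleRing R],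
      Function.Injective (BurnsideTrace.trace (MonoidAlgebra R G)) ∧
      Function.Injective (BurnsideTrace.thetaTrace R C) ∧
      (Nontrivial R → Nontrivial (LinearMap.range (BurnsideTrace.thetaK0 R C)))) ∧
    -- case (ii): a commutative complete local domain of characteristic zero
    (∀ (R : Type*) [CommRing R] [IsDomain R] [CharZero R] [IsLocalRing R]
        [IsAdicComplete (IsLocalRing.maximalIdeal R) R],
      Function.Injective (BurnsideTrace.trace (MonoidAlgebra R G)) ∧
      Function.Injective (BurnsideTrace.thetaTrace R C)) ∧
    -- case (iii): a Dedekind domain whose quotient field is a number field, with the order of the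
    -- group invertible
    (∀ (R : Type*) [CommRing R] [IsDedekindDomain R] (F : Type*) [Field F] [NumberField F]
        [Algebra R F] [IsFractionRing R F],
      (IsUnit (Nat.card G : R) →
        Function.Injective
          (BurnsideTrace.rat (BurnsideTrace.trace (MonoidAlgebra R G)))) ∧
      (IsUnit (Nat.card C : R) →
        Function.Injective (BurnsideTrace.thetaTrace R C) ∧
        Nontrivial (LinearMap.range (BurnsideTrace.thetaK0 R C)))) := by
  refine ⟨fun F _ _ R _ _ _ _ => ?_, fun R _ _ _ _ _ => ?_, fun R _ _ F _ _ _ _ => ?_⟩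
  · exact ⟨BurnsideTrace.trace_injective_monoidAlgebra_of_isSemisimpleRing F R G,
      BurnsideTrace.thetaTrace_injective (BurnsideTrace.rat_injective
        (BurnsideTrace.trace_injective_monoidAlgebra_of_isSemisimpleRing F R C)),
      fun _ => BurnsideTrace.nontrivial_range_thetaK0_of_algebra F R C⟩
  · exact ⟨BurnsideTrace.trace_injective_of_isAdicComplete R G,
      BurnsideTrace.thetaTrace_injective (BurnsideTrace.rat_injective
        (BurnsideTrace.trace_injective_of_isAdicComplete R C))⟩
  · refine ⟨fun h => BurnsideTrace.rat_trace_injective_of_isDedekindDomain R G F h,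
      fun h => ⟨BurnsideTrace.thetaTrace_injective
        (BurnsideTrace.rat_trace_injective_of_isDedekindDomain R C F h), ?_⟩⟩
    -- Here `R` is commutative, so the map to its fraction field already serves as trace functional.
    exact BurnsideTrace.nontrivial_range_thetaK0 (algebraMap R F).toAddMonoidHom
      (fun a b => by rw [mul_comm]) (by simp) h
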